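/- Let $(M,g)$ be a connected smooth $n$-dimensional manifold, $n\ge 1$, with a smooth metric $g_{ij}$ (nondegenerate, of any signature), let $\Gamma^i=g^{jk}\Gamma^i_{jk}$, where $\Gamma^i_{jk}$ are the Christoffel symbols of $g$, and let $J\subseteq\mathbb R$ be an open interval. Consider, for $u=u(t,x)$ on $J\times M$, the homogeneous heat equation $$H:=g^{ij}u_{ij}-\Gamma^i u_i-u_t=0 ,$$ where $u_i,u_{ij}$ are partial derivatives in local coordinates. A Lie point symmetry is a smooth vector field $X=\xi^t\partial_t+\xi^i\partial_i+\eta\,\partial_u$ on $J\times M\times\mathbb R$, with components depending on $(t,x,u)$, whose second prolongation satisfies $X^{[2]}H=\lambda H$ for some function $\lambda$ of $t$, $x$, $u$ and the first derivatives of $u$. A smooth vector field $Y$ on $M$ with $\mathcal L_Y g=2\psi g$, $\psi$ constant, is a Killing vector (KV) if $\psi=0$ and a homothetic vector (HV) if $\psi\neq0$; it is gradient if $Y^i=S^{,i}=g^{ij}S_{,j}$ for some smooth function $S$ on $M$. Then the Lie point symmetries of the heat equation are constructed from the homothetic algebra of $g$ as follows. (a) If $Y$ is a nongradient HV/KV with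 constant $\psi$, then the Lie point symmetries whose $M$-component has the form $T(t)Y^i\partial_i$ are exactly the vector fields $$X=(2\psi c_1t+c_2)\,\partial_t+c_1Y^i\partial_i+(a_0u+b(t,x))\,\partial_u ,$$ where $c_1,c_2,a_0$ are arbitrary constants and $b$ is an arbitrary smooth solution of the heat equation on $J\times M$. (b) If $Y^i=S^{,i}$ is a gradient HV/KV with constant $\psi$, then the Lie point symmetries whose $M$-component has the form $T(t)S^{,i}\partial_i$ are exactly the vector fields $$X=(c_3\psi t^2+2c_4\psi t+c_5)\,\partial_t+(c_3t+c_4)S^{,i}\partial_i+\Big(-\frac{c_3}{2}S-\frac{c_3}{2}n\psi t+c_6\Big)u\,\partial_u+b(t,x)\,\partial_u ,$$ where $c_3,c_4,c_5,c_6$ are arbitrary constants and $b$ is an arbitrary smooth solution of the heat equation on $J\times M$. (c) Every Lie point symmetry is a sum of symmetries of these kinds: the Lie point symmetries are exactly the vector fields $$X=(\varphi t^2+2\psi t+c)\,\partial_t+(Y^i+t\,S^{,i})\,\partial_i+\Big(\Big(-\frac12S-\frac12n\varphi t+a_0\Big)u+b(t,x)\Big)\partial_u ,$$ where $Y$ is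 a vector field with $\mathcal L_Yg=2\psi g$, $S$ is a smooth function whose gradient $Z^i=S^{,i}$ satisfies $\mathcal L_Zg=2\varphi g$ ($\psi,\varphi$ constants; $Y=0$ and $Z=0$ are allowed), $c,a_0$ are constants, and $b$ is a smooth solution of the heat equation on $J\times M$. -/

import Mathlib

open scoped Manifold ContDiff

noncomputable section

/-! ### Lie point symmetries of scalar second order equations

Independent variables `z : ι → ℝ`, one dependent variable `u`, first derivatives `p i = u_i`,
second derivatives `q i j = u_{ij}`. -/

namespace PointSymmetry

variable {ι : Type*} [Fintype ι] [DecidableEq ι]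

/-- Total derivative `D_i f = f_{,i} + u_i f_u` of a function `f(z, u)`. -/
def totalDeriv (f : (ι → ℝ) × ℝ → ℝ) (i : ι) (z : ι → ℝ) (u : ℝ) (p : ι → ℝ) : ℝ :=
  fderiv ℝ f (z, u) (Pi.single i 1, p i)

/-- Total derivative `D_i F = F_{,i} + u_i F_u + ∑ k, u_{ik} F_{u_k}` of a function `F(z, u, p)`. -/
def totalDeriv₁ (F : (ι → ℝ) × ℝ × (ι → ℝ) → ℝ) (i : ι)
    (z : ι → ℝ) (u : ℝ) (p : ι → ℝ) (q : ι → ι → ℝ) : ℝ :=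
  fderiv ℝ F (z, u, p) (Pi.single i 1, p i, q i)

/-- First prolongation coefficient `η_i = D_i η - ∑ j, u_j D_i ξ^j`. -/
def prolong₁ (ξ : ι → (ι → ℝ) × ℝ → ℝ) (η : (ι → ℝ) × ℝ → ℝ) (i : ι)
    (w : (ι → ℝ) × ℝ × (ι → ℝ)) : ℝ :=
  totalDeriv η i w.1 w.2.1 w.2.2 - ∑ j, w.2.2 j * totalDeriv (ξ j) i w.1 w.2.1 w.2.2

/-- Second prolongation coefficient `η_{ij} = D_j η_i - ∑ k, u_{ik} D_j ξ^k`. -/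
def prolong₂ (ξ : ι → (ι → ℝ) × ℝ → ℝ) (η : (ι → ℝ) × ℝ → ℝ) (i j : ι)
    (z : ι → ℝ) (u : ℝ) (p : ι → ℝ) (q : ι → ι → ℝ) : ℝ :=
  totalDeriv₁ (prolong₁ ξ η i) j z u p q - ∑ k, q i k * totalDeriv (ξ k) j z u p

/-- `X^{[2]} H`, the second prolongation of `X = ξ^i ∂_i + η ∂_u` applied to `H(z, u, u_i, u_{ij})`. -/
def prolongApply (ξ : ι → (ι → ℝ) × ℝ → ℝ) (η : (ι → ℝ) × ℝ → ℝ)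
    (H : (ι → ℝ) × ℝ × (ι → ℝ) × (ι → ι → ℝ) → ℝ)
    (z : ι → ℝ) (u : ℝ) (p : ι → ℝ) (q : ι → ι → ℝ) : ℝ :=
  fderiv ℝ H (z, u, p, q)
    ((fun i => ξ i (z, u)), η (z, u), (fun i => prolong₁ ξ η i (z, u, p)),
      (fun i j => prolong₂ ξ η i j z u p q))

/-- The symmetry condition `X^{[2]} H = λ H` with a multiplier `λ(z, u, u_i)`, over base points in
`Ω` and for all values of the jet variables (`u_{ij}` being symmetric). -/
def SatisfiesSymmetryCondition (Ω : Set (ι → ℝ))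
    (H : (ι → ℝ) × ℝ × (ι → ℝ) × (ι → ι → ℝ) → ℝ)
    (ξ : ι → (ι → ℝ) × ℝ → ℝ) (η : (ι → ℝ) × ℝ → ℝ) : Prop :=
  ∃ mult : (ι → ℝ) × ℝ × (ι → ℝ) → ℝ,
    ∀ z ∈ Ω, ∀ (u : ℝ) (p : ι → ℝ) (q : ι → ι → ℝ), (∀ i j, q i j = q j i) →
      prolongApply ξ η H z u p q = mult (z, u, p) * H (z, u, p, q)

/-- Partial derivative. -/
def partialDeriv (i : ι) (f : (ι → ℝ) → ℝ) (z : ι → ℝ) : ℝ := fderiv ℝ f z (Pi.single i 1)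

/-- `f` satisfies the equation `H(z, u, u_i, u_{ij}) = 0` at the points of `Ω`. -/
def SatisfiesPDE (Ω : Set (ι → ℝ)) (H : (ι → ℝ) × ℝ × (ι → ℝ) × (ι → ι → ℝ) → ℝ)
    (f : (ι → ℝ) → ℝ) : Prop :=
  ∀ z ∈ Ω, H (z, f z, (fun i => partialDeriv i f z),
    (fun i j => partialDeriv j (partialDeriv i f) z)) = 0

end PointSymmetry

open PointSymmetry

/-! ### Metrics, homothetic vectors and the heat equation -/

variable {n : ℕ} {M : Type*} [TopologicalSpace M] [ChartedSpace (Fin n → ℝ) M]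

/-- The tangent space of an `n`-dimensional manifold `M` at `x`. -/
abbrev TSpace (n : ℕ) {M : Type*} [TopologicalSpace M] [ChartedSpace (Fin n → ℝ) M] (x : M) :
    Type := TangentSpace 𝓘(ℝ, Fin n → ℝ) x

/-- The coordinate vector `∂_i` of the chart `e` at the point with coordinates `y`. -/
def coordVec (e : OpenPartialHomeomorph M (Fin n → ℝ)) (y : Fin n → ℝ) (i : Fin n) :
    TSpace n (e.symm y) :=
  mfderiv 𝓘(ℝ, Fin n → ℝ) 𝓘(ℝ, Fin n → ℝ) e.symm y (Pi.single i (1 : ℝ) : Fin n → ℝ)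

/-- The components `v^i` of a tangent vector `v` at `x` in the chart `e`. -/
def vecComp (e : OpenPartialHomeomorph M (Fin n → ℝ)) (x : M) (v : TSpace n x) : Fin n → ℝ :=
  mfderiv 𝓘(ℝ, Fin n → ℝ) 𝓘(ℝ, Fin n → ℝ) e x v

/-- The spatial part of a point with coordinates `(t, x^i)`. These are indexed by `Option (Fin n)`:
`none` stands for `t` and `some i` for `x^i`. -/
def spacePart (z : Option (Fin n) → ℝ) : Fin n → ℝ := fun i => z (some i)

/-- The coordinate domain of `J × M` given by the chart `e` of `M`. -/
def chartDomain (J : Set ℝ) (e : OpenPartialHomeomorph M (Fin n → ℝ)) :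
    Set (Option (Fin n) → ℝ) :=
  {z | z none ∈ J ∧ spacePart z ∈ e.target}

variable (n M) in
/-- A smooth metric of arbitrary signature: a smooth field of nondegenerate symmetric bilinear forms
on the tangent spaces. -/
structure MetricTensor where
  form : ∀ x : M, TSpace n x →ₗ[ℝ] TSpace n x →ₗ[ℝ] ℝ
  symm : ∀ x v w, form x v w = form x w v
  nondegenerate : ∀ x v, (∀ w, form x v w = 0) → v = 0
  smooth : ∀ e ∈ atlas (Fin n → ℝ) M, ∀ i j : Fin n,
    ContDiffOn ℝ ∞ (fun y => form (e.symm y) (coordVec e y i) (coordVec e y j)) e.target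

namespace MetricTensor

variable (g : MetricTensor n M) (e : OpenPartialHomeomorph M (Fin n → ℝ))

/-- The matrix `g_{ij}` in a chart. -/
def lower (y : Fin n → ℝ) : Matrix (Fin n) (Fin n) ℝ :=
  Matrix.of fun i j => g.form (e.symm y) (coordVec e y i) (coordVec e y j)

/-- The inverse matrix `g^{ij}`. -/
def upper (y : Fin n → ℝ) : Matrix (Fin n) (Fin n) ℝ := (g.lower e y)⁻¹

/-- The Christoffel symbols `Γ^i_{jk}` of the Levi-Civita connection. -/
def christoffel (y : Fin n → ℝ) (i j k : Fin n) : ℝ :=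
  (1 / 2) * ∑ r, g.upper e y i r *
    (partialDeriv k (fun y => g.lower e y j r) y + partialDeriv j (fun y => g.lower e y k r) y
      - partialDeriv r (fun y => g.lower e y j k) y)

/-- `Γ^i = g^{jk} Γ^i_{jk}`. -/
def gammaTrace (y : Fin n → ℝ) (i : Fin n) : ℝ :=
  ∑ j, ∑ k, g.upper e y j k * g.christoffel e y i j k

/-- The homogeneous heat equation `g^{ij} u_{ij} - Γ^i u_i - u_t = 0` in a chart: the left side as a
function of `(t, x^i)`, `u`, the first and the second derivatives. -/
def heat (w : (Option (Fin n) → ℝ) × ℝ × (Option (Fin n) → ℝ) ×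
    (Option (Fin n) → Option (Fin n) → ℝ)) : ℝ :=
  (∑ i, ∑ j, g.upper e (spacePart w.1) i j * w.2.2.2 (some i) (some j))
    - (∑ i, g.gammaTrace e (spacePart w.1) i * w.2.2.1 (some i)) - w.2.2.1 none

/-- `b(t, x)` is a smooth solution on `J × M` of the homogeneous heat equation. -/
def IsHeatSolution (J : Set ℝ) (b : ℝ → M → ℝ) : Prop :=
  ∀ e ∈ atlas (Fin n → ℝ) M,
    ContDiffOn ℝ ∞ (fun z : Option (Fin n) → ℝ => b (z none) (e.symm (spacePart z)))
      (chartDomain J e) ∧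
    SatisfiesPDE (chartDomain J e) (g.heat e)
      (fun z => b (z none) (e.symm (spacePart z)))

/-- `Y` is a smooth vector field with `L_Y g = 2 ψ g` for the constant `ψ`: a Killing vector if
`ψ = 0`, a homothetic vector if `ψ ≠ 0`. -/
def IsHomothetic (Y : ∀ x : M, TSpace n x) (ψ : ℝ) : Prop :=
  ∀ e ∈ atlas (Fin n → ℝ) M,
    ContDiffOn ℝ ∞ (fun y => vecComp e (e.symm y) (Y (e.symm y))) e.target ∧
    ∀ y ∈ e.target, ∀ i j : Fin n,
      ∑ k, (vecComp e (e.symm y) (Y (e.symm y)) k * partialDeriv k (fun y => g.lower e y i j) y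
        + g.lower e y k j * partialDeriv i (fun y => vecComp e (e.symm y) (Y (e.symm y)) k) y
        + g.lower e y i k * partialDeriv j (fun y => vecComp e (e.symm y) (Y (e.symm y)) k) y)
      = 2 * ψ * g.lower e y i j

/-- `Y` is the gradient `S^{,i}` of the smooth function `S`. -/
def IsGradient (Y : ∀ x : M, TSpace n x) (S : M → ℝ) : Prop :=
  ContMDiff 𝓘(ℝ, Fin n → ℝ) 𝓘(ℝ, ℝ) ∞ S ∧
    ∀ (x : M) (v : TSpace n x),
      g.form x (Y x) v = (mfderiv 𝓘(ℝ, Fin n → ℝ) 𝓘(ℝ, ℝ) S x v : ℝ)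

end MetricTensor

variable (n M) in
/-- A vector field `X = τ ∂_t + ξ + η ∂_u` in the variables `(t, x, u)`, with `ξ(t, x, u)` tangent
to `M` at `x`. -/
structure PointField where
  τ : ℝ → M → ℝ → ℝ
  ξ : ℝ → ∀ x : M, ℝ → TSpace n x
  η : ℝ → M → ℝ → ℝ

namespace PointField

variable (X : PointField n M) (e : OpenPartialHomeomorph M (Fin n → ℝ))

/-- The components `ξ^t`, `ξ^i` of `X` in a chart. -/
def baseComp : Option (Fin n) → (Option (Fin n) → ℝ) × ℝ → ℝ
  | none, w => X.τ (w.1 none) (e.symm (spacePart w.1)) w.2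
  | some i, w =>
      vecComp e (e.symm (spacePart w.1)) (X.ξ (w.1 none) (e.symm (spacePart w.1)) w.2) i

/-- The component `η` of `X` in a chart. -/
def fibreComp (w : (Option (Fin n) → ℝ) × ℝ) : ℝ :=
  X.η (w.1 none) (e.symm (spacePart w.1)) w.2

/-- `X` is smooth on `J × M × ℝ`. -/
def IsSmooth (J : Set ℝ) : Prop :=
  ∀ e ∈ atlas (Fin n → ℝ) M,
    (∀ k, ContDiffOn ℝ ∞ (X.baseComp e k) (chartDomain J e ×ˢ Set.univ)) ∧
    ContDiffOn ℝ ∞ (X.fibreComp e) (chartDomain J e ×ˢ Set.univ)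

/-- `X` is a smooth Lie point symmetry, on `J × M × ℝ`, of the homogeneous heat equation. -/
def IsHeatSymmetry (g : MetricTensor n M) (J : Set ℝ) : Prop :=
  X.IsSmooth J ∧ ∀ e ∈ atlas (Fin n → ℝ) M,
    SatisfiesSymmetryCondition (chartDomain J e) (g.heat e) (X.baseComp e) (X.fibreComp e)

end PointField

end

/-! At each point the condition X^{[2]}H = λH is affine in the second derivatives of u, since λ does
not involve them. Write τ for the time component of X.

Mixed derivatives u_{ti} do not occur in H, so their coefficients, together with the nondegeneracy
of g, force τ to depend on t alone (`SymmetryConditionAt.time_component`). The coefficients of the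
spatial derivatives u_{ij} form a matrix identity for the derivative of g⁻¹ along ξ. Comparing it
for different values of the first derivatives gives ξ^i_u = 0, λ = η_u - τ_t and L_ξ g = τ_t g, so ξ
is homothetic at each fixed time (`SymmetryConditionAt.projectable`).

A homothety preserves the Levi-Civita connection, which makes the traced Lie derivative of the
Christoffel symbols vanish (`dirDeriv_tracedChristoffel`). Hence all terms in u_{ij} and u_t cancel,
and X^{[2]}H - λH becomes a quadratic polynomial in the u_i
(`IsProjectableHomothetic.prolongApply_sub`). Its coefficients give η_uu = 0, ξ^i_t = -2 g^{ij}
η_{uj}, and the heat equation for η at each fixed u. Conversely these equations make the polynomial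
vanish.

To integrate the system, let Δ = g^{ij}∂_i∂_j - Γ^i∂_i. The field ξ_t is the gradient of -2η_u and
satisfies L_{ξ_t} g = τ_tt g, so Δη_u = -(n/4)τ_tt (`laplacian_of_homothetic_gradient`).
Differentiating the heat equation for η in u gives Δη_u = η_ut. Thus η_ut depends on t only, so ξ_tt
= 0, and then τ_ttt g = L_{ξ_tt} g = 0. Therefore τ is quadratic in t, ξ = Y + tZ with Y homothetic
and Z homothetic and gradient, η_u = -S/2 - nφt/2 + const, and η at u = 0 is the solution b. This is
(c). Parts (a) and (b) are the case where Y and Z are multiples of one field; connectedness of M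
fixes the potential up to a constant.

The geometric lemmas are stated for a matrix function on a normed space with chosen directions `v`,
because they are needed both in a chart of M and on the space of the variables (t, x, u). -/

open PointSymmetry

/-! ### Directional derivatives -/

section DirDeriv

variable {E : Type*} [NormedAddCommGroup E] [NormedSpace ℝ E]

/-- The derivative of `f` at `w` in the direction `v`. -/
noncomputable def dirDeriv (v : E) (f : E → ℝ) (w : E) : ℝ := fderiv ℝ f w v

variable {W : Set E} {f g : E → ℝ} {w v : E}

theorem ContDiffOn.differentiableAt_of_isOpen {F : Type*} [NormedAddCommGroup F] [NormedSpace ℝ F]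
    {f : E → F} (hf : ContDiffOn ℝ ∞ f W) (hW : IsOpen W) (hw : w ∈ W) :
    DifferentiableAt ℝ f w :=
  (hf.contDiffAt (hW.mem_nhds hw)).differentiableAt (by simp)

theorem ContDiffOn.dirDeriv (hf : ContDiffOn ℝ ∞ f W) (hW : IsOpen W) (v : E) :
    ContDiffOn ℝ ∞ (dirDeriv v f) W :=
  (hf.fderiv_of_isOpen hW (m := ∞) (by simp)).clm_apply contDiffOn_const

theorem dirDeriv_add (hf : DifferentiableAt ℝ f w) (hg : DifferentiableAt ℝ g w) :
    dirDeriv v (fun x => f x + g x) w = dirDeriv v f w + dirDeriv v g w := by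
  simp [dirDeriv, fderiv_fun_add hf hg]

theorem dirDeriv_sub (hf : DifferentiableAt ℝ f w) (hg : DifferentiableAt ℝ g w) :
    dirDeriv v (fun x => f x - g x) w = dirDeriv v f w - dirDeriv v g w := by
  simp [dirDeriv, fderiv_fun_sub hf hg]

theorem dirDeriv_mul (hf : DifferentiableAt ℝ f w) (hg : DifferentiableAt ℝ g w) :
    dirDeriv v (fun x => f x * g x) w = dirDeriv v f w * g w + f w * dirDeriv v g w := by
  simp [dirDeriv, fderiv_fun_mul hf hg]; ring

theorem dirDeriv_const_mul (c : ℝ) (hf : DifferentiableAt ℝ f w) :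
    dirDeriv v (fun x => c * f x) w = c * dirDeriv v f w := by
  simp [dirDeriv, fderiv_const_mul hf]

@[simp] theorem dirDeriv_const (c : ℝ) : dirDeriv v (fun _ => c) w = 0 := by
  simp [dirDeriv]

theorem dirDeriv_sum {κ : Type*} {s : Finset κ} {F : κ → E → ℝ}
    (hF : ∀ i ∈ s, DifferentiableAt ℝ (F i) w) :
    dirDeriv v (fun x => ∑ i ∈ s, F i x) w = ∑ i ∈ s, dirDeriv v (F i) w := by
  simp [dirDeriv, fderiv_fun_sum hF]

theorem dirDeriv_congr (hW : IsOpen W) (h : ∀ x ∈ W, f x = g x) (hw : w ∈ W) :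
    dirDeriv v f w = dirDeriv v g w := by
  have : f =ᶠ[nhds w] g := Filter.eventuallyEq_of_mem (hW.mem_nhds hw) h
  simp [dirDeriv, this.fderiv_eq]

theorem dirDeriv_eq_zero (hW : IsOpen W) {c : ℝ} (h : ∀ x ∈ W, f x = c) (hw : w ∈ W) :
    dirDeriv v f w = 0 := by
  rw [dirDeriv_congr hW h hw, dirDeriv_const]

theorem dirDeriv_comm (hf : ContDiffOn ℝ ∞ f W) (hW : IsOpen W) (hw : w ∈ W) (v v' : E) :
    dirDeriv v (dirDeriv v' f) w = dirDeriv v' (dirDeriv v f) w := by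
  have h1 : ContDiffAt ℝ ∞ f w := hf.contDiffAt (hW.mem_nhds hw)
  have h2 : DifferentiableAt ℝ (fderiv ℝ f) w :=
    (hf.fderiv_of_isOpen hW (m := ∞) (by simp)).differentiableAt_of_isOpen hW hw
  have key : ∀ a b : E, dirDeriv a (dirDeriv b f) w = fderiv ℝ (fderiv ℝ f) w a b := by
    intro a b
    have : HasFDerivAt (dirDeriv b f) ((fderiv ℝ (fderiv ℝ f) w).flip b) w := by
      have := h2.hasFDerivAt.clm_apply (hasFDerivAt_const b w)
      simp only [ContinuousLinearMap.comp_zero, zero_add] at this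
      exact this
    simp [dirDeriv, this.fderiv]
  rw [key, key]
  exact (h1.isSymmSndFDerivAt (by simpa using WithTop.coe_le_coe.2 (le_top : (2 : ℕ∞) ≤ ⊤))) v v'

theorem dirDeriv_sum_smul {κ : Type*} (s : Finset κ) (c : κ → ℝ) (v : κ → E) :
    dirDeriv (∑ i ∈ s, c i • v i) f w = ∑ i ∈ s, c i * dirDeriv (v i) f w := by
  simp [dirDeriv]

theorem dirDeriv_comp {F : Type*} [NormedAddCommGroup F] [NormedSpace ℝ F] (L : E →L[ℝ] F)
    {f : F → ℝ} (hf : DifferentiableAt ℝ f (L w)) :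
    dirDeriv v (fun x => f (L x)) w = dirDeriv (L v) f (L w) := by
  have : HasFDerivAt (fun x => f (L x)) ((fderiv ℝ f (L w)).comp L) w :=
    HasFDerivAt.comp w hf.hasFDerivAt L.hasFDerivAt
  simp [dirDeriv, this.fderiv]

end DirDeriv

/-! ### The traced Christoffel symbols along a homothetic field -/

noncomputable section Geometry

variable {E : Type*} [NormedAddCommGroup E] [NormedSpace ℝ E]
variable {ι : Type*} [Fintype ι] [DecidableEq ι]

/-- The Christoffel symbols `Γ_{r,jk}` of the first kind of `G`, with respect to the directions
`v`. -/
def christoffelFirst (G : E → Matrix ι ι ℝ) (v : ι → E) (r : ι) (w : E) : Matrix ι ι ℝ :=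
  Matrix.of fun j k => 1 / 2 * (dirDeriv (v k) (fun x => G x j r) w
    + dirDeriv (v j) (fun x => G x k r) w - dirDeriv (v r) (fun x => G x j k) w)

/-- The trace `g^{jk} Γ^i_{jk}` of the Christoffel symbols of `G`, with respect to the
directions `v`. -/
def tracedChristoffel (G : E → Matrix ι ι ℝ) (v : ι → E) (w : E) (i : ι) : ℝ :=
  ∑ j, ∑ k, (G w)⁻¹ j k * (1 / 2 * ∑ r, (G w)⁻¹ i r * (dirDeriv (v k) (fun x => G x j r) w
    + dirDeriv (v j) (fun x => G x k r) w - dirDeriv (v r) (fun x => G x j k) w))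

/-- The components of the Lie derivative of `G` along the field with components `ξ`, with respect
to the directions `v`. -/
def lieDerivMetric (G : E → Matrix ι ι ℝ) (v : ι → E) (ξ : ι → E → ℝ) (w : E) (i j : ι) : ℝ :=
  ∑ k, (ξ k w * dirDeriv (v k) (fun x => G x i j) w + G w k j * dirDeriv (v i) (ξ k) w
    + G w i k * dirDeriv (v j) (ξ k) w)

/-- Raising the index after the contraction splits the trace into an inverse metric times a vector,
a form suited to the product rule along a field. -/
theorem tracedChristoffel_eq (G : E → Matrix ι ι ℝ) (v : ι → E) (w : E) :
    tracedChristoffel G v w =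
      (G w)⁻¹.mulVec (fun r => ∑ j, ∑ k, (G w)⁻¹ j k * christoffelFirst G v r w j k) := by
  funext i
  simp only [tracedChristoffel, Matrix.mulVec, dotProduct, christoffelFirst, Matrix.of_apply,
    Finset.mul_sum]
  conv_rhs => rw [Finset.sum_comm]
  refine Finset.sum_congr rfl fun j _ => ?_
  conv_rhs => rw [Finset.sum_comm]
  exact Finset.sum_congr rfl fun k _ => Finset.sum_congr rfl fun r _ => by ring

variable {W : Set E} {G : E → Matrix ι ι ℝ} {v : ι → E}

theorem contDiffOn_det (hG : ∀ i j, ContDiffOn ℝ ∞ (fun w => G w i j) W) :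
    ContDiffOn ℝ ∞ (fun w => (G w).det) W := by
  simp only [Matrix.det_apply']
  exact ContDiffOn.sum fun σ _ => contDiffOn_const.mul (contDiffOn_prod fun i _ => hG _ _)

/-- By Cramer's rule the entries are polynomials in the entries of `G` divided by the determinant.
-/
theorem contDiffOn_inv_apply (hG : ∀ i j, ContDiffOn ℝ ∞ (fun w => G w i j) W)
    (hdet : ∀ w ∈ W, IsUnit (G w).det) (i j : ι) :
    ContDiffOn ℝ ∞ (fun w => (G w)⁻¹ i j) W := by
  simp only [Matrix.inv_def, Matrix.smul_apply, Matrix.adjugate_apply, Ring.inverse_eq_inv',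
    smul_eq_mul]
  refine ((contDiffOn_det hG).inv fun w hw => (hdet w hw).ne_zero).mul
    (contDiffOn_det fun a b => ?_)
  by_cases h : a = j
  · subst h; simpa using contDiffOn_const
  · simpa [Matrix.updateRow_ne h] using hG a b

theorem contDiffOn_tracedChristoffel (hW : IsOpen W)
    (hG : ∀ i j, ContDiffOn ℝ ∞ (fun w => G w i j) W)
    (hdet : ∀ w ∈ W, IsUnit (G w).det) (i : ι) :
    ContDiffOn ℝ ∞ (fun w => tracedChristoffel G v w i) W := by
  unfold tracedChristoffel
  exact ContDiffOn.sum fun j _ => ContDiffOn.sum fun k _ =>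
    (contDiffOn_inv_apply hG hdet j k).mul (contDiffOn_const.mul (ContDiffOn.sum fun r _ =>
      (contDiffOn_inv_apply hG hdet i r).mul ((((hG j r).dirDeriv hW _).add
        ((hG k r).dirDeriv hW _)).sub ((hG j k).dirDeriv hW _))))

/-- Entrywise derivative of a matrix valued function. -/
def dirDerivMatrix (V : E) (G : E → Matrix ι ι ℝ) (w : E) : Matrix ι ι ℝ :=
  Matrix.of fun i j => dirDeriv V (fun x => G x i j) w

/-- Obtained by differentiating G⁻¹ G = 1 entrywise and multiplying by G⁻¹ on the right. -/
theorem dirDerivMatrix_inv (hW : IsOpen W) (hG : ∀ i j, ContDiffOn ℝ ∞ (fun w => G w i j) W)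
    (hdet : ∀ w ∈ W, IsUnit (G w).det) {w : E} (hw : w ∈ W) (V : E) :
    dirDerivMatrix V (fun x => (G x)⁻¹) w = -((G w)⁻¹ * dirDerivMatrix V G w * (G w)⁻¹) := by
  have hA := contDiffOn_inv_apply hG hdet
  have h0 : dirDerivMatrix V (fun x => (G x)⁻¹) w * G w + (G w)⁻¹ * dirDerivMatrix V G w = 0 := by
    ext i j
    have h1 : dirDeriv V (fun x => ∑ k, (G x)⁻¹ i k * G x k j) w = 0 := by
      refine dirDeriv_eq_zero hW (c := (1 : Matrix ι ι ℝ) i j) (fun x hx => ?_) hw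
      rw [← Matrix.nonsing_inv_mul _ (hdet x hx), Matrix.mul_apply]
    rw [dirDeriv_sum (fun k _ => (((hA i k).mul (hG k j)).differentiableAt_of_isOpen hW hw))] at h1
    simp only [Matrix.add_apply, Matrix.mul_apply, dirDerivMatrix, Matrix.of_apply,
      Matrix.zero_apply, ← Finset.sum_add_distrib]
    rw [← h1]
    refine Finset.sum_congr rfl fun k _ => ?_
    rw [dirDeriv_mul ((hA i k).differentiableAt_of_isOpen hW hw)
      ((hG k j).differentiableAt_of_isOpen hW hw)]
  calc dirDerivMatrix V (fun x => (G x)⁻¹) w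
      = (dirDerivMatrix V (fun x => (G x)⁻¹) w * G w) * (G w)⁻¹ := by
        rw [Matrix.mul_assoc, Matrix.mul_nonsing_inv _ (hdet w hw), Matrix.mul_one]
    _ = _ := by rw [eq_neg_of_add_eq_zero_left h0, Matrix.neg_mul]

variable {ξ : ι → E → ℝ} {σ : E → ℝ}

/-- The matrix `ξ^i_{,j}`. -/
def jacobianMatrix (v : ι → E) (ξ : ι → E → ℝ) (w : E) : Matrix ι ι ℝ :=
  Matrix.of fun i j => dirDeriv (v j) (ξ i) w

-- The homothety equation solved for the derivative of `G` along the field, so that what follows is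
-- matrix algebra.
omit [DecidableEq ι] in
theorem dirDerivMatrix_of_lieDerivMetric {w : E} 
    (hL : ∀ i j, lieDerivMetric G v ξ w i j = σ w * G w i j) :
    dirDerivMatrix (∑ k, ξ k w • v k) G w = σ w • G w
      - ((jacobianMatrix v ξ w).transpose * G w + G w * jacobianMatrix v ξ w) := by
  ext i j
  have := hL i j
  simp only [lieDerivMetric, Finset.sum_add_distrib] at this
  simp only [dirDerivMatrix, Matrix.of_apply, dirDeriv_sum_smul, Matrix.sub_apply,
    Matrix.smul_apply, smul_eq_mul, Matrix.add_apply, Matrix.mul_apply, Matrix.transpose_apply,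
    jacobianMatrix, ← this]
  have e : ∀ k, dirDeriv (v i) (ξ k) w * G w k j = G w k j * dirDeriv (v i) (ξ k) w := 
    fun k => mul_comm _ _
  simp only [e]; ring

/-- Along a homothetic field `L_ξ g = σ g` the inverse metric satisfies `L_ξ g⁻¹ = -σ g⁻¹`. -/
theorem dirDerivMatrix_inv_of_lieDerivMetric (hW : IsOpen W)
    (hG : ∀ i j, ContDiffOn ℝ ∞ (fun w => G w i j) W)
    (hdet : ∀ w ∈ W, IsUnit (G w).det) {w : E} (hw : w ∈ W)
    (hL : ∀ i j, lieDerivMetric G v ξ w i j = σ w * G w i j) :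
    dirDerivMatrix (∑ k, ξ k w • v k) (fun x => (G x)⁻¹) w =
      (G w)⁻¹ * (jacobianMatrix v ξ w).transpose + jacobianMatrix v ξ w * (G w)⁻¹
        - σ w • (G w)⁻¹ := by
  rw [dirDerivMatrix_inv hW hG hdet hw, dirDerivMatrix_of_lieDerivMetric hL]
  have h1 := Matrix.nonsing_inv_mul _ (hdet w hw)
  have h2 := Matrix.mul_nonsing_inv _ (hdet w hw)
  simp only [Matrix.mul_sub, Matrix.sub_mul, Matrix.mul_add, Matrix.add_mul, Matrix.mul_smul,
    Matrix.smul_mul, h1, Matrix.mul_assoc, h2, Matrix.one_mul, Matrix.mul_one]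
  rw [← Matrix.mul_assoc (G w)⁻¹ (G w), h1, Matrix.one_mul]
  abel

/-- Conversely `L_ξ g⁻¹ = -σ g⁻¹` implies `L_ξ g = σ g`. -/
theorem lieDerivMetric_of_dirDerivMatrix_inv (hW : IsOpen W)
    (hG : ∀ i j, ContDiffOn ℝ ∞ (fun w => G w i j) W)
    (hdet : ∀ w ∈ W, IsUnit (G w).det) {w : E} (hw : w ∈ W)
    (hL : dirDerivMatrix (∑ k, ξ k w • v k) (fun x => (G x)⁻¹) w =
      (G w)⁻¹ * (jacobianMatrix v ξ w).transpose + jacobianMatrix v ξ w * (G w)⁻¹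
        - σ w • (G w)⁻¹) (i j : ι) :
    lieDerivMetric G v ξ w i j = σ w * G w i j := by
  rw [dirDerivMatrix_inv hW hG hdet hw] at hL
  have h1 := Matrix.nonsing_inv_mul _ (hdet w hw)
  have h2 := Matrix.mul_nonsing_inv _ (hdet w hw)
  have h3 : dirDerivMatrix (∑ k, ξ k w • v k) G w = σ w • G w
      - ((jacobianMatrix v ξ w).transpose * G w + G w * jacobianMatrix v ξ w) := by
    -- Sandwiching between two copies of G undoes the formula for the derivative of the inverse.
    have := congrArg (fun X => -(G w * X * G w)) hL
    simp only [Matrix.mul_neg, Matrix.neg_mul, neg_neg, Matrix.mul_assoc, h1, Matrix.mul_one,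
      Matrix.mul_add, Matrix.add_mul, Matrix.mul_sub, Matrix.sub_mul, Matrix.smul_mul,
      Matrix.mul_smul] at this
    simp only [← Matrix.mul_assoc, h2, Matrix.one_mul] at this
    rw [this]; abel
  have := congrFun (congrFun h3 i) j
  simp only [dirDerivMatrix, Matrix.of_apply, dirDeriv_sum_smul, Matrix.sub_apply,
    Matrix.smul_apply, smul_eq_mul, Matrix.add_apply, Matrix.mul_apply, Matrix.transpose_apply,
    jacobianMatrix] at this
  have e : ∀ k, dirDeriv (v i) (ξ k) w * G w k j = G w k j * dirDeriv (v i) (ξ k) w := 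
    fun k => mul_comm _ _
  simp only [lieDerivMetric, Finset.sum_add_distrib, this, e]
  ring

-- The homothety equation differentiated in a direction in which σ is stationary; commuting
-- derivatives puts the derivative along the field on the outside.
omit [DecidableEq ι] in
theorem dirDeriv_dirDeriv_metric (hW : IsOpen W)
    (hG : ∀ i j, ContDiffOn ℝ ∞ (fun w => G w i j) W) (hξ : ∀ k, ContDiffOn ℝ ∞ (ξ k) W)
    (hσ : DifferentiableOn ℝ σ W) 
    (hL : ∀ w ∈ W, ∀ i j, lieDerivMetric G v ξ w i j = σ w * G w i j) {w : E} (hw : w ∈ W)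
    {m : ι} (hσ' : dirDeriv (v m) σ w = 0) (i j : ι) :
    dirDeriv (∑ k, ξ k w • v k) (dirDeriv (v m) (fun x => G x i j)) w =
      σ w * dirDeriv (v m) (fun x => G x i j) w -
      ∑ k, (dirDeriv (v m) (ξ k) w * dirDeriv (v k) (fun x => G x i j) w
        + dirDeriv (v m) (fun x => G x k j) w * dirDeriv (v i) (ξ k) w
        + G w k j * dirDeriv (v m) (dirDeriv (v i) (ξ k)) w
        + dirDeriv (v m) (fun x => G x i k) w * dirDeriv (v j) (ξ k) w
        + G w i k * dirDeriv (v m) (dirDeriv (v j) (ξ k)) w) := by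
  have dG := fun i j => (hG i j).differentiableAt_of_isOpen hW hw
  have dξ := fun k => (hξ k).differentiableAt_of_isOpen hW hw
  have ddG := fun V i j => ((hG i j).dirDeriv hW V).differentiableAt_of_isOpen hW hw
  have ddξ := fun V k => ((hξ k).dirDeriv hW V).differentiableAt_of_isOpen hW hw
  have h := dirDeriv_congr (v := v m) hW (fun x hx => hL x hx i j) hw
  unfold lieDerivMetric at h
  rw [dirDeriv_mul (hσ.differentiableAt (hW.mem_nhds hw)) (dG i j), hσ', zero_mul, zero_add,
    dirDeriv_sum (fun k _ => (((dξ k).fun_mul (ddG _ _ _)).fun_add ((dG _ _).fun_mul (ddξ _ _))).fun_add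
      ((dG _ _).fun_mul (ddξ _ _)))] at h
  rw [← h, ← Finset.sum_sub_distrib, dirDeriv_sum_smul]
  refine Finset.sum_congr rfl fun k _ => ?_
  rw [dirDeriv_add (((dξ k).fun_mul (ddG _ _ _)).fun_add ((dG _ _).fun_mul (ddξ _ _)))
      ((dG _ _).fun_mul (ddξ _ _)),
    dirDeriv_add ((dξ k).fun_mul (ddG _ _ _)) ((dG _ _).fun_mul (ddξ _ _)),
    dirDeriv_mul (dξ k) (ddG _ _ _), dirDeriv_mul (dG _ _) (ddξ _ _),
    dirDeriv_mul (dG _ _) (ddξ _ _), dirDeriv_comm (hG i j) hW hw (v k) (v m)]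
  ring

-- The three derivatives of the metric in Γ_{r,jk} are treated by `dirDeriv_dirDeriv_metric`. Among
-- the second derivatives of ξ, those contracted with G j l and G k l cancel in pairs, and only the
-- ones contracted with G r l survive.
omit [DecidableEq ι] in
theorem dirDeriv_christoffelFirst (hW : IsOpen W)
    (hG : ∀ i j, ContDiffOn ℝ ∞ (fun w => G w i j) W) (hsymm : ∀ w i j, G w i j = G w j i)
    (hξ : ∀ k, ContDiffOn ℝ ∞ (ξ k) W)
    (hσ : DifferentiableOn ℝ σ W) 
    (hL : ∀ w ∈ W, ∀ i j, lieDerivMetric G v ξ w i j = σ w * G w i j) {w : E} (hw : w ∈ W)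
    (hσ' : ∀ m, dirDeriv (v m) σ w = 0) (r j k : ι) :
    dirDeriv (∑ k, ξ k w • v k) (fun x => christoffelFirst G v r x j k) w =
      σ w * christoffelFirst G v r w j k -
      ∑ l, (G w r l * dirDeriv (v k) (dirDeriv (v j) (ξ l)) w
        + dirDeriv (v j) (ξ l) w * christoffelFirst G v r w l k
        + christoffelFirst G v r w j l * dirDeriv (v k) (ξ l) w
        + dirDeriv (v r) (ξ l) w * christoffelFirst G v l w j k) := by
  have ddG := fun V i j => ((hG i j).dirDeriv hW V).differentiableAt_of_isOpen hW hw
  simp only [christoffelFirst, Matrix.of_apply]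
  rw [dirDeriv_const_mul _ (((ddG _ _ _).fun_add (ddG _ _ _)).fun_sub (ddG _ _ _)),
    dirDeriv_sub ((ddG _ _ _).fun_add (ddG _ _ _)) (ddG _ _ _), dirDeriv_add (ddG _ _ _) (ddG _ _ _),
    dirDeriv_dirDeriv_metric hW hG hξ hσ hL hw (hσ' _),
    dirDeriv_dirDeriv_metric hW hG hξ hσ hL hw (hσ' _),
    dirDeriv_dirDeriv_metric hW hG hξ hσ hL hw (hσ' _)]
  have e : ∀ a b c d S1 S2 S3 S4 : ℝ, S1 + S2 - S3 = 2 * S4 →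
      1 / 2 * (d * a - S1 + (d * b - S2) - (d * c - S3)) = d * (1 / 2 * (a + b - c)) - S4 := by
    intro a b c d S1 S2 S3 S4 h; linear_combination (-1 / 2) * h
  refine e _ _ _ _ _ _ _ _ ?_
  rw [← Finset.sum_add_distrib, ← Finset.sum_sub_distrib, Finset.mul_sum]
  refine Finset.sum_congr rfl fun l _ => ?_
  have sG : ∀ a b, (fun x => G x a b) = fun x => G x b a := fun a b => funext fun x => hsymm x a b
  rw [sG l r, sG l k, hsymm w l r, hsymm w l k, 
    dirDeriv_comm (hξ l) hW hw (v j) (v k), dirDeriv_comm (hξ l) hW hw (v r) (v k),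
    dirDeriv_comm (hξ l) hW hw (v r) (v j)]
  ring

end Geometry

/-! ### Traced Christoffel symbols and the Laplacian for homothetic fields -/

noncomputable section HessianTrace

variable {E : Type*} [NormedAddCommGroup E] [NormedSpace ℝ E]
variable {ι : Type*} [Fintype ι] [DecidableEq ι]
variable {W : Set E} {G : E → Matrix ι ι ℝ} {v : ι → E} {ξ : ι → E → ℝ} {σ : E → ℝ}

omit [DecidableEq ι] in
theorem sum_sum_mul_eq_trace (A B : Matrix ι ι ℝ) :
    ∑ j, ∑ k, A j k * B j k = (A * B.transpose).trace := by
  simp [Matrix.trace, Matrix.mul_apply]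

omit [DecidableEq ι] in
/-- Contraction of `L_ξ (g^{jk} C_{jk})`, where `g^{jk}` and `C_{jk}` have the derivatives
`A'`, `C'` in the direction of a homothetic field with Jacobian matrix `B`. -/
theorem contraction_identity (A B C K : Matrix ι ι ℝ) (s : ℝ) :
    ∑ j, ∑ k, ((A * B.transpose + B * A - s • A) j k * C j k
      + A j k * (s • C - (B.transpose * C + C * B + K)) j k) = - ∑ j, ∑ k, A j k * K j k := by
  simp only [Finset.sum_add_distrib]
  rw [sum_sum_mul_eq_trace, sum_sum_mul_eq_trace, sum_sum_mul_eq_trace]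
  simp only [Matrix.sub_mul, Matrix.add_mul, Matrix.mul_add, Matrix.mul_sub,
    Matrix.transpose_sub, Matrix.transpose_add, Matrix.transpose_mul, Matrix.trace_add,
    Matrix.trace_sub, Matrix.smul_mul, Matrix.mul_smul, Matrix.transpose_smul,
    Matrix.transpose_transpose]
  -- The terms A Bᵀ Cᵀ cancel directly; tr (B A Cᵀ) equals tr (A Cᵀ B) by cyclicity.
  rw [Matrix.mul_assoc B, Matrix.trace_mul_comm B, Matrix.mul_assoc, Matrix.mul_assoc]
  ring

/-- For a field with `L_ξ g = σ g`, where `σ` has vanishing derivative in the directions `v`,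
the traced Lie derivative of the Christoffel symbols vanishes. -/
theorem dirDeriv_tracedChristoffel (hW : IsOpen W)
    (hG : ∀ i j, ContDiffOn ℝ ∞ (fun w => G w i j) W) (hsymm : ∀ w i j, G w i j = G w j i)
    (hdet : ∀ w ∈ W, IsUnit (G w).det)
    (hξ : ∀ k, ContDiffOn ℝ ∞ (ξ k) W) (hσ : DifferentiableOn ℝ σ W)
    (hL : ∀ w ∈ W, ∀ i j, lieDerivMetric G v ξ w i j = σ w * G w i j) {w : E} (hw : w ∈ W)
    (hσ' : ∀ m, dirDeriv (v m) σ w = 0) (i : ι) :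
    dirDeriv (∑ k, ξ k w • v k) (fun x => tracedChristoffel G v x i) w =
      ∑ l, dirDeriv (v l) (ξ i) w * tracedChristoffel G v w l - σ w * tracedChristoffel G v w i
      - ∑ j, ∑ k, (G w)⁻¹ j k * dirDeriv (v k) (dirDeriv (v j) (ξ i)) w := by
  set V := ∑ k, ξ k w • v k with hV
  set A := (G w)⁻¹ with hA
  set B := jacobianMatrix v ξ w with hB
  set h : ι → ℝ := fun l => ∑ j, ∑ k, A j k * dirDeriv (v k) (dirDeriv (v j) (ξ l)) w with hh
  let cf : ι → E → ℝ := fun r x => ∑ j, ∑ k, (G x)⁻¹ j k * christoffelFirst G v r x j k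
  set c : ι → ℝ := fun r => cf r w with hc
  have sA := contDiffOn_inv_apply hG hdet
  have sC : ∀ r j k, ContDiffOn ℝ ∞ (fun x => christoffelFirst G v r x j k) W := fun r j k =>
    contDiffOn_const.mul ((((hG j r).dirDeriv hW _).add
        ((hG k r).dirDeriv hW _)).sub ((hG j k).dirDeriv hW _))
  have sAC : ∀ r j k, ContDiffOn ℝ ∞ (fun x => (G x)⁻¹ j k * christoffelFirst G v r x j k) W :=
    fun r j k => (sA j k).mul (sC r j k)
  have sc : ∀ r, ContDiffOn ℝ ∞ (cf r) W := fun r =>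
    ContDiffOn.sum fun j _ => ContDiffOn.sum fun k _ => sAC r j k
  have dA := dirDerivMatrix_inv_of_lieDerivMetric hW hG hdet hw (hL w hw)
  have dc : ∀ r, dirDeriv V (cf r) w = -(G w).mulVec h r - B.transpose.mulVec c r := by
    intro r
    -- The terms acting on the contracted indices `j`, `k` have the shape required by
    -- `contraction_identity` and drop out. The role of `K` is played by the second derivatives of ξ
    -- and the term acting on the free index `r`.
    have h1 : dirDeriv V (cf r) w = ∑ j, ∑ k,
        ((A * B.transpose + B * A - σ w • A) j k * christoffelFirst G v r w j k
          + A j k * (σ w • christoffelFirst G v r w - (B.transpose * christoffelFirst G v r w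
            + christoffelFirst G v r w * B + Matrix.of fun j k => ∑ l,
              (G w r l * dirDeriv (v k) (dirDeriv (v j) (ξ l)) w
              + B l r * christoffelFirst G v l w j k))) j k) := by
      rw [dirDeriv_sum fun j _ => (ContDiffOn.sum fun k _ =>
        sAC r j k).differentiableAt_of_isOpen hW hw]
      refine Finset.sum_congr rfl fun j _ => ?_
      rw [dirDeriv_sum fun k _ => (sAC r j k).differentiableAt_of_isOpen hW hw]
      refine Finset.sum_congr rfl fun k _ => ?_
      rw [dirDeriv_mul ((sA j k).differentiableAt_of_isOpen hW hw)
        ((sC r j k).differentiableAt_of_isOpen hW hw)]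
      congr 2
      · exact congrFun (congrFun dA j) k
      · rw [dirDeriv_christoffelFirst hW hG hsymm hξ hσ hL hw hσ']
        simp only [Matrix.sub_apply, Matrix.smul_apply, smul_eq_mul, Matrix.add_apply,
          Matrix.mul_apply, Matrix.of_apply, Matrix.transpose_apply, hB, jacobianMatrix,
          ← Finset.sum_add_distrib]
        congr 1
        exact Finset.sum_congr rfl fun l _ => by ring
    rw [h1, contraction_identity]
    simp only [Matrix.of_apply, Matrix.mulVec, dotProduct, hh, hc, cf, Finset.mul_sum,
      Matrix.transpose_apply, mul_add, Finset.sum_add_distrib]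
    rw [neg_add, sub_eq_add_neg]
    congr 2
    · conv_rhs => rw [Finset.sum_comm]
      refine Finset.sum_congr rfl fun j _ => ?_
      conv_rhs => rw [Finset.sum_comm]
      exact Finset.sum_congr rfl fun k _ => Finset.sum_congr rfl fun r _ => by ring
    · conv_rhs => rw [Finset.sum_comm]
      refine Finset.sum_congr rfl fun j _ => ?_
      conv_rhs => rw [Finset.sum_comm]
      exact Finset.sum_congr rfl fun k _ => Finset.sum_congr rfl fun r _ => by ring
  have hΓ : ∀ x, tracedChristoffel G v x = (G x)⁻¹.mulVec (fun r => cf r x) :=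
    fun x => tracedChristoffel_eq G v x
  have h2 : dirDeriv V (fun x => tracedChristoffel G v x i) w =
      ((A * B.transpose + B * A - σ w • A).mulVec c +
        A.mulVec (-(G w).mulVec h - B.transpose.mulVec c)) i := by
    simp only [hΓ, Matrix.mulVec, dotProduct, Pi.add_apply]
    rw [dirDeriv_sum fun k _ => ((sA i k).mul (sc k)).differentiableAt_of_isOpen hW hw,
      ← Finset.sum_add_distrib]
    refine Finset.sum_congr rfl fun k _ => ?_
    rw [dirDeriv_mul ((sA i k).differentiableAt_of_isOpen hW hw)
        ((sc k).differentiableAt_of_isOpen hW hw), dc, ← dA]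
    rfl
  -- With Γ = A c, the contributions of A Bᵀ c from the derivatives of A and of c cancel.
  have h3 : (A * B.transpose + B * A - σ w • A).mulVec c +
        A.mulVec (-(G w).mulVec h - B.transpose.mulVec c) =
      B.mulVec (tracedChristoffel G v w) - σ w • tracedChristoffel G v w - h := by
    rw [hΓ w]
    simp only [Matrix.sub_mulVec, Matrix.add_mulVec, Matrix.mulVec_sub, Matrix.mulVec_neg,
      Matrix.mulVec_mulVec, Matrix.smul_mulVec]
    rw [hA, Matrix.nonsing_inv_mul _ (hdet w hw), Matrix.one_mulVec]
    abel
  rw [h2, h3]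
  rfl

/-- The Laplacian of a function whose gradient is homothetic. -/
theorem laplacian_of_homothetic_gradient (hW : IsOpen W)
    (hG : ∀ i j, ContDiffOn ℝ ∞ (fun w => G w i j) W) (hsymm : ∀ w i j, G w i j = G w j i)
    (hdet : ∀ w ∈ W, IsUnit (G w).det) {Z : ι → E → ℝ} {S : E → ℝ} {s : ℝ}
    (hZ : ∀ k, ContDiffOn ℝ ∞ (Z k) W) (hS : ContDiffOn ℝ ∞ S W)
    (hgrad : ∀ w ∈ W, ∀ i, ∑ k, G w i k * Z k w = dirDeriv (v i) S w) {w : E} (hw : w ∈ W)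
    (hL : ∀ i j, lieDerivMetric G v Z w i j = s * G w i j) :
    ∑ i, ∑ j, (G w)⁻¹ i j * dirDeriv (v j) (dirDeriv (v i) S) w
      - ∑ i, tracedChristoffel G v w i * dirDeriv (v i) S w = Fintype.card ι * s / 2 := by
  have dG := fun i j => (hG i j).differentiableAt_of_isOpen hW hw
  have dZ := fun k => (hZ k).differentiableAt_of_isOpen hW hw
  have hess : ∀ i j, dirDeriv (v j) (dirDeriv (v i) S) w =
      ∑ k, (dirDeriv (v j) (fun x => G x i k) w * Z k w + G w i k * dirDeriv (v j) (Z k) w) := by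
    intro i j
    rw [← dirDeriv_congr hW (fun x hx => hgrad x hx i) hw,
      dirDeriv_sum fun k _ => (dG i k).fun_mul (dZ k)]
    exact Finset.sum_congr rfl fun k _ => dirDeriv_mul (dG i k) (dZ k)
  -- Adding the two expressions for the symmetric Hessian produces the Lie derivative of the metric
  -- plus twice a Christoffel term, so the covariant Hessian of S is (s/2) g.
  have hess' : ∀ i j, dirDeriv (v j) (dirDeriv (v i) S) w =
      s / 2 * G w i j + ∑ k, Z k w * christoffelFirst G v k w i j := by
    intro i j
    have h1 : 2 * dirDeriv (v j) (dirDeriv (v i) S) w =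
        s * G w i j + 2 * ∑ k, Z k w * christoffelFirst G v k w i j := by
      calc 2 * dirDeriv (v j) (dirDeriv (v i) S) w
          = dirDeriv (v j) (dirDeriv (v i) S) w + dirDeriv (v i) (dirDeriv (v j) S) w := by
            rw [dirDeriv_comm hS hW hw (v i) (v j)]; ring
        _ = _ := by
            rw [hess i j, hess j i, ← hL i j, lieDerivMetric, Finset.mul_sum,
              ← Finset.sum_add_distrib, ← Finset.sum_add_distrib]
            refine Finset.sum_congr rfl fun k _ => ?_
            rw [hsymm w k j]
            simp only [christoffelFirst, Matrix.of_apply]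
            ring
    linarith
  set c : ι → ℝ := fun r => ∑ j, ∑ k, (G w)⁻¹ j k * christoffelFirst G v r w j k with hc
  have hsymm' : (G w).transpose = G w := by ext i j; exact hsymm w j i
  have t1 : ∑ i, ∑ j, (G w)⁻¹ i j * G w i j = Fintype.card ι := by
    rw [sum_sum_mul_eq_trace, hsymm', Matrix.nonsing_inv_mul _ (hdet w hw), Matrix.trace_one]
  have t2 : ∑ i, ∑ j, (G w)⁻¹ i j * dirDeriv (v j) (dirDeriv (v i) S) w =
      Fintype.card ι * s / 2 + ∑ k, c k * Z k w := by
    have : Fintype.card ι * s / 2 = ∑ i, ∑ j, (G w)⁻¹ i j * (s / 2 * G w i j) := by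
      rw [mul_div_assoc, ← t1, Finset.sum_mul]
      refine Finset.sum_congr rfl fun i _ => ?_
      rw [Finset.sum_mul]
      exact Finset.sum_congr rfl fun j _ => by ring
    rw [this]
    simp only [hess', mul_add, Finset.sum_add_distrib, hc, Finset.sum_mul, Finset.mul_sum]
    congr 1
    conv_rhs => rw [Finset.sum_comm]
    refine Finset.sum_congr rfl fun j _ => ?_
    conv_rhs => rw [Finset.sum_comm]
    exact Finset.sum_congr rfl fun k _ => Finset.sum_congr rfl fun r _ => by ring
  -- Since S_{,i} = g_{ik} Z^k, the first order part of the Laplacian is exactly the Christoffel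
  -- term of the traced Hessian; what remains is (s/2) tr (g⁻¹ g).
  have t3 : ∑ i, tracedChristoffel G v w i * dirDeriv (v i) S w = ∑ k, c k * Z k w := by
    simp only [← hgrad w hw]
    change tracedChristoffel G v w ⬝ᵥ (G w).mulVec (fun k => Z k w) = c ⬝ᵥ fun k => Z k w
    rw [Matrix.dotProduct_mulVec, tracedChristoffel_eq, ← Matrix.mulVec_transpose, hsymm',
      Matrix.mulVec_mulVec, Matrix.mul_nonsing_inv _ (hdet w hw), Matrix.one_mulVec]
  rw [t2, t3]; ring

end HessianTrace

/-! ### Prolongation in terms of directional derivatives -/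

noncomputable section Prolongation

variable {ι : Type*} [Fintype ι] [DecidableEq ι]

/-- The coordinate direction `∂_i` in the space of the variables `(z, u)`. -/
def baseDir (i : ι) : (ι → ℝ) × ℝ := (Pi.single i 1, 0)

/-- The coordinate direction `∂_u` in the space of the variables `(z, u)`. -/
def fibreDir : (ι → ℝ) × ℝ := (0, 1)

theorem dirDeriv_single_prod (f : (ι → ℝ) × ℝ → ℝ) (i : ι) (c : ℝ) (w : (ι → ℝ) × ℝ) :
    dirDeriv (Pi.single i 1, c) f w = dirDeriv (baseDir i) f w + c * dirDeriv fibreDir f w := by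
  have : ((Pi.single i 1, c) : (ι → ℝ) × ℝ) = baseDir i + c • fibreDir := by
    ext <;> simp [baseDir, fibreDir]
  simp [dirDeriv, this]

theorem totalDeriv_eq (f : (ι → ℝ) × ℝ → ℝ) (i : ι) (z : ι → ℝ) (u : ℝ) (p : ι → ℝ) :
    totalDeriv f i z u p =
      dirDeriv (baseDir i) f (z, u) + p i * dirDeriv fibreDir f (z, u) :=
  dirDeriv_single_prod f i (p i) (z, u)

theorem prolong₁_eq (ξ : ι → (ι → ℝ) × ℝ → ℝ) (η : (ι → ℝ) × ℝ → ℝ) (i : ι)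
    (w : (ι → ℝ) × ℝ × (ι → ℝ)) :
    prolong₁ ξ η i w = dirDeriv (baseDir i) η (w.1, w.2.1)
      + w.2.2 i * dirDeriv fibreDir η (w.1, w.2.1)
      - ∑ k, w.2.2 k * (dirDeriv (baseDir i) (ξ k) (w.1, w.2.1)
        + w.2.2 i * dirDeriv fibreDir (ξ k) (w.1, w.2.1)) := by
  simp [prolong₁, totalDeriv_eq]

/-- The projection from `(z, u, p)` to `(z, u)`. -/
def jetProj : (ι → ℝ) × ℝ × (ι → ℝ) →L[ℝ] (ι → ℝ) × ℝ :=
  (ContinuousLinearMap.fst ℝ _ _).prod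
    ((ContinuousLinearMap.fst ℝ _ _).comp (ContinuousLinearMap.snd ℝ _ _))

/-- The coordinate `p_i` of `(z, u, p)`. -/
def jetCoord (i : ι) : (ι → ℝ) × ℝ × (ι → ℝ) →L[ℝ] ℝ :=
  (ContinuousLinearMap.proj i).comp
    ((ContinuousLinearMap.snd ℝ _ _).comp (ContinuousLinearMap.snd ℝ _ _))

variable {W : Set ((ι → ℝ) × ℝ)} {ξ : ι → (ι → ℝ) × ℝ → ℝ} {η : (ι → ℝ) × ℝ → ℝ}

/-- Full expansion by the chain rule. The components of X enter only through derivatives at (z, u),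
so the dependence on `p` and `q` becomes explicit. -/
theorem prolong₂_eq (hW : IsOpen W) (hξ : ∀ k, ContDiffOn ℝ ∞ (ξ k) W) (hη : ContDiffOn ℝ ∞ η W)
    {z : ι → ℝ} {u : ℝ} (hw : (z, u) ∈ W) (i j : ι) (p : ι → ℝ) (q : ι → ι → ℝ) :
    prolong₂ ξ η i j z u p q =
      dirDeriv (baseDir j) (dirDeriv (baseDir i) η) (z, u)
      + p j * dirDeriv fibreDir (dirDeriv (baseDir i) η) (z, u)
      + q j i * dirDeriv fibreDir η (z, u)
      + p i * (dirDeriv (baseDir j) (dirDeriv fibreDir η) (z, u)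
        + p j * dirDeriv fibreDir (dirDeriv fibreDir η) (z, u))
      - ∑ k, (q j k * (dirDeriv (baseDir i) (ξ k) (z, u) + p i * dirDeriv fibreDir (ξ k) (z, u))
        + p k * (dirDeriv (baseDir j) (dirDeriv (baseDir i) (ξ k)) (z, u)
          + p j * dirDeriv fibreDir (dirDeriv (baseDir i) (ξ k)) (z, u)
          + q j i * dirDeriv fibreDir (ξ k) (z, u)
          + p i * (dirDeriv (baseDir j) (dirDeriv fibreDir (ξ k)) (z, u)
            + p j * dirDeriv fibreDir (dirDeriv fibreDir (ξ k)) (z, u))))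
      - ∑ k, q i k * (dirDeriv (baseDir j) (ξ k) (z, u)
        + p j * dirDeriv fibreDir (ξ k) (z, u)) := by
  set V : (ι → ℝ) × ℝ × (ι → ℝ) := (Pi.single j 1, p j, q j) with hV
  set w : (ι → ℝ) × ℝ × (ι → ℝ) := (z, u, p) with hwdef
  have hc : ∀ k, dirDeriv V (fun x => jetCoord k x) w = q j k := fun k => by
    simp only [dirDeriv, ContinuousLinearMap.fderiv]; rfl
  have dc : ∀ k : ι, DifferentiableAt ℝ (fun x => jetCoord k x) w :=
    fun k => (jetCoord k).differentiableAt
  have hf : ∀ f : (ι → ℝ) × ℝ → ℝ, ContDiffOn ℝ ∞ f W → dirDeriv V (fun x => f (jetProj x)) w =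
      dirDeriv (baseDir j) f (z, u) + p j * dirDeriv fibreDir f (z, u) := fun f hf => by
    rw [dirDeriv_comp jetProj (hf.differentiableAt_of_isOpen hW hw)]
    exact dirDeriv_single_prod f j (p j) (z, u)
  have df : ∀ f : (ι → ℝ) × ℝ → ℝ, ContDiffOn ℝ ∞ f W →
      DifferentiableAt ℝ (fun x => f (jetProj x)) w := fun f hf =>
    DifferentiableAt.comp w (hf.differentiableAt_of_isOpen hW hw) jetProj.differentiableAt
  have e : prolong₁ ξ η i = fun x => dirDeriv (baseDir i) η (jetProj x)
      + jetCoord i x * dirDeriv fibreDir η (jetProj x)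
      - ∑ k, jetCoord k x * (dirDeriv (baseDir i) (ξ k) (jetProj x)
        + jetCoord i x * dirDeriv fibreDir (ξ k) (jetProj x)) := by
    funext x; rw [prolong₁_eq]; rfl
  have h1 : totalDeriv₁ (prolong₁ ξ η i) j z u p q = dirDeriv V (prolong₁ ξ η i) w := rfl
  have hs : ∀ f : (ι → ℝ) × ℝ → ℝ, ContDiffOn ℝ ∞ f W →
      DifferentiableAt ℝ (fun x => dirDeriv (baseDir i) f (jetProj x)
        + jetCoord i x * dirDeriv fibreDir f (jetProj x)) w ∧
      dirDeriv V (fun x => dirDeriv (baseDir i) f (jetProj x)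
        + jetCoord i x * dirDeriv fibreDir f (jetProj x)) w =
      dirDeriv (baseDir j) (dirDeriv (baseDir i) f) (z, u)
      + p j * dirDeriv fibreDir (dirDeriv (baseDir i) f) (z, u)
      + q j i * dirDeriv fibreDir f (z, u)
      + p i * (dirDeriv (baseDir j) (dirDeriv fibreDir f) (z, u)
        + p j * dirDeriv fibreDir (dirDeriv fibreDir f) (z, u)) := by
    intro f h
    have d1 := df _ (h.dirDeriv hW (baseDir i))
    have d2 := df _ (h.dirDeriv hW fibreDir)
    refine ⟨d1.fun_add ((dc i).fun_mul d2), ?_⟩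
    rw [dirDeriv_add d1 ((dc i).fun_mul d2), dirDeriv_mul (dc i) d2, hc, hf _ (h.dirDeriv hW _),
      hf _ (h.dirDeriv hW _), add_assoc (_ + _)]
    rfl
  rw [prolong₂, h1, e, dirDeriv_sub (hs η hη).1
    (DifferentiableAt.fun_sum fun k _ => (dc k).fun_mul (hs _ (hξ k)).1), (hs η hη).2,
    dirDeriv_sum fun k _ => (dc k).fun_mul (hs _ (hξ k)).1]
  simp only [totalDeriv_eq]
  congr 2
  refine Finset.sum_congr rfl fun k _ => ?_
  rw [dirDeriv_mul (dc k) (hs _ (hξ k)).1, hc, (hs _ (hξ k)).2]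
  rfl

end Prolongation

/-! ### The second prolongation applied to the heat equation -/

noncomputable section HeatProlongation

variable {n : ℕ}

/-- `spacePart` as a continuous linear map. -/
def spaceProj : (Option (Fin n) → ℝ) →L[ℝ] (Fin n → ℝ) :=
  ContinuousLinearMap.pi fun i => ContinuousLinearMap.proj (some i)

@[simp] theorem spaceProj_apply (z : Option (Fin n) → ℝ) : spaceProj z = spacePart z := rfl

/-- The spatial part of `(t, x, u)`. -/
def spaceProjE : (Option (Fin n) → ℝ) × ℝ →L[ℝ] (Fin n → ℝ) :=
  spaceProj.comp (ContinuousLinearMap.fst ℝ _ _)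

/-- The left side of the heat equation of the metric `G` on a coordinate domain. -/
def heatFun (G : (Fin n → ℝ) → Matrix (Fin n) (Fin n) ℝ)
    (w : (Option (Fin n) → ℝ) × ℝ × (Option (Fin n) → ℝ) ×
      (Option (Fin n) → Option (Fin n) → ℝ)) : ℝ :=
  (∑ i, ∑ j, (G (spacePart w.1))⁻¹ i j * w.2.2.2 (some i) (some j))
    - (∑ i, tracedChristoffel G (fun k => Pi.single k 1) (spacePart w.1) i * w.2.2.1 (some i))
    - w.2.2.1 none

/-- The spatial coordinate directions in the space of the variables `(t, x, u)`. -/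
def spaceDir (k : Fin n) : (Option (Fin n) → ℝ) × ℝ := baseDir (some k)

variable {U : Set (Fin n → ℝ)} {G : (Fin n → ℝ) → Matrix (Fin n) (Fin n) ℝ}

theorem spaceProjE_spaceDir (k : Fin n) : spaceProjE (spaceDir k) = Pi.single k (1 : ℝ) := by
  funext i
  simp only [spaceProjE, spaceDir, baseDir, ContinuousLinearMap.comp_apply,
    ContinuousLinearMap.coe_fst', spaceProj_apply, spacePart]
  by_cases h : i = k
  · subst h; simp
  · simp [h]

/-- The metric depends on x alone and the projection sends `spaceDir k` to the k-th coordinate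
vector. This permits computing with Christoffel symbols on the space where the components of X live.
-/
theorem tracedChristoffel_pullback (hU : IsOpen U)
    (hG : ∀ i j, ContDiffOn ℝ ∞ (fun y => G y i j) U)
    {w : (Option (Fin n) → ℝ) × ℝ} (hw : spacePart w.1 ∈ U) :
    tracedChristoffel (fun w : (Option (Fin n) → ℝ) × ℝ => G (spacePart w.1)) spaceDir w =
      tracedChristoffel G (fun k => Pi.single k 1) (spacePart w.1) := by
  have : ∀ k i j, dirDeriv (spaceDir k)
      (fun w : (Option (Fin n) → ℝ) × ℝ => G (spacePart w.1) i j) w =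
      dirDeriv (Pi.single k 1) (fun y => G y i j) (spacePart w.1) := fun k i j => by
    have := dirDeriv_comp (w := w) (v := spaceDir k) spaceProjE (f := fun y => G y i j)
      ((hG i j).differentiableAt_of_isOpen hU hw)
    rw [spaceProjE_spaceDir] at this
    exact this
  funext i
  simp only [tracedChristoffel, this]

/-- The coefficients of H depend only on x and H does not contain u. Hence only the spatial
components differentiate the coefficients, and η enters through its prolongations alone. -/
theorem prolongApply_heatFun (hU : IsOpen U)
    (hG : ∀ i j, ContDiffOn ℝ ∞ (fun y => G y i j) U) (hdet : ∀ y ∈ U, IsUnit (G y).det)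
    (ξ : Option (Fin n) → (Option (Fin n) → ℝ) × ℝ → ℝ)
    (η : (Option (Fin n) → ℝ) × ℝ → ℝ) {z : Option (Fin n) → ℝ} (u : ℝ) (hz : spacePart z ∈ U)
    (p : Option (Fin n) → ℝ) (q : Option (Fin n) → Option (Fin n) → ℝ) :
    prolongApply ξ η (heatFun G) z u p q =
      (∑ i, ∑ j, (dirDeriv (∑ k, ξ (some k) (z, u) • spaceDir k)
          (fun w : (Option (Fin n) → ℝ) × ℝ => (G (spacePart w.1))⁻¹ i j) (z, u)
            * q (some i) (some j)
        + (G (spacePart z))⁻¹ i j * prolong₂ ξ η (some i) (some j) z u p q))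
      - (∑ i, (dirDeriv (∑ k, ξ (some k) (z, u) • spaceDir k)
          (fun w : (Option (Fin n) → ℝ) × ℝ =>
            tracedChristoffel G (fun k => Pi.single k 1) (spacePart w.1) i) (z, u)
            * p (some i)
        + tracedChristoffel G (fun k => Pi.single k 1) (spacePart z) i
          * prolong₁ ξ η (some i) (z, u, p)))
      - prolong₁ ξ η none (z, u, p) := by
  set x := (z, u, p, q) with hx
  set V : (Option (Fin n) → ℝ) × ℝ × (Option (Fin n) → ℝ) × (Option (Fin n) → Option (Fin n) → ℝ)
    := ((fun i => ξ i (z, u)), η (z, u), (fun i => prolong₁ ξ η i (z, u, p)),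
      (fun i j => prolong₂ ξ η i j z u p q)) with hV
  have h0 : prolongApply ξ η (heatFun G) z u p q = dirDeriv V (heatFun G) x := rfl
  let P : (Option (Fin n) → ℝ) × ℝ × (Option (Fin n) → ℝ) × (Option (Fin n) → Option (Fin n) → ℝ)
    →L[ℝ] (Fin n → ℝ) := spaceProj.comp (ContinuousLinearMap.fst ℝ _ _)
  let P1 (a : Option (Fin n)) : (Option (Fin n) → ℝ) × ℝ × (Option (Fin n) → ℝ) ×
      (Option (Fin n) → Option (Fin n) → ℝ) →L[ℝ] ℝ :=
    (ContinuousLinearMap.proj a).comp ((ContinuousLinearMap.fst ℝ _ _).comp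
      ((ContinuousLinearMap.snd ℝ _ _).comp (ContinuousLinearMap.snd ℝ _ _)))
  let P2 (a b : Option (Fin n)) : (Option (Fin n) → ℝ) × ℝ × (Option (Fin n) → ℝ) ×
      (Option (Fin n) → Option (Fin n) → ℝ) →L[ℝ] ℝ :=
    (ContinuousLinearMap.proj (φ := fun _ : Option (Fin n) => ℝ) b).comp
      ((ContinuousLinearMap.proj (φ := fun _ => Option (Fin n) → ℝ) a).comp
      ((ContinuousLinearMap.snd ℝ _ _).comp
      ((ContinuousLinearMap.snd ℝ _ _).comp (ContinuousLinearMap.snd ℝ _ _))))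
  have hPV : spaceProjE (∑ k, ξ (some k) (z, u) • spaceDir k) = P V := by
    rw [map_sum]
    simp only [map_smul, spaceProjE_spaceDir]
    funext i
    simp only [Finset.sum_apply, Pi.smul_apply, smul_eq_mul]
    rw [Finset.sum_eq_single i (fun b _ hb => by simp [hb.symm]) (by simp)]
    simp only [Pi.single_eq_same, mul_one]
    rfl
  have hf : ∀ f : (Fin n → ℝ) → ℝ, ContDiffOn ℝ ∞ f U → dirDeriv V (fun x => f (P x)) x =
      dirDeriv (∑ k, ξ (some k) (z, u) • spaceDir k)
        (fun w : (Option (Fin n) → ℝ) × ℝ => f (spacePart w.1)) (z, u) := fun f hf => by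
    have d := hf.differentiableAt_of_isOpen hU hz
    rw [dirDeriv_comp P d]
    have := dirDeriv_comp (w := (z, u)) (v := ∑ k, ξ (some k) (z, u) • spaceDir k) spaceProjE d
    rw [hPV] at this
    exact this.symm
  have df : ∀ f : (Fin n → ℝ) → ℝ, ContDiffOn ℝ ∞ f U →
      DifferentiableAt ℝ (fun x => f (P x)) x := fun f hf =>
    DifferentiableAt.comp x (hf.differentiableAt_of_isOpen hU hz) P.differentiableAt
  have h1 : ∀ a, dirDeriv V (fun x => P1 a x) x = prolong₁ ξ η a (z, u, p) := fun a => by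
    simp only [dirDeriv, ContinuousLinearMap.fderiv]; rfl
  have h2 : ∀ a b, dirDeriv V (fun x => P2 a b x) x = prolong₂ ξ η a b z u p q := fun a b => by
    simp only [dirDeriv, ContinuousLinearMap.fderiv]; rfl
  have sA := contDiffOn_inv_apply hG hdet
  have sΓ := contDiffOn_tracedChristoffel (v := fun k => Pi.single k (1 : ℝ)) hU hG hdet
  have d1 : ∀ a, DifferentiableAt ℝ (fun x => P1 a x) x := fun a => (P1 a).differentiableAt
  have d2 : ∀ a b, DifferentiableAt ℝ (fun x => P2 a b x) x := fun a b => (P2 a b).differentiableAt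
  have dA : ∀ i j, DifferentiableAt ℝ (fun x => (G (P x))⁻¹ i j * P2 (some i) (some j) x) x :=
    fun i j => (df _ (sA i j)).fun_mul (d2 _ _)
  have dΓ : ∀ i, DifferentiableAt ℝ (fun x =>
      tracedChristoffel G (fun k => Pi.single k 1) (P x) i * P1 (some i) x) x :=
    fun i => (df _ (sΓ i)).fun_mul (d1 _)
  have e : heatFun G = fun x => (∑ i, ∑ j, (G (P x))⁻¹ i j * P2 (some i) (some j) x)
    - (∑ i, tracedChristoffel G (fun k => Pi.single k 1) (P x) i * P1 (some i) x)
    - P1 none x := rfl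
  rw [h0, e, dirDeriv_sub ((DifferentiableAt.fun_sum fun i _ => DifferentiableAt.fun_sum
      fun j _ => dA i j).fun_sub (DifferentiableAt.fun_sum fun i _ => dΓ i)) (d1 none),
    dirDeriv_sub (DifferentiableAt.fun_sum fun i _ => DifferentiableAt.fun_sum
      fun j _ => dA i j) (DifferentiableAt.fun_sum fun i _ => dΓ i), h1,
    dirDeriv_sum (fun i _ => dΓ i), dirDeriv_sum (fun i _ => DifferentiableAt.fun_sum
      fun j _ => dA i j)]
  congr 2
  · refine Finset.sum_congr rfl fun i _ => ?_
    rw [dirDeriv_sum fun j _ => dA i j]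
    refine Finset.sum_congr rfl fun j _ => ?_
    rw [dirDeriv_mul (df _ (sA i j)) (d2 _ _), hf _ (sA i j), h2]
    rfl
  · refine Finset.sum_congr rfl fun i _ => ?_
    rw [dirDeriv_mul (df _ (sΓ i)) (d1 _), hf _ (sΓ i), h1]
    rfl

end HeatProlongation

/-! ### The determining equations -/

noncomputable section DeterminingAlgebra

variable {ι : Type*} [Fintype ι]

/-- The algebra of the reduction. Here `A` is g⁻¹, `B i l` is ξ^i_{,l}, `H` holds the second spatial
derivatives of ξ, and the derivatives of g⁻¹ and Γ along ξ are already replaced by their values for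
a homothetic field with factor `τt`. The multiplier `ηu - τt` is the one for which all `q` and `pt`
terms cancel. -/
theorem heat_prolongation_identity {A q : ι → ι → ℝ} (hA : ∀ i j, A i j = A j i)
    (hq : ∀ i j, q i j = q j i) (B : ι → ι → ℝ) (H : ι → ι → ι → ℝ) (Γ p dη duη ξt : ι → ℝ)
    (ddη : ι → ι → ℝ) (ηu ηuu ηt pt τt : ℝ) :
    (∑ i, ∑ j, ((∑ l, A i l * B j l + ∑ l, B i l * A l j - τt * A i j) * q i j
      + A i j * (ddη j i + p j * duη i + q j i * ηu + p i * (duη j + p j * ηuu)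
        - ∑ k, (q j k * B k i + p k * H k j i) - ∑ k, q i k * B k j)))
      - (∑ i, ((∑ l, B i l * Γ l - τt * Γ i - ∑ j, ∑ k, A j k * H i k j) * p i
        + Γ i * (dη i + p i * ηu - ∑ k, p k * B k i)))
      - (ηt + pt * ηu - (pt * τt + ∑ k, p k * ξt k))
      - (ηu - τt) * (∑ i, ∑ j, A i j * q i j - ∑ i, Γ i * p i - pt) =
    (∑ i, ∑ j, A i j * ddη j i - ∑ i, Γ i * dη i - ηt)
      + ∑ i, p i * (2 * ∑ j, A i j * duη j + ξt i) + (∑ i, ∑ j, A i j * p i * p j) * ηuu := by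
  -- `s1` and `s2` cancel the derivative of g⁻¹ against the terms q B of the prolongation, `s3`
  -- cancels the second derivatives of ξ, and `s4` cancels Γ B. The other identities collect like
  -- terms.
  have s1 : ∑ i, ∑ j, (∑ l, A i l * B j l) * q i j = ∑ i, ∑ j, A i j * ∑ k, q i k * B k j := by
    simp only [Finset.sum_mul, Finset.mul_sum]
    refine Finset.sum_congr rfl fun i _ => ?_
    rw [Finset.sum_comm]
    exact Finset.sum_congr rfl fun j _ => Finset.sum_congr rfl fun k _ => by ring
  have s2 : ∑ i, ∑ j, (∑ l, B i l * A l j) * q i j = ∑ i, ∑ j, A i j * ∑ k, q j k * B k i := by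
    simp only [Finset.sum_mul, Finset.mul_sum]
    rw [Finset.sum_comm]
    conv_rhs => rw [Finset.sum_comm]
    refine Finset.sum_congr rfl fun j _ => ?_
    rw [Finset.sum_comm]
    exact Finset.sum_congr rfl fun i _ => Finset.sum_congr rfl fun k _ => by rw [hq j k]; ring
  have s3 : ∑ i, ∑ j, A i j * ∑ k, p k * H k j i = ∑ i, (∑ j, ∑ k, A j k * H i k j) * p i := by
    simp only [Finset.sum_mul, Finset.mul_sum]
    conv_rhs => rw [Finset.sum_comm]
    refine Finset.sum_congr rfl fun i _ => ?_
    rw [Finset.sum_comm]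
    refine Finset.sum_congr rfl fun k _ => Finset.sum_congr rfl fun j _ => by ring
  have s4 : ∑ i, (∑ l, B i l * Γ l) * p i = ∑ i, Γ i * ∑ k, p k * B k i := by
    simp only [Finset.sum_mul, Finset.mul_sum]
    rw [Finset.sum_comm]
    exact Finset.sum_congr rfl fun i _ => Finset.sum_congr rfl fun k _ => by ring
  have s5 : ∑ i, ∑ j, A i j * (p j * duη i) = ∑ i, p i * ∑ j, A i j * duη j := by
    simp only [Finset.mul_sum]
    rw [Finset.sum_comm]
    exact Finset.sum_congr rfl fun i _ => Finset.sum_congr rfl fun j _ => by rw [hA j i]; ring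
  have s6 : ∑ i, ∑ j, A i j * (p i * duη j) = ∑ i, p i * ∑ j, A i j * duη j := by
    simp only [Finset.mul_sum]
    exact Finset.sum_congr rfl fun i _ => Finset.sum_congr rfl fun j _ => by ring
  have s7 : ∑ i, ∑ j, A i j * (q j i * ηu) = ηu * ∑ i, ∑ j, A i j * q i j := by
    simp only [Finset.mul_sum]
    exact Finset.sum_congr rfl fun i _ => Finset.sum_congr rfl fun j _ => by rw [hq j i]; ring
  have s8 : ∑ i, ∑ j, τt * A i j * q i j = τt * ∑ i, ∑ j, A i j * q i j := by
    simp only [Finset.mul_sum, mul_assoc]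
  have s9 : ∑ i, ∑ j, A i j * (p i * (p j * ηuu)) = (∑ i, ∑ j, A i j * p i * p j) * ηuu := by
    simp only [Finset.sum_mul]
    exact Finset.sum_congr rfl fun i _ => Finset.sum_congr rfl fun j _ => by ring
  have s10 : ∑ i, τt * Γ i * p i = τt * ∑ i, Γ i * p i := by
    simp only [Finset.mul_sum, mul_assoc]
  have s11 : ∑ i, Γ i * (p i * ηu) = ηu * ∑ i, Γ i * p i := by
    simp only [Finset.mul_sum]
    exact Finset.sum_congr rfl fun i _ => by ring
  have s12 : ∑ i, p i * (2 * ∑ j, A i j * duη j) = 2 * ∑ i, p i * ∑ j, A i j * duη j := by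
    rw [Finset.mul_sum]
    exact Finset.sum_congr rfl fun i _ => by ring
  simp only [mul_add, add_mul, sub_mul, mul_sub, Finset.sum_add_distrib, Finset.sum_sub_distrib,
    s9, s11, s12, s5, s6, s7, s8, s10] at *
  linear_combination s1 + s2 - s3 - s4

variable [DecidableEq ι]

/-- Taking r to be the l-th coordinate vector gives 2 (A T)_l = 0. -/
theorem eq_zero_of_sum_symm {A : Matrix ι ι ℝ} (hA : ∀ i j, A i j = A j i) (hdet : IsUnit A.det)
    {T : ι → ℝ} (h : ∀ r : ι → ℝ, ∑ i, ∑ j, A i j * (r j * T i + r i * T j) = 0) : T = 0 := by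
  have h1 : A.mulVec T = 0 := by
    funext l
    have h2 := h (Pi.single l 1)
    simp only [mul_add, Finset.sum_add_distrib, Pi.single_apply, ite_mul, one_mul, zero_mul,
      mul_ite, mul_zero, Finset.sum_ite_eq', Finset.mem_univ, if_true] at h2
    rw [Finset.sum_comm] at h2
    simp only [Finset.sum_ite_eq', Finset.mem_univ, if_true] at h2
    rw [Finset.sum_congr rfl fun i _ => by rw [hA i l]] at h2
    simp only [Matrix.mulVec, dotProduct, Pi.zero_apply]
    linarith
  have := congrArg A⁻¹.mulVec h1
  rwa [Matrix.mulVec_mulVec, Matrix.nonsing_inv_mul _ hdet, Matrix.one_mulVec,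
    Matrix.mulVec_zero] at this

-- Let R be the difference of the two sides. The hypothesis says tr (R Q) = 0 for symmetric Q, and R
-- is itself symmetric, so Q = R makes the sum of squares of its entries vanish.
omit [DecidableEq ι] in
theorem matrix_eq_of_contraction {A A' J : Matrix ι ι ℝ} {m : ℝ} (hA : A.transpose = A)
    (hA' : A'.transpose = A')
    (h : ∀ Q : Matrix ι ι ℝ, (∀ i j, Q i j = Q j i) →
      ∑ i, ∑ j, (A' i j * Q i j + A i j * (Q j i * m - ∑ k, Q j k * J k i
        - ∑ k, Q i k * J k j)) = 0) :
    A' + m • A = J * A + A * J.transpose := by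
  set R := A' + m • A - J * A - A * J.transpose with hR
  have hRt : R.transpose = R := by
    rw [hR]
    simp only [Matrix.transpose_sub, Matrix.transpose_add, Matrix.transpose_smul,
      Matrix.transpose_mul, Matrix.transpose_transpose, hA, hA']
    abel
  have h1 := h R fun i j => congrFun (congrFun hRt j) i
  have h2 : ∑ i, ∑ j, R i j * R i j = 0 := by
    rw [sum_sum_mul_eq_trace, hRt]
    have e : ∑ i, ∑ j, (A' i j * R i j + A i j * (R j i * m - ∑ k, R j k * J k i
        - ∑ k, R i k * J k j)) = (A' * R.transpose).trace + m * (A * R).trace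
        - (A * (R * J)).trace - (A * (R * J).transpose).trace := by
      have t1 : ∑ i, ∑ j, A i j * (R j i * m) = m * (A * R).trace := by
        have := sum_sum_mul_eq_trace A R.transpose
        rw [Matrix.transpose_transpose] at this
        simp only [← this, Finset.mul_sum, Matrix.transpose_apply]
        exact Finset.sum_congr rfl fun i _ => Finset.sum_congr rfl fun j _ => by ring
      have t2 : ∑ i, ∑ j, A i j * ∑ k, R j k * J k i = (A * (R * J)).trace := by
        have := sum_sum_mul_eq_trace A (R * J).transpose
        rw [Matrix.transpose_transpose] at this
        simp only [← this, Matrix.transpose_apply, Matrix.mul_apply]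
      have t3 : ∑ i, ∑ j, A i j * ∑ k, R i k * J k j = (A * (R * J).transpose).trace := by
        simp only [← sum_sum_mul_eq_trace, Matrix.mul_apply]
      simp only [mul_sub, Finset.sum_sub_distrib, Finset.sum_add_distrib, t1, t2, t3,
        sum_sum_mul_eq_trace A' R]
      ring
    rw [e, hRt] at h1
    have e2 : (A * (R * J).transpose).trace = (A * J.transpose * R).trace := by
      rw [Matrix.transpose_mul, hRt, Matrix.mul_assoc]
    have e3 : (A * (R * J)).trace = (J * A * R).trace := by
      rw [← Matrix.mul_assoc, Matrix.trace_mul_comm, Matrix.mul_assoc]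
    rw [e2, e3] at h1
    rw [← h1]
    have e4 : R * R = A' * R + m • (A * R) - J * A * R - A * J.transpose * R := by
      conv_lhs => enter [1]; rw [hR]
      simp only [Matrix.sub_mul, Matrix.add_mul, Matrix.smul_mul]
    rw [e4]
    simp only [Matrix.trace_sub, Matrix.trace_add, Matrix.trace_smul, smul_eq_mul]
  have h3 : R = 0 := by
    ext i j
    have h4 := (Finset.sum_eq_zero_iff_of_nonneg fun i _ =>
      Finset.sum_nonneg fun j _ => mul_self_nonneg (R i j)).1 h2 i (Finset.mem_univ i)
    have h5 := (Finset.sum_eq_zero_iff_of_nonneg fun j _ =>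
      mul_self_nonneg (R i j)).1 h4 j (Finset.mem_univ j)
    exact mul_self_eq_zero.1 h5
  rw [hR, sub_sub] at h3
  exact sub_eq_zero.1 h3

/-- The choice P = A⁻¹ x turns both summands into x xᵀ, whose diagonal entries are squares. -/
theorem eq_zero_of_rank_one {A : Matrix ι ι ℝ} (hA : A.transpose = A) (hdet : IsUnit A.det)
    {x : ι → ℝ} (h : ∀ P : ι → ℝ, Matrix.vecMulVec x P * A
      + A * (Matrix.vecMulVec x P).transpose = 0) : x = 0 := by
  funext i
  have h1 := congrFun (congrFun (h (A⁻¹.mulVec x)) i) i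
  simp only [Matrix.transpose_vecMulVec, Matrix.vecMulVec_mul, Matrix.mul_vecMulVec,
    Matrix.mulVec_mulVec, Matrix.mul_nonsing_inv _ hdet, Matrix.one_mulVec] at h1
  rw [← Matrix.mulVec_transpose, hA, Matrix.mulVec_mulVec, Matrix.mul_nonsing_inv _ hdet,
    Matrix.one_mulVec] at h1
  simp only [Matrix.add_apply, Matrix.vecMulVec_apply, Matrix.zero_apply] at h1
  exact mul_self_eq_zero.1 (by linarith)

/-- Replacing p by -p separates the linear part from the quadratic one. Since A may be indefinite, a
given vector may be null; instead, `s ≠ 0` would make the whole quadratic form vanish, which by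
polarization contradicts nondegeneracy. -/
theorem quadratic_coefficients_eq_zero [Nonempty ι] {A : Matrix ι ι ℝ}
    (hA : ∀ i j, A i j = A j i) (hdet : IsUnit A.det) {c s : ℝ} {d : ι → ℝ}
    (h : ∀ p : ι → ℝ, c + ∑ i, p i * d i + (∑ i, ∑ j, A i j * p i * p j) * s = 0) :
    c = 0 ∧ (∀ i, d i = 0) ∧ s = 0 := by
  have hc : c = 0 := by simpa using h 0
  have hp : ∀ p : ι → ℝ, ∑ i, p i * d i = 0 ∧ (∑ i, ∑ j, A i j * p i * p j) * s = 0 := by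
    intro p
    have h1 := h p
    have h2 := h (-p)
    simp only [Pi.neg_apply, neg_mul, mul_neg, neg_neg, Finset.sum_neg_distrib] at h2
    constructor <;> linarith
  refine ⟨hc, fun i => ?_, ?_⟩
  · simpa [Pi.single_apply] using (hp (Pi.single i 1)).1
  · by_contra hs
    have hq : ∀ p : ι → ℝ, ∑ i, ∑ j, A i j * p i * p j = 0 := fun p =>
      (mul_eq_zero.1 (hp p).2).resolve_right hs
    obtain ⟨i⟩ := ‹Nonempty ι›
    have hz : (Pi.single i 1 : ι → ℝ) = 0 := by
      refine eq_zero_of_sum_symm hA hdet fun r => ?_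
      have h1 := hq (r + Pi.single i 1)
      have h2 := hq r
      have h3 := hq (Pi.single i 1)
      have e : ∑ a, ∑ b, A a b * (r b * (Pi.single i 1 : ι → ℝ) a + r a * (Pi.single i 1 : ι → ℝ) b)
        = ∑ a, ∑ b, A a b * (r + Pi.single i 1 : ι → ℝ) a * (r + Pi.single i 1 : ι → ℝ) b
        - ∑ a, ∑ b, A a b * r a * r b
        - ∑ a, ∑ b, A a b * (Pi.single i 1 : ι → ℝ) a * (Pi.single i 1 : ι → ℝ) b := by
        simp only [← Finset.sum_sub_distrib]
        refine Finset.sum_congr rfl fun a _ => Finset.sum_congr rfl fun b _ => ?_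
        simp only [Pi.add_apply]; ring
      rw [e, h1, h2, h3]; ring
    have := congrFun hz i
    simp at this

end DeterminingAlgebra

/-! ### Reduction of the symmetry condition to a quadratic in the first derivatives -/

noncomputable section Determining

variable {n : ℕ}

/-- The metric coefficients as functions of `(t, x, u)`. -/
def pullMetric (G : (Fin n → ℝ) → Matrix (Fin n) (Fin n) ℝ) (w : (Option (Fin n) → ℝ) × ℝ) :
    Matrix (Fin n) (Fin n) ℝ := G (spacePart w.1)

/-- The time direction in the space of the variables `(t, x, u)`. -/
def timeDir : (Option (Fin n) → ℝ) × ℝ := baseDir none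

/-- The heat operator, acting on functions of `(t, x, u)` with `u` as a parameter. -/
def heatOperator (G : (Fin n → ℝ) → Matrix (Fin n) (Fin n) ℝ)
    (f : (Option (Fin n) → ℝ) × ℝ → ℝ) (w : (Option (Fin n) → ℝ) × ℝ) : ℝ :=
  ∑ i, ∑ j, (pullMetric G w)⁻¹ i j * dirDeriv (spaceDir j) (dirDeriv (spaceDir i) f) w
    - ∑ i, tracedChristoffel (pullMetric G) spaceDir w i * dirDeriv (spaceDir i) f w
    - dirDeriv timeDir f w

/-- The fields that project to `(t, x)` with time component depending on `t` only and
`L_ξ g = τ_t g`. -/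
structure IsProjectableHomothetic (G : (Fin n → ℝ) → Matrix (Fin n) (Fin n) ℝ)
    (W : Set ((Option (Fin n) → ℝ) × ℝ)) (ξ : Option (Fin n) → (Option (Fin n) → ℝ) × ℝ → ℝ) :
    Prop where
  time_space : ∀ w ∈ W, ∀ i, dirDeriv (spaceDir i) (ξ none) w = 0
  time_fibre : ∀ w ∈ W, dirDeriv fibreDir (ξ none) w = 0
  space_fibre : ∀ w ∈ W, ∀ k, dirDeriv fibreDir (ξ (some k)) w = 0
  lie : ∀ w ∈ W, ∀ i j, lieDerivMetric (pullMetric G) spaceDir (fun k => ξ (some k)) w i j =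
    dirDeriv timeDir (ξ none) w * pullMetric G w i j

/-- The determining equations for the Lie point symmetries of the heat equation. -/
structure DeterminingSystem (G : (Fin n → ℝ) → Matrix (Fin n) (Fin n) ℝ)
    (W : Set ((Option (Fin n) → ℝ) × ℝ)) (ξ : Option (Fin n) → (Option (Fin n) → ℝ) × ℝ → ℝ)
    (η : (Option (Fin n) → ℝ) × ℝ → ℝ) : Prop extends IsProjectableHomothetic G W ξ where
  fibre_affine : ∀ w ∈ W, dirDeriv fibreDir (dirDeriv fibreDir η) w = 0
  drift : ∀ w ∈ W, ∀ i,
    2 * ∑ j, (pullMetric G w)⁻¹ i j * dirDeriv (spaceDir j) (dirDeriv fibreDir η) w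
      + dirDeriv timeDir (ξ (some i)) w = 0
  heat : ∀ w ∈ W, heatOperator G η w = 0

variable {U : Set (Fin n → ℝ)} {G : (Fin n → ℝ) → Matrix (Fin n) (Fin n) ℝ}
  {W : Set ((Option (Fin n) → ℝ) × ℝ)} {ξ : Option (Fin n) → (Option (Fin n) → ℝ) × ℝ → ℝ}
  {η : (Option (Fin n) → ℝ) × ℝ → ℝ}

theorem contDiffOn_pullMetric (hG : ∀ i j, ContDiffOn ℝ ∞ (fun y => G y i j) U)
    (hWU : ∀ w ∈ W, spacePart w.1 ∈ U) (i j : Fin n) :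
    ContDiffOn ℝ ∞ (fun w => pullMetric G w i j) W :=
  (hG i j).comp (spaceProjE.contDiff.contDiffOn) hWU

theorem inv_symm_apply {A : Matrix (Fin n) (Fin n) ℝ} (h : ∀ i j, A i j = A j i) (i j : Fin n) :
    A⁻¹ i j = A⁻¹ j i := by
  have : A.transpose = A := by ext i j; exact h j i
  conv_lhs => rw [← this, ← Matrix.transpose_nonsing_inv]
  rfl

/-- The symmetry condition on fields with `L_ξ g = τ_t g`, reduced to the lower order terms. -/
theorem IsProjectableHomothetic.prolongApply_sub (hU : IsOpen U) (hW : IsOpen W)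
    (hWU : ∀ w ∈ W, spacePart w.1 ∈ U)
    (hG : ∀ i j, ContDiffOn ℝ ∞ (fun y => G y i j) U) (hsymm : ∀ y i j, G y i j = G y j i)
    (hdet : ∀ y ∈ U, IsUnit (G y).det)
    (hξ : ∀ k, ContDiffOn ℝ ∞ (ξ k) W) (hη : ContDiffOn ℝ ∞ η W)
    (h : IsProjectableHomothetic G W ξ) {z : Option (Fin n) → ℝ} {u : ℝ} (hw : (z, u) ∈ W)
    (p : Option (Fin n) → ℝ) {q : Option (Fin n) → Option (Fin n) → ℝ}
    (hq : ∀ i j, q i j = q j i) :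
    prolongApply ξ η (heatFun G) z u p q
      - (dirDeriv fibreDir η (z, u) - dirDeriv timeDir (ξ none) (z, u)) * heatFun G (z, u, p, q) =
    heatOperator G η (z, u)
    + ∑ i, p (some i) *
      (2 * ∑ j, (pullMetric G (z, u))⁻¹ i j
          * dirDeriv (spaceDir j) (dirDeriv fibreDir η) (z, u)
        + dirDeriv timeDir (ξ (some i)) (z, u))
    + (∑ i, ∑ j, (pullMetric G (z, u))⁻¹ i j * p (some i) * p (some j))
      * dirDeriv fibreDir (dirDeriv fibreDir η) (z, u) := by
  have hz : spacePart z ∈ U := hWU _ hw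
  have sG := contDiffOn_pullMetric hG hWU
  have hdet' : ∀ w ∈ W, IsUnit (pullMetric G w).det := fun w hw => hdet _ (hWU w hw)
  have hsymm' : ∀ w i j, pullMetric G w i j = pullMetric G w j i := fun w => hsymm _
  have hσ : DifferentiableOn ℝ (dirDeriv timeDir (ξ none)) W :=
    ((hξ none).dirDeriv hW _).differentiableOn (by simp)
  -- The factor τ_t is constant in space because τ is; this is what makes the Christoffel formula
  -- available.
  have hσ' : ∀ m, dirDeriv (spaceDir m) (dirDeriv timeDir (ξ none)) (z, u) = 0 := fun m => by
    rw [dirDeriv_comm (hξ none) hW hw]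
    exact dirDeriv_eq_zero hW (fun x hx => h.time_space x hx m) hw
  have dA := dirDerivMatrix_inv_of_lieDerivMetric hW sG hdet' hw (h.lie _ hw)
  have dΓ := dirDeriv_tracedChristoffel hW sG hsymm' hdet' (fun k => hξ (some k)) hσ h.lie hw hσ'
  have dA' : ∀ i j, dirDeriv (∑ k, ξ (some k) (z, u) • spaceDir k)
      (fun w : (Option (Fin n) → ℝ) × ℝ => (G (spacePart w.1))⁻¹ i j) (z, u) =
      ∑ l, (pullMetric G (z, u))⁻¹ i l * dirDeriv (spaceDir l) (ξ (some j)) (z, u)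
      + ∑ l, dirDeriv (spaceDir l) (ξ (some i)) (z, u) * (pullMetric G (z, u))⁻¹ l j
      - dirDeriv timeDir (ξ none) (z, u) * (pullMetric G (z, u))⁻¹ i j := by
    intro i j
    have := congrFun (congrFun dA i) j
    simp only [dirDerivMatrix, Matrix.mul_apply, jacobianMatrix, Matrix.of_apply,
      Matrix.sub_apply, Matrix.add_apply, Matrix.smul_apply, smul_eq_mul,
      Matrix.transpose_apply] at this
    exact this
  have eΓ : ∀ w ∈ W, tracedChristoffel (pullMetric G) spaceDir w =
      tracedChristoffel G (fun k => Pi.single k 1) (spacePart w.1) := fun w hw =>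
    tracedChristoffel_pullback hU hG (hWU w hw)
  have dΓ' : ∀ i, dirDeriv (∑ k, ξ (some k) (z, u) • spaceDir k)
      (fun w : (Option (Fin n) → ℝ) × ℝ =>
            tracedChristoffel G (fun k => Pi.single k 1) (spacePart w.1) i) (z, u) = _ := fun i =>
    (dirDeriv_congr hW (fun w hw => (congrFun (eΓ w hw) i).symm) hw).trans (dΓ i)
  have z2 : ∀ k, ∀ a ∈ W, dirDeriv fibreDir (ξ k) a = 0 := fun k a ha => by
    cases k with
    | none => exact h.time_fibre a ha
    | some k => exact h.space_fibre a ha k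
  have z3 : ∀ k v, dirDeriv v (dirDeriv fibreDir (ξ k)) (z, u) = 0 := fun k v =>
    dirDeriv_eq_zero hW (z2 k) hw
  have z4 : ∀ k v, dirDeriv fibreDir (dirDeriv v (ξ k)) (z, u) = 0 := fun k v => by
    rw [dirDeriv_comm (hξ k) hW hw]; exact z3 k v
  have z5 : ∀ i v, dirDeriv v (dirDeriv (baseDir (some i)) (ξ none)) (z, u) = 0 := fun i v =>
    dirDeriv_eq_zero hW (fun x hx => h.time_space x hx i) hw
  have z6 : ∀ i, dirDeriv (baseDir (some i)) (ξ none) (z, u) = 0 := fun i => h.time_space _ hw i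
  have key := heat_prolongation_identity (A := fun i j => (pullMetric G (z, u))⁻¹ i j)
    (q := fun i j => q (some i) (some j)) (inv_symm_apply (hsymm' _)) (fun i j => hq _ _)
    (fun i l => dirDeriv (spaceDir l) (ξ (some i)) (z, u))
    (fun k j i => dirDeriv (spaceDir j) (dirDeriv (spaceDir i) (ξ (some k))) (z, u))
    (fun i => tracedChristoffel (pullMetric G) spaceDir (z, u) i) (fun i => p (some i))
    (fun i => dirDeriv (spaceDir i) η (z, u))
    (fun i => dirDeriv (spaceDir i) (dirDeriv fibreDir η) (z, u))
    (fun i => dirDeriv timeDir (ξ (some i)) (z, u))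
    (fun j i => dirDeriv (spaceDir j) (dirDeriv (spaceDir i) η) (z, u))
    (dirDeriv fibreDir η (z, u)) (dirDeriv fibreDir (dirDeriv fibreDir η) (z, u))
    (dirDeriv timeDir η (z, u)) (p none) (dirDeriv timeDir (ξ none) (z, u))
  unfold heatOperator
  rw [← key, prolongApply_heatFun hU hG hdet ξ η u hz p q]
  simp only [prolong₂_eq hW hξ hη hw, prolong₁_eq, dA', dΓ', z2 _ _ hw, z3, z4, z5, z6,
    Fintype.sum_option, mul_zero, add_zero, zero_add, heatFun, eΓ _ hw]
  simp only [dirDeriv_comm hη hW hw fibreDir]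
  rfl

end Determining

/-! ### The symmetry condition is equivalent to the determining equations -/

noncomputable section DeterminingForward

variable {n : ℕ} {U : Set (Fin n → ℝ)} {G : (Fin n → ℝ) → Matrix (Fin n) (Fin n) ℝ}
  {W : Set ((Option (Fin n) → ℝ) × ℝ)} {ξ : Option (Fin n) → (Option (Fin n) → ℝ) × ℝ → ℝ}
  {η : (Option (Fin n) → ℝ) × ℝ → ℝ}

/-- The symmetry condition at a single point with multiplier `mult`. -/
def SymmetryConditionAt (G : (Fin n → ℝ) → Matrix (Fin n) (Fin n) ℝ)
    (ξ : Option (Fin n) → (Option (Fin n) → ℝ) × ℝ → ℝ) (η : (Option (Fin n) → ℝ) × ℝ → ℝ)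
    (z : Option (Fin n) → ℝ) (u : ℝ) (mult : (Option (Fin n) → ℝ) → ℝ) : Prop :=
  ∀ (p : Option (Fin n) → ℝ) (q : Option (Fin n) → Option (Fin n) → ℝ),
    (∀ i j, q i j = q j i) →
      prolongApply ξ η (heatFun G) z u p q = mult p * heatFun G (z, u, p, q)

/-- The part of the symmetry condition that is linear in the second derivatives. -/
theorem SymmetryConditionAt.second_order (hU : IsOpen U) (hW : IsOpen W)
    (hWU : ∀ w ∈ W, spacePart w.1 ∈ U)
    (hG : ∀ i j, ContDiffOn ℝ ∞ (fun y => G y i j) U) (hdet : ∀ y ∈ U, IsUnit (G y).det)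
    (hξ : ∀ k, ContDiffOn ℝ ∞ (ξ k) W) (hη : ContDiffOn ℝ ∞ η W)
    {z : Option (Fin n) → ℝ} {u : ℝ} (hw : (z, u) ∈ W) {mult : (Option (Fin n) → ℝ) → ℝ}
    (h : SymmetryConditionAt G ξ η z u mult)
    (p : Option (Fin n) → ℝ) {q : Option (Fin n) → Option (Fin n) → ℝ}
    (hq : ∀ i j, q i j = q j i) :
    ∑ i, ∑ j, (dirDeriv (∑ k, ξ (some k) (z, u) • spaceDir k)
          (fun w => (pullMetric G w)⁻¹ i j) (z, u) * q (some i) (some j)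
      + (pullMetric G (z, u))⁻¹ i j * (q (some j) (some i) * (dirDeriv fibreDir η (z, u)
            - ∑ k, p k * dirDeriv fibreDir (ξ k) (z, u))
          - ∑ k, q (some j) k * (dirDeriv (spaceDir i) (ξ k) (z, u)
            + p (some i) * dirDeriv fibreDir (ξ k) (z, u))
          - ∑ k, q (some i) k * (dirDeriv (spaceDir j) (ξ k) (z, u)
            + p (some j) * dirDeriv fibreDir (ξ k) (z, u)))) =
    mult p * ∑ i, ∑ j, (pullMetric G (z, u))⁻¹ i j * q (some i) (some j) := by
  -- The multiplier is the same at `q` and at `0`, so subtracting the two conditions isolates the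
  -- part linear in `q`.
  have h1 := h p q hq
  have h0 := h p 0 (fun _ _ => rfl)
  have hz : spacePart z ∈ U := hWU _ hw
  let Lq : Fin n → Fin n → ℝ := fun i j => (q (some j) (some i) * (dirDeriv fibreDir η (z, u)
            - ∑ k, p k * dirDeriv fibreDir (ξ k) (z, u))
          - ∑ k, q (some j) k * (dirDeriv (spaceDir i) (ξ k) (z, u)
            + p (some i) * dirDeriv fibreDir (ξ k) (z, u))
          - ∑ k, q (some i) k * (dirDeriv (spaceDir j) (ξ k) (z, u)
            + p (some j) * dirDeriv fibreDir (ξ k) (z, u)))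
  have hP : ∀ i j, prolong₂ ξ η (some i) (some j) z u p q =
      prolong₂ ξ η (some i) (some j) z u p 0 + Lq i j := by
    intro i j
    simp only [Lq, prolong₂_eq hW hξ hη hw, Pi.zero_apply, zero_mul, zero_add, add_zero,
      Finset.sum_const_zero, sub_zero, spaceDir, mul_sub, Finset.mul_sum]
    have e : ∀ k, p k * (dirDeriv (baseDir (some j)) (dirDeriv (baseDir (some i)) (ξ k)) (z, u)
          + p (some j) * dirDeriv fibreDir (dirDeriv (baseDir (some i)) (ξ k)) (z, u)
          + q (some j) (some i) * dirDeriv fibreDir (ξ k) (z, u)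
          + p (some i) * (dirDeriv (baseDir (some j)) (dirDeriv fibreDir (ξ k)) (z, u)
            + p (some j) * dirDeriv fibreDir (dirDeriv fibreDir (ξ k)) (z, u))) =
        p k * (dirDeriv (baseDir (some j)) (dirDeriv (baseDir (some i)) (ξ k)) (z, u)
          + p (some j) * dirDeriv fibreDir (dirDeriv (baseDir (some i)) (ξ k)) (z, u)
          + p (some i) * (dirDeriv (baseDir (some j)) (dirDeriv fibreDir (ξ k)) (z, u)
            + p (some j) * dirDeriv fibreDir (dirDeriv fibreDir (ξ k)) (z, u)))
        + q (some j) (some i) * (p k * dirDeriv fibreDir (ξ k) (z, u)) := fun k => by ring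
    simp only [e, Finset.sum_add_distrib]
    ring
  rw [prolongApply_heatFun hU hG hdet ξ η u hz] at h1 h0
  simp only [heatFun, hP, Pi.zero_apply, mul_zero, Finset.sum_const_zero, zero_add, zero_sub]
    at h1 h0
  simp only [mul_add, Finset.sum_add_distrib] at h1 h0
  change ∑ i, ∑ j, (_ + (pullMetric G (z, u))⁻¹ i j * Lq i j) = _
  simp only [Finset.sum_add_distrib]
  simp only [pullMetric]
  linear_combination h1 - h0

/-- H contains no u_{ti}, so with only these second derivatives switched on the right side vanishes,
and nondegeneracy of g⁻¹ kills their coefficients. -/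
theorem SymmetryConditionAt.time_component (hU : IsOpen U) (hW : IsOpen W)
    (hWU : ∀ w ∈ W, spacePart w.1 ∈ U)
    (hG : ∀ i j, ContDiffOn ℝ ∞ (fun y => G y i j) U) (hsymm : ∀ y i j, G y i j = G y j i)
    (hdet : ∀ y ∈ U, IsUnit (G y).det)
    (hξ : ∀ k, ContDiffOn ℝ ∞ (ξ k) W) (hη : ContDiffOn ℝ ∞ η W)
    {z : Option (Fin n) → ℝ} {u : ℝ} (hw : (z, u) ∈ W) {mult : (Option (Fin n) → ℝ) → ℝ}
    (h : SymmetryConditionAt G ξ η z u mult) (p : Fin n → ℝ) (i : Fin n) :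
    dirDeriv (spaceDir i) (ξ none) (z, u) + p i * dirDeriv fibreDir (ξ none) (z, u) = 0 := by
  have hdetA : IsUnit (pullMetric G (z, u))⁻¹.det :=
    Matrix.isUnit_nonsing_inv_det _ (hdet _ (hWU _ hw))
  have h0 : (fun i => dirDeriv (spaceDir i) (ξ none) (z, u)
      + p i * dirDeriv fibreDir (ξ none) (z, u)) = 0 := by
    refine eq_zero_of_sum_symm
      (inv_symm_apply (A := pullMetric G (z, u)) (hsymm _)) hdetA fun r => ?_
    -- Only the mixed entries u_{ti} = r_i are nonzero.
    let q : Option (Fin n) → Option (Fin n) → ℝ := fun a b =>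
      a.elim (b.elim 0 r) (fun i => b.elim (r i) fun _ => 0)
    have hq : ∀ a b, q a b = q b a := by
      intro a b; cases a <;> cases b <;> rfl
    have := h.second_order hU hW hWU hG hdet hξ hη hw (fun a => a.elim 0 p) hq
    simp only [q, Fintype.sum_option, Option.elim, mul_zero, zero_mul, Finset.sum_const_zero,
      zero_add, add_zero, zero_sub] at this
    rw [← neg_eq_zero, ← this, ← Finset.sum_neg_distrib]
    refine Finset.sum_congr rfl fun a _ => ?_
    rw [← Finset.sum_neg_distrib]
    exact Finset.sum_congr rfl fun b _ => by ring
  exact congrFun h0 i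

/-- The coefficients of the spatial u_{ij} give one matrix identity for each p, with Jacobian `J` a
rank one perturbation of that of ξ by ξ_u. The unknown multiplier is first found from the
coefficient of u_t; then the dependence of the identity on p forces ξ_u = 0. -/
theorem SymmetryConditionAt.projectable [Nonempty (Fin n)] (hU : IsOpen U) (hW : IsOpen W)
    (hWU : ∀ w ∈ W, spacePart w.1 ∈ U)
    (hG : ∀ i j, ContDiffOn ℝ ∞ (fun y => G y i j) U) (hsymm : ∀ y i j, G y i j = G y j i)
    (hdet : ∀ y ∈ U, IsUnit (G y).det)
    (hξ : ∀ k, ContDiffOn ℝ ∞ (ξ k) W) (hη : ContDiffOn ℝ ∞ η W)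
    (hx : ∀ w ∈ W, ∀ i, dirDeriv (spaceDir i) (ξ none) w = 0)
    (hu : ∀ w ∈ W, dirDeriv fibreDir (ξ none) w = 0)
    {z : Option (Fin n) → ℝ} {u : ℝ} (hw : (z, u) ∈ W) {mult : (Option (Fin n) → ℝ) → ℝ}
    (h : SymmetryConditionAt G ξ η z u mult) :
    (∀ k, dirDeriv fibreDir (ξ (some k)) (z, u) = 0) ∧
    (∀ i j, lieDerivMetric (pullMetric G) spaceDir (fun k => ξ (some k)) (z, u) i j =
      dirDeriv timeDir (ξ none) (z, u) * pullMetric G (z, u) i j) ∧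
    ∀ p, mult p = dirDeriv fibreDir η (z, u)
      - ∑ k, p (some k) * dirDeriv fibreDir (ξ (some k)) (z, u)
      - dirDeriv timeDir (ξ none) (z, u) := by
  have hz : spacePart z ∈ U := hWU _ hw
  have sG := contDiffOn_pullMetric hG hWU
  have hdet' : ∀ w ∈ W, IsUnit (pullMetric G w).det := fun w hw => hdet _ (hWU w hw)
  have hsymmA : ∀ w i j, (pullMetric G w)⁻¹ i j = (pullMetric G w)⁻¹ j i := fun w =>
    inv_symm_apply (hsymm _)
  set A := (pullMetric G (z, u))⁻¹ with hAdef
  have hA : A.transpose = A := by ext i j; exact hsymmA _ j i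
  have hdetA : IsUnit A.det := Matrix.isUnit_nonsing_inv_det _ (hdet' _ hw)
  have hA0 : A ≠ 0 := by
    intro h0; rw [h0, Matrix.det_zero] at hdetA; exact not_isUnit_zero hdetA
  set A' := dirDerivMatrix (∑ k, ξ (some k) (z, u) • spaceDir k)
    (fun w => (pullMetric G w)⁻¹) (z, u) with hA'def
  have hA' : A'.transpose = A' := by
    ext i j
    simp only [hA'def, Matrix.transpose_apply, dirDerivMatrix, Matrix.of_apply]
    congr 1
    funext w; exact hsymmA w j i
  set B := jacobianMatrix spaceDir (fun k => ξ (some k)) (z, u) with hB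
  set x : Fin n → ℝ := fun k => dirDeriv fibreDir (ξ (some k)) (z, u) with hxdef
  set m : (Option (Fin n) → ℝ) → ℝ := fun p => dirDeriv fibreDir η (z, u)
    - ∑ k, p (some k) * x k with hm
  let J : (Fin n → ℝ) → Matrix (Fin n) (Fin n) ℝ := fun P => B + Matrix.vecMulVec x P
  have key : ∀ p : Option (Fin n) → ℝ, A' + (m p - mult p) • A =
      J (fun i => p (some i)) * A + A * (J fun i => p (some i)).transpose := by
    intro p
    refine matrix_eq_of_contraction hA hA' fun Q hQ => ?_
    let q : Option (Fin n) → Option (Fin n) → ℝ := fun a b =>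
      a.elim 0 (fun i => b.elim 0 fun j => Q i j)
    have hq : ∀ a b, q a b = q b a := by
      intro a b; cases a <;> cases b <;> simp [q, hQ]
    have := h.second_order hU hW hWU hG hdet hξ hη hw p hq
    simp only [q, Fintype.sum_option, Option.elim, hu _ hw, zero_mul, mul_zero, zero_add] at this
    rw [← sub_eq_zero, Finset.mul_sum, ← Finset.sum_sub_distrib] at this
    rw [← this]
    refine Finset.sum_congr rfl fun i _ => ?_
    rw [Finset.mul_sum, ← Finset.sum_sub_distrib]
    refine Finset.sum_congr rfl fun j _ => ?_
    simp only [J, hB, jacobianMatrix, Matrix.add_apply, Matrix.of_apply, Matrix.vecMulVec_apply,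
      hA'def, dirDerivMatrix, hm, hxdef, hQ j i, ← hAdef]
    have e : ∀ i k : Fin n, dirDeriv (spaceDir i) (ξ (some k)) (z, u)
        + dirDeriv fibreDir (ξ (some k)) (z, u) * p (some i) =
        dirDeriv (spaceDir i) (ξ (some k)) (z, u)
        + p (some i) * dirDeriv fibreDir (ξ (some k)) (z, u) := fun i k => by ring
    simp only [e]
    ring
  have hmult : ∀ p, mult p = m p - dirDeriv timeDir (ξ none) (z, u) := by
    intro p
    -- Only u_t is raised, by one. The matrix identity contains u_t only through the multiplier, so
    -- the multiplier does not depend on u_t.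
    let p' : Option (Fin n) → ℝ := fun a => a.elim (p none + 1) fun i => p (some i)
    have hpp : mult p' = mult p := by
      have e : (m p - mult p) • A = (m p' - mult p') • A :=
        add_left_cancel ((key p).trans (key p').symm)
      have e2 : (mult p' - mult p) • A = 0 := by
        have : mult p' - mult p = (m p - mult p) - (m p' - mult p') := by
          simp only [hm, p', Option.elim]; ring
        rw [this, sub_smul, e, sub_self]
      exact sub_eq_zero.1 ((smul_eq_zero.1 e2).resolve_right hA0)
    have z5 : ∀ i v, dirDeriv v (dirDeriv (baseDir (some i)) (ξ none)) (z, u) = 0 := fun i v =>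
      dirDeriv_eq_zero hW (fun x hy => hx x hy i) hw
    have z6 : ∀ i, dirDeriv (baseDir (some i)) (ξ none) (z, u) = 0 := fun i => hx _ hw i
    have z3 : ∀ v, dirDeriv v (dirDeriv fibreDir (ξ none)) (z, u) = 0 := fun v =>
      dirDeriv_eq_zero hW hu hw
    -- At q = 0 the difference of the conditions at `p'` and `p` is the coefficient of u_t, and H
    -- has coefficient -1 there.
    have h1 := h p 0 fun _ _ => rfl
    have h2 := h p' 0 fun _ _ => rfl
    rw [hpp] at h2
    rw [prolongApply_heatFun hU hG hdet ξ η u hz] at h1 h2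
    simp only [heatFun, prolong₂_eq hW hξ hη hw, prolong₁_eq, z3, z5, z6, hu _ hw,
      Fintype.sum_option, Pi.zero_apply, mul_zero, zero_mul, add_zero, zero_add,
      Finset.sum_const_zero, zero_sub, sub_zero, p', Option.elim] at h1 h2
    have e3 : ∀ c : ℝ, ∑ k, p (some k) * (dirDeriv (baseDir none) (ξ (some k)) (z, u)
        + c * dirDeriv fibreDir (ξ (some k)) (z, u)) =
        ∑ k, p (some k) * dirDeriv (baseDir none) (ξ (some k)) (z, u)
        + c * ∑ k, p (some k) * dirDeriv fibreDir (ξ (some k)) (z, u) := fun c => by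
      rw [Finset.mul_sum, ← Finset.sum_add_distrib]
      exact Finset.sum_congr rfl fun k _ => by ring
    rw [e3] at h1 h2
    simp only [hm, hxdef, timeDir]
    linear_combination h2 - h1
  have key2 : ∀ P : Fin n → ℝ, A' + dirDeriv timeDir (ξ none) (z, u) • A =
      J P * A + A * (J P).transpose := by
    intro P
    have := key (fun a => a.elim 0 P)
    rw [hmult, sub_sub_cancel] at this
    exact this
  have hJ0 : J 0 = B := by
    ext i j; simp [J, Matrix.vecMulVec_apply]
  have key0 := key2 0
  rw [hJ0] at key0
  -- Subtracting the identity at P = 0 leaves only the rank one terms.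
  have hx0 : x = 0 := by
    refine eq_zero_of_rank_one hA hdetA fun P => ?_
    have := (key2 P).symm.trans key0
    simp only [J, Matrix.add_mul, Matrix.transpose_add, Matrix.mul_add] at this
    rw [add_add_add_comm] at this
    exact (add_eq_left).1 this
  refine ⟨fun k => congrFun hx0 k, ?_, fun p => hmult p⟩
  refine lieDerivMetric_of_dirDerivMatrix_inv (σ := dirDeriv timeDir (ξ none)) hW sG hdet' hw ?_
  rw [← hA'def, ← hAdef, ← hB, eq_sub_iff_add_eq, key0, add_comm]

/-- The symmetry condition for the heat equation implies the determining equations. -/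
theorem DeterminingSystem.of_symmetryCondition [Nonempty (Fin n)] (hU : IsOpen U) (hW : IsOpen W)
    (hWU : ∀ w ∈ W, spacePart w.1 ∈ U)
    (hG : ∀ i j, ContDiffOn ℝ ∞ (fun y => G y i j) U) (hsymm : ∀ y i j, G y i j = G y j i)
    (hdet : ∀ y ∈ U, IsUnit (G y).det)
    (hξ : ∀ k, ContDiffOn ℝ ∞ (ξ k) W) (hη : ContDiffOn ℝ ∞ η W)
    (h : ∀ w ∈ W, ∃ mult, SymmetryConditionAt G ξ η w.1 w.2 mult) :
    DeterminingSystem G W ξ η := by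
  have hx : ∀ w ∈ W, ∀ i, dirDeriv (spaceDir i) (ξ none) w = 0 := fun w hw i => by
    obtain ⟨mult, hm⟩ := h w hw
    simpa using hm.time_component hU hW hWU hG hsymm hdet hξ hη hw 0 i
  have hu : ∀ w ∈ W, dirDeriv fibreDir (ξ none) w = 0 := fun w hw => by
    obtain ⟨mult, hm⟩ := h w hw
    obtain ⟨i⟩ := ‹Nonempty (Fin n)›
    -- Once τ_{,i} = 0 is known, the value p_i = 1 isolates τ_u; one spatial coordinate is enough,
    -- which is where n ≥ 1 enters.
    have := hm.time_component hU hW hWU hG hsymm hdet hξ hη hw 1 i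
    rw [hx w hw i] at this
    simpa using this
  have hp : IsProjectableHomothetic G W ξ := by
    refine ⟨hx, hu, fun w hw => ?_, fun w hw => ?_⟩
    · obtain ⟨mult, hm⟩ := h w hw
      exact (hm.projectable hU hW hWU hG hsymm hdet hξ hη hx hu hw).1
    · obtain ⟨mult, hm⟩ := h w hw
      exact (hm.projectable hU hW hWU hG hsymm hdet hξ hη hx hu hw).2.1
  have hc : ∀ w ∈ W, heatOperator G η w = 0 ∧ (∀ i,
      2 * ∑ j, (pullMetric G w)⁻¹ i j * dirDeriv (spaceDir j) (dirDeriv fibreDir η) w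
      + dirDeriv timeDir (ξ (some i)) w = 0) ∧
      dirDeriv fibreDir (dirDeriv fibreDir η) w = 0 := by
    intro w hw
    obtain ⟨mult, hm⟩ := h w hw
    have hmult := (hm.projectable hU hW hWU hG hsymm hdet hξ hη hx hu hw).2.2
    refine quadratic_coefficients_eq_zero (inv_symm_apply (hsymm _))
      (Matrix.isUnit_nonsing_inv_det _ (hdet _ (hWU w hw))) fun P => ?_
    -- The reduced expression involves only the spatial first derivatives, so q = 0 and u_t = 0 lose
    -- nothing.
    have h1 := hp.prolongApply_sub hU hW hWU hG hsymm hdet hξ hη (z := w.1) (u := w.2) hw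
      (fun a => a.elim 0 P) (q := 0) fun _ _ => rfl
    rw [hm _ _ fun _ _ => rfl, hmult] at h1
    simp only [hp.space_fibre w hw, mul_zero, Finset.sum_const_zero, sub_zero, sub_self,
      Option.elim, Prod.mk.eta] at h1
    exact h1.symm
  exact ⟨hp, fun w hw => (hc w hw).2.2, fun w hw => (hc w hw).2.1, fun w hw => (hc w hw).1⟩

/-- The determining equations imply the symmetry condition for the heat equation. -/
theorem DeterminingSystem.prolongApply_eq (hU : IsOpen U) (hW : IsOpen W)
    (hWU : ∀ w ∈ W, spacePart w.1 ∈ U)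
    (hG : ∀ i j, ContDiffOn ℝ ∞ (fun y => G y i j) U) (hsymm : ∀ y i j, G y i j = G y j i)
    (hdet : ∀ y ∈ U, IsUnit (G y).det)
    (hξ : ∀ k, ContDiffOn ℝ ∞ (ξ k) W) (hη : ContDiffOn ℝ ∞ η W)
    (h : DeterminingSystem G W ξ η) {z : Option (Fin n) → ℝ} {u : ℝ} (hw : (z, u) ∈ W) :
    SymmetryConditionAt G ξ η z u fun _ =>
      dirDeriv fibreDir η (z, u) - dirDeriv timeDir (ξ none) (z, u) := by
  intro p q hq
  have h1 := h.toIsProjectableHomothetic.prolongApply_sub hU hW hWU hG hsymm hdet hξ hη hw p hq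
  simp only [h.heat _ hw, h.drift _ hw, h.fibre_affine _ hw, mul_zero, Finset.sum_const_zero,
    add_zero] at h1
  exact sub_eq_zero.1 h1

end DeterminingForward

/-! ### Consequences of the determining equations -/

noncomputable section Slices

variable {n : ℕ}

theorem dirDeriv_comp_affine {E F : Type*} [NormedAddCommGroup E] [NormedSpace ℝ E]
    [NormedAddCommGroup F] [NormedSpace ℝ F] (L : E →L[ℝ] F) (c : F) {f : F → ℝ} {v w : E}
    (hf : DifferentiableAt ℝ f (c + L w)) :
    dirDeriv v (fun x => f (c + L x)) w = dirDeriv (L v) f (c + L w) := by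
  have : HasFDerivAt (fun x => f (c + L x)) ((fderiv ℝ f (c + L w)).comp L) w :=
    HasFDerivAt.comp w hf.hasFDerivAt (L.hasFDerivAt.const_add c)
  simp [dirDeriv, this.fderiv]

theorem hasDerivAt_line {E : Type*} [NormedAddCommGroup E] [NormedSpace ℝ E] {f : E → ℝ}
    (c v : E) {s : ℝ} (hf : DifferentiableAt ℝ f (c + s • v)) :
    HasDerivAt (fun s : ℝ => f (c + s • v)) (dirDeriv v f (c + s • v)) s := by
  have h1 : HasDerivAt (fun s : ℝ => c + s • v) v s := by
    simpa using ((hasDerivAt_id s).smul_const v).const_add c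
  exact hf.hasFDerivAt.comp_hasDerivAt s h1

/-- The point with coordinates `(t, y)`. -/
def txPoint (t : ℝ) (y : Fin n → ℝ) : Option (Fin n) → ℝ := fun a => a.elim t y

/-- The inclusion of the space directions. -/
def spaceIncl : (Fin n → ℝ) →L[ℝ] (Option (Fin n) → ℝ) × ℝ :=
  ContinuousLinearMap.prod
    (ContinuousLinearMap.pi fun a => a.elim 0 fun i => ContinuousLinearMap.proj i) 0

theorem spaceIncl_apply (t u : ℝ) (y : Fin n → ℝ) :
    ((txPoint t 0, u) : (Option (Fin n) → ℝ) × ℝ) + spaceIncl y = (txPoint t y, u) := by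
  refine Prod.ext (funext fun a => ?_) (by simp [spaceIncl])
  cases a <;> simp [spaceIncl, txPoint]

theorem spaceIncl_single (i : Fin n) : spaceIncl (Pi.single i (1 : ℝ)) = spaceDir i := by
  refine Prod.ext (funext fun a => ?_) (by simp [spaceIncl, spaceDir, baseDir])
  cases a <;> simp [spaceIncl, spaceDir, baseDir, Pi.single_apply]

variable {f : (Option (Fin n) → ℝ) × ℝ → ℝ} {t u : ℝ} {y : Fin n → ℝ}

theorem dirDeriv_spaceSlice (hf : DifferentiableAt ℝ f (txPoint t y, u)) (i : Fin n) :
    dirDeriv (Pi.single i 1) (fun y => f (txPoint t y, u)) y =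
      dirDeriv (spaceDir i) f (txPoint t y, u) := by
  rw [← spaceIncl_apply] at hf
  have := dirDeriv_comp_affine (v := Pi.single i 1) spaceIncl (txPoint t 0, u) hf
  simpa only [spaceIncl_apply, spaceIncl_single] using this

theorem hasDerivAt_timeSlice (hf : DifferentiableAt ℝ f (txPoint t y, u)) :
    HasDerivAt (fun s => f (txPoint s y, u)) (dirDeriv timeDir f (txPoint t y, u)) t := by
  have e : ∀ s : ℝ, ((txPoint 0 y, u) : (Option (Fin n) → ℝ) × ℝ) + s • timeDir =
      (txPoint s y, u) := fun s => by
    refine Prod.ext (funext fun a => ?_) (by simp [timeDir, baseDir])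
    cases a <;> simp [timeDir, baseDir, txPoint]
  rw [← e] at hf
  simpa only [e] using hasDerivAt_line (txPoint 0 y, u) timeDir hf

theorem hasDerivAt_fibreSlice {z : Option (Fin n) → ℝ} (hf : DifferentiableAt ℝ f (z, u)) :
    HasDerivAt (fun s => f (z, s)) (dirDeriv fibreDir f (z, u)) u := by
  have e : ∀ s : ℝ, ((z, 0) : (Option (Fin n) → ℝ) × ℝ) + s • fibreDir = (z, s) := fun s => by
    simp [fibreDir]
  rw [← e] at hf
  simpa only [e] using hasDerivAt_line (z, 0) fibreDir hf

theorem dirDeriv_baseSlice {z : Option (Fin n) → ℝ} (hf : DifferentiableAt ℝ f (z, u))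
    (a : Option (Fin n)) :
    dirDeriv (Pi.single a 1) (fun z => f (z, u)) z = dirDeriv (baseDir a) f (z, u) := by
  have e : ∀ z : Option (Fin n) → ℝ, ((0, u) : (Option (Fin n) → ℝ) × ℝ) +
      ContinuousLinearMap.inl ℝ (Option (Fin n) → ℝ) ℝ z = (z, u) := fun z => by simp
  rw [← e] at hf
  have := dirDeriv_comp_affine (v := Pi.single a 1) (ContinuousLinearMap.inl ℝ (Option (Fin n) → ℝ) ℝ) (0, u) hf
  simp only [e] at this
  exact this

theorem dirDeriv_spaceFun {U : Set (Fin n → ℝ)} (hU : IsOpen U) {F : (Fin n → ℝ) → ℝ}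
    (hF : ContDiffOn ℝ ∞ F U) {w : (Option (Fin n) → ℝ) × ℝ} (hw : spacePart w.1 ∈ U)
    (v : (Option (Fin n) → ℝ) × ℝ) :
    dirDeriv v (fun w : (Option (Fin n) → ℝ) × ℝ => F (spacePart w.1)) w =
      dirDeriv (spacePart v.1) F (spacePart w.1) :=
  dirDeriv_comp (w := w) spaceProjE (hF.differentiableAt_of_isOpen hU hw)

theorem spacePart_spaceDir (i : Fin n) : spacePart (spaceDir i).1 = Pi.single i 1 :=
  spaceProjE_spaceDir i

theorem spacePart_timeDir : spacePart (timeDir (n := n)).1 = 0 := by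
  funext i; simp [timeDir, baseDir, spacePart]

theorem spacePart_fibreDir : spacePart (fibreDir (ι := Option (Fin n))).1 = 0 := by
  funext i; simp [fibreDir, spacePart]

end Slices

/-! ### Differential consequences of the system, and solutions from homothetic data -/

noncomputable section DeterminingConsequences

variable {n : ℕ} {U : Set (Fin n → ℝ)} {G : (Fin n → ℝ) → Matrix (Fin n) (Fin n) ℝ}
  {W : Set ((Option (Fin n) → ℝ) × ℝ)} {ξ : Option (Fin n) → (Option (Fin n) → ℝ) × ℝ → ℝ}
  {η : (Option (Fin n) → ℝ) × ℝ → ℝ}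

/-- A constant direction that annihilates the metric coefficients commutes with the Lie derivative,
so the homothety equation may be differentiated along it. Used for the time direction, once for ξ_t
and again for ξ_tt. -/
theorem lieDerivMetric_dirDeriv {E : Type*} [NormedAddCommGroup E] [NormedSpace ℝ E] {W : Set E}
    {G : E → Matrix (Fin n) (Fin n) ℝ} {v : Fin n → E} {ξ : Fin n → E → ℝ} {σ : E → ℝ}
    (hW : IsOpen W) (hG : ∀ i j, ContDiffOn ℝ ∞ (fun w => G w i j) W)
    (hξ : ∀ k, ContDiffOn ℝ ∞ (ξ k) W) (hσ : ContDiffOn ℝ ∞ σ W) {V : E}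
    (hV : ∀ w ∈ W, ∀ i j, dirDeriv V (fun w => G w i j) w = 0)
    (hL : ∀ w ∈ W, ∀ i j, lieDerivMetric G v ξ w i j = σ w * G w i j) {w : E} (hw : w ∈ W)
    (i j : Fin n) :
    lieDerivMetric G v (fun k => dirDeriv V (ξ k)) w i j = dirDeriv V σ w * G w i j := by
  have dG := fun i j => (hG i j).differentiableAt_of_isOpen hW hw
  have dξ := fun k => (hξ k).differentiableAt_of_isOpen hW hw
  have ddG := fun V i j => ((hG i j).dirDeriv hW V).differentiableAt_of_isOpen hW hw
  have ddξ := fun V k => ((hξ k).dirDeriv hW V).differentiableAt_of_isOpen hW hw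
  have h := dirDeriv_congr (v := V) hW (fun x hx => hL x hx i j) hw
  unfold lieDerivMetric at h
  rw [dirDeriv_mul (hσ.differentiableAt_of_isOpen hW hw) (dG i j), hV w hw, mul_zero, add_zero,
    dirDeriv_sum (fun k _ => (((dξ k).fun_mul (ddG _ _ _)).fun_add
      ((dG _ _).fun_mul (ddξ _ _))).fun_add ((dG _ _).fun_mul (ddξ _ _)))] at h
  rw [← h, lieDerivMetric]
  refine Finset.sum_congr rfl fun k _ => ?_
  have hz : dirDeriv V (dirDeriv (v k) fun w => G w i j) w = 0 := by
    rw [dirDeriv_comm (hG i j) hW hw]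
    exact dirDeriv_eq_zero hW (fun x hx => hV x hx i j) hw
  rw [dirDeriv_add (((dξ k).fun_mul (ddG _ _ _)).fun_add ((dG _ _).fun_mul (ddξ _ _)))
      ((dG _ _).fun_mul (ddξ _ _)),
    dirDeriv_add ((dξ k).fun_mul (ddG _ _ _)) ((dG _ _).fun_mul (ddξ _ _)),
    dirDeriv_mul (dξ k) (ddG _ _ _), dirDeriv_mul (dG _ _) (ddξ _ _),
    dirDeriv_mul (dG _ _) (ddξ _ _), hz, hV w hw, hV w hw, dirDeriv_comm (hξ k) hW hw V,
    dirDeriv_comm (hξ k) hW hw V]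
  ring

/-- The coefficients of the operator do not depend on u. -/
theorem heatOperator_dirDeriv_fibre (hU : IsOpen U) (hW : IsOpen W)
    (hWU : ∀ w ∈ W, spacePart w.1 ∈ U)
    (hG : ∀ i j, ContDiffOn ℝ ∞ (fun y => G y i j) U) (hdet : ∀ y ∈ U, IsUnit (G y).det)
    (hη : ContDiffOn ℝ ∞ η W) {w : (Option (Fin n) → ℝ) × ℝ} (hw : w ∈ W) :
    dirDeriv fibreDir (heatOperator G η) w = heatOperator G (dirDeriv fibreDir η) w := by
  have sG := contDiffOn_pullMetric hG hWU
  have hdet' : ∀ w ∈ W, IsUnit (pullMetric G w).det := fun w hw => hdet _ (hWU w hw)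
  have dA := fun i j => (contDiffOn_inv_apply sG hdet' i j).differentiableAt_of_isOpen hW hw
  have dΓ := fun i => (contDiffOn_tracedChristoffel (v := spaceDir) hW sG hdet'
    i).differentiableAt_of_isOpen hW hw
  have d1 := fun V => (hη.dirDeriv hW V).differentiableAt_of_isOpen hW hw
  have d2 := fun V V' => ((hη.dirDeriv hW V).dirDeriv hW V').differentiableAt_of_isOpen hW hw
  have zA : ∀ i j, dirDeriv fibreDir (fun w => (pullMetric G w)⁻¹ i j) w = 0 := fun i j =>
    (dirDeriv_spaceFun hU (contDiffOn_inv_apply hG hdet i j) (hWU w hw) _).trans (by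
      rw [spacePart_fibreDir]; simp [dirDeriv])
  have zΓ : ∀ i, dirDeriv fibreDir (fun w => tracedChristoffel (pullMetric G) spaceDir w i) w = 0 :=
    fun i => by
      refine (dirDeriv_congr hW
        (fun x hx => congrFun (tracedChristoffel_pullback hU hG (hWU x hx)) i) hw).trans ?_
      exact (dirDeriv_spaceFun hU (contDiffOn_tracedChristoffel hU hG hdet i) (hWU w hw) _).trans
        (by rw [spacePart_fibreDir]; simp [dirDeriv])
  unfold heatOperator
  rw [dirDeriv_sub ((DifferentiableAt.fun_sum fun i _ => DifferentiableAt.fun_sum fun j _ =>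
      (dA i j).fun_mul (d2 _ _)).fun_sub (DifferentiableAt.fun_sum fun i _ =>
      (dΓ i).fun_mul (d1 _))) (d1 _),
    dirDeriv_sub (DifferentiableAt.fun_sum fun i _ => DifferentiableAt.fun_sum fun j _ =>
      (dA i j).fun_mul (d2 _ _)) (DifferentiableAt.fun_sum fun i _ => (dΓ i).fun_mul (d1 _)),
    dirDeriv_sum fun i _ => DifferentiableAt.fun_sum fun j _ => (dA i j).fun_mul (d2 _ _),
    dirDeriv_sum fun i _ => (dΓ i).fun_mul (d1 _), dirDeriv_comm hη hW hw fibreDir timeDir]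
  congr 2
  · refine Finset.sum_congr rfl fun i _ => ?_
    rw [dirDeriv_sum fun j _ => (dA i j).fun_mul (d2 _ _)]
    refine Finset.sum_congr rfl fun j _ => ?_
    rw [dirDeriv_mul (dA i j) (d2 _ _), zA, zero_mul, zero_add,
      dirDeriv_comm (hη.dirDeriv hW _) hW hw fibreDir]
    congr 1
    exact dirDeriv_congr hW (fun x hx => dirDeriv_comm hη hW hx _ _) hw
  · refine Finset.sum_congr rfl fun i _ => ?_
    rw [dirDeriv_mul (dΓ i) (d1 _), zΓ, zero_mul, zero_add, dirDeriv_comm hη hW hw fibreDir]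

theorem pullMetric_timeDeriv (hU : IsOpen U) (hG : ∀ i j, ContDiffOn ℝ ∞ (fun y => G y i j) U)
    {w : (Option (Fin n) → ℝ) × ℝ} (hw : spacePart w.1 ∈ U) (i j : Fin n) :
    dirDeriv timeDir (fun w => pullMetric G w i j) w = 0 :=
  (dirDeriv_spaceFun hU (hG i j) hw _).trans (by rw [spacePart_timeDir]; simp [dirDeriv])

/-- The potential of the time derivative of the space part of a symmetry. -/
theorem DeterminingSystem.gradient (hWU : ∀ w ∈ W, spacePart w.1 ∈ U)
    (hdet : ∀ y ∈ U, IsUnit (G y).det) (h : DeterminingSystem G W ξ η)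
    {w : (Option (Fin n) → ℝ) × ℝ} (hw : w ∈ W) (i : Fin n) :
    ∑ k, pullMetric G w i k * dirDeriv timeDir (ξ (some k)) w =
      -2 * dirDeriv (spaceDir i) (dirDeriv fibreDir η) w := by
  set a : Fin n → ℝ := fun j => dirDeriv (spaceDir j) (dirDeriv fibreDir η) w with ha
  have h1 : (fun k => dirDeriv timeDir (ξ (some k)) w) =
      (pullMetric G w)⁻¹.mulVec ((-2 : ℝ) • a) := by
    funext k
    rw [Matrix.mulVec_smul]
    have := h.drift w hw k
    simp only [Pi.smul_apply, Matrix.mulVec, dotProduct, smul_eq_mul, ha]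
    linarith
  change (pullMetric G w).mulVec (fun k => dirDeriv timeDir (ξ (some k)) w) i = _
  rw [h1, Matrix.mulVec_mulVec, Matrix.mul_nonsing_inv (pullMetric G w) (hdet _ (hWU w hw)),
    Matrix.one_mulVec]
  simp [ha]

theorem DeterminingSystem.lie_timeDeriv (hU : IsOpen U) (hW : IsOpen W)
    (hWU : ∀ w ∈ W, spacePart w.1 ∈ U)
    (hG : ∀ i j, ContDiffOn ℝ ∞ (fun y => G y i j) U)
    (hξ : ∀ k, ContDiffOn ℝ ∞ (ξ k) W)
    (h : DeterminingSystem G W ξ η) {w : (Option (Fin n) → ℝ) × ℝ} (hw : w ∈ W) (i j : Fin n) :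
    lieDerivMetric (pullMetric G) spaceDir (fun k => dirDeriv timeDir (ξ (some k))) w i j =
      dirDeriv timeDir (dirDeriv timeDir (ξ none)) w * pullMetric G w i j :=
  lieDerivMetric_dirDeriv hW (contDiffOn_pullMetric hG hWU) (fun k => hξ (some k))
    ((hξ none).dirDeriv hW _)
    (fun w hw i j => pullMetric_timeDeriv hU hG (hWU w hw) i j) h.lie hw i j

/-- Two evaluations of the Laplacian of η_u: as the u-derivative of the heat equation for η it is
η_ut, and as -1/2 times the Laplacian of the potential of the homothetic gradient ξ_t it is -(1/2)(n
τ_tt/2). -/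
theorem DeterminingSystem.linear_timeDeriv (hU : IsOpen U) (hW : IsOpen W)
    (hWU : ∀ w ∈ W, spacePart w.1 ∈ U)
    (hG : ∀ i j, ContDiffOn ℝ ∞ (fun y => G y i j) U) (hsymm : ∀ y i j, G y i j = G y j i)
    (hdet : ∀ y ∈ U, IsUnit (G y).det)
    (hξ : ∀ k, ContDiffOn ℝ ∞ (ξ k) W) (hη : ContDiffOn ℝ ∞ η W)
    (h : DeterminingSystem G W ξ η) {w : (Option (Fin n) → ℝ) × ℝ} (hw : w ∈ W) :
    dirDeriv timeDir (dirDeriv fibreDir η) w =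
      -(n / 4) * dirDeriv timeDir (dirDeriv timeDir (ξ none)) w := by
  have sa := hη.dirDeriv hW fibreDir
  have h1 : heatOperator G (dirDeriv fibreDir η) w = 0 := by
    rw [← heatOperator_dirDeriv_fibre hU hW hWU hG hdet hη hw]
    exact dirDeriv_eq_zero hW h.heat hw
  have e1 : ∀ v, ∀ x ∈ W, dirDeriv v (fun x => -2 * dirDeriv fibreDir η x) x =
      -2 * dirDeriv v (dirDeriv fibreDir η) x := fun v x hx =>
    dirDeriv_const_mul _ (sa.differentiableAt_of_isOpen hW hx)
  have e2 : ∀ v v', dirDeriv v (dirDeriv v' (fun x => -2 * dirDeriv fibreDir η x)) w =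
      -2 * dirDeriv v (dirDeriv v' (dirDeriv fibreDir η)) w := fun v v' => by
    rw [dirDeriv_congr hW (e1 v') hw]
    exact dirDeriv_const_mul _ ((sa.dirDeriv hW v').differentiableAt_of_isOpen hW hw)
  have h2 := laplacian_of_homothetic_gradient hW (contDiffOn_pullMetric hG hWU)
    (fun w => hsymm _) (fun w hw => hdet _ (hWU w hw)) (v := spaceDir)
    (Z := fun k => dirDeriv timeDir (ξ (some k))) (S := fun x => -2 * dirDeriv fibreDir η x)
    (fun k => (hξ _).dirDeriv hW _) (contDiffOn_const.mul sa)
    (fun x hx i => (h.gradient hWU hdet hx i).trans (e1 _ x hx).symm) hw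
    (fun i j => h.lie_timeDeriv hU hW hWU hG hξ hw i j)
  simp only [e1 _ w hw, e2, mul_left_comm _ (-2 : ℝ), ← Finset.mul_sum, Fintype.card_fin] at h2
  unfold heatOperator at h1
  linarith

/-- Differentiating ξ^i_t = -2 g^{ij} η_{uj} in t brings in the spatial gradient of η_ut, which is
zero because η_ut is a multiple of τ_tt. -/
theorem DeterminingSystem.space_timeDeriv_timeDeriv (hU : IsOpen U) (hW : IsOpen W)
    (hWU : ∀ w ∈ W, spacePart w.1 ∈ U)
    (hG : ∀ i j, ContDiffOn ℝ ∞ (fun y => G y i j) U) (hsymm : ∀ y i j, G y i j = G y j i)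
    (hdet : ∀ y ∈ U, IsUnit (G y).det)
    (hξ : ∀ k, ContDiffOn ℝ ∞ (ξ k) W) (hη : ContDiffOn ℝ ∞ η W)
    (h : DeterminingSystem G W ξ η) {w : (Option (Fin n) → ℝ) × ℝ} (hw : w ∈ W) (i : Fin n) :
    dirDeriv timeDir (dirDeriv timeDir (ξ (some i))) w = 0 := by
  have sa := hη.dirDeriv hW fibreDir
  have sτ := (hξ none).dirDeriv hW timeDir
  have h1 : ∀ j, dirDeriv timeDir (dirDeriv (spaceDir j) (dirDeriv fibreDir η)) w = 0 := by
    intro j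
    have h2 : dirDeriv (spaceDir j) (dirDeriv timeDir (dirDeriv timeDir (ξ none))) w = 0 := by
      rw [dirDeriv_comm sτ hW hw]
      refine dirDeriv_eq_zero hW (c := 0) (fun x hx => ?_) hw
      rw [dirDeriv_comm (hξ none) hW hx]
      exact dirDeriv_eq_zero hW (fun y hy => h.time_space y hy j) hx
    rw [dirDeriv_comm sa hW hw, dirDeriv_congr hW
      (fun x hx => h.linear_timeDeriv hU hW hWU hG hsymm hdet hξ hη hx) hw,
      dirDeriv_const_mul _ ((sτ.dirDeriv hW _).differentiableAt_of_isOpen hW hw), h2, mul_zero]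
  have sA := contDiffOn_inv_apply (contDiffOn_pullMetric hG hWU) (fun w hw => hdet _ (hWU w hw))
  have hA : ∀ j, dirDeriv timeDir (fun w => (pullMetric G w)⁻¹ i j) w = 0 := fun j =>
    (dirDeriv_spaceFun hU (contDiffOn_inv_apply hG hdet i j) (hWU w hw) _).trans
      (by rw [spacePart_timeDir]; simp [dirDeriv])
  have hd : ∀ j, DifferentiableAt ℝ (fun w => (pullMetric G w)⁻¹ i j
      * dirDeriv (spaceDir j) (dirDeriv fibreDir η) w) w := fun j =>
    ((sA i j).mul (sa.dirDeriv hW _)).differentiableAt_of_isOpen hW hw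
  rw [dirDeriv_congr (g := fun w => -2 * ∑ j, (pullMetric G w)⁻¹ i j
      * dirDeriv (spaceDir j) (dirDeriv fibreDir η) w) hW
      (fun x hx => by have := h.drift x hx i; linarith) hw,
    dirDeriv_const_mul _ (DifferentiableAt.fun_sum fun j _ => hd j),
    dirDeriv_sum fun j _ => hd j, Finset.sum_eq_zero, mul_zero]
  intro j _
  rw [dirDeriv_mul ((sA i j).differentiableAt_of_isOpen hW hw)
    ((sa.dirDeriv hW _).differentiableAt_of_isOpen hW hw), hA, h1, zero_mul, mul_zero, add_zero]

/-- Differentiating the homothety equation twice in t gives 0 = L_{ξ_tt} g = τ_ttt g, while g is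
nonzero. -/
theorem DeterminingSystem.time_third_deriv [Nonempty (Fin n)] (hU : IsOpen U) (hW : IsOpen W)
    (hWU : ∀ w ∈ W, spacePart w.1 ∈ U)
    (hG : ∀ i j, ContDiffOn ℝ ∞ (fun y => G y i j) U) (hsymm : ∀ y i j, G y i j = G y j i)
    (hdet : ∀ y ∈ U, IsUnit (G y).det)
    (hξ : ∀ k, ContDiffOn ℝ ∞ (ξ k) W) (hη : ContDiffOn ℝ ∞ η W)
    (h : DeterminingSystem G W ξ η) {w : (Option (Fin n) → ℝ) × ℝ} (hw : w ∈ W) :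
    dirDeriv timeDir (dirDeriv timeDir (dirDeriv timeDir (ξ none))) w = 0 := by
  by_contra hne
  have h0 : pullMetric G w = 0 := by
    ext i j
    have h1 := lieDerivMetric_dirDeriv hW (contDiffOn_pullMetric hG hWU)
      (fun k => (hξ (some k)).dirDeriv hW timeDir) (((hξ none).dirDeriv hW _).dirDeriv hW _)
      (fun w hw i j => pullMetric_timeDeriv hU hG (hWU w hw) i j)
      (fun w hw i j => h.lie_timeDeriv hU hW hWU hG hξ hw i j) hw i j
    have hz := fun k => fun x hx =>
      h.space_timeDeriv_timeDeriv hU hW hWU hG hsymm hdet hξ hη (w := x) hx k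
    have hz' : ∀ k v, dirDeriv v (dirDeriv timeDir (dirDeriv timeDir (ξ (some k)))) w = 0 :=
      fun k v => dirDeriv_eq_zero hW (hz k) hw
    simp only [lieDerivMetric, hz', hz _ w hw, zero_mul, mul_zero, add_zero,
      Finset.sum_const_zero] at h1
    exact (mul_eq_zero.1 h1.symm).resolve_left hne
  have := hdet _ (hWU w hw)
  change IsUnit (pullMetric G w).det at this
  rw [h0, Matrix.det_zero] at this
  exact not_isUnit_zero this

/-- A vector field `Y` and a gradient field `Z` with potential `S`, both homothetic, solve the
determining equations. -/
theorem DeterminingSystem.of_homothetic (hU : IsOpen U) (hW : IsOpen W)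
    (hWU : ∀ w ∈ W, spacePart w.1 ∈ U)
    (hG : ∀ i j, ContDiffOn ℝ ∞ (fun y => G y i j) U) (hsymm : ∀ y i j, G y i j = G y j i)
    (hdet : ∀ y ∈ U, IsUnit (G y).det) {Ω : Set (Option (Fin n) → ℝ)} (hΩ : IsOpen Ω)
    (hWΩ : ∀ w ∈ W, w.1 ∈ Ω) {Y Z : Fin n → (Fin n → ℝ) → ℝ} {S : (Fin n → ℝ) → ℝ}
    {b : (Option (Fin n) → ℝ) → ℝ} {ψ φ c a₀ : ℝ}
    (hY : ∀ k, ContDiffOn ℝ ∞ (Y k) U) (hZ : ∀ k, ContDiffOn ℝ ∞ (Z k) U)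
    (hS : ContDiffOn ℝ ∞ S U) (hb : ContDiffOn ℝ ∞ b Ω)
    (hLY : ∀ y ∈ U, ∀ i j,
      lieDerivMetric G (fun k => Pi.single k 1) Y y i j = 2 * ψ * G y i j)
    (hLZ : ∀ y ∈ U, ∀ i j,
      lieDerivMetric G (fun k => Pi.single k 1) Z y i j = 2 * φ * G y i j)
    (hgrad : ∀ y ∈ U, ∀ i, ∑ k, G y i k * Z k y = dirDeriv (Pi.single i 1) S y)
    (hheat : SatisfiesPDE Ω (heatFun G) b)
    (h0 : ∀ w ∈ W, ξ none w = φ * w.1 none ^ 2 + 2 * ψ * w.1 none + c)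
    (h1 : ∀ w ∈ W, ∀ k, ξ (some k) w = Y k (spacePart w.1) + w.1 none * Z k (spacePart w.1))
    (h2 : ∀ w ∈ W, η w =
      (-(1 / 2) * S (spacePart w.1) - 1 / 2 * n * φ * w.1 none + a₀) * w.2 + b w.1) :
    DeterminingSystem G W ξ η := by
  let T : (Option (Fin n) → ℝ) × ℝ →L[ℝ] ℝ :=
    (ContinuousLinearMap.proj none).comp (ContinuousLinearMap.fst ℝ _ _)
  have dT : ∀ w, DifferentiableAt ℝ (fun w => T w) w := fun w => T.differentiableAt
  have T0 : ∀ v w, dirDeriv v (fun w => T w) w = T v := fun v w => by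
    simp only [dirDeriv, ContinuousLinearMap.fderiv]
  have Ts : ∀ i, T (spaceDir i) = 0 := fun i => by simp [T, spaceDir, baseDir]
  have Tt : T timeDir = 1 := by simp [T, timeDir, baseDir]
  have Tu : T fibreDir = 0 := by simp [T, fibreDir]
  let P : (Option (Fin n) → ℝ) × ℝ →L[ℝ] ℝ := ContinuousLinearMap.snd ℝ _ _
  have dP : ∀ w, DifferentiableAt ℝ (fun w => P w) w := fun w => P.differentiableAt
  have P0 : ∀ v w, dirDeriv v (fun w => P w) w = v.2 := fun v w => by
    simp only [dirDeriv, ContinuousLinearMap.fderiv]; rfl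
  -- functions of the space variables
  have dF : ∀ {F : (Fin n → ℝ) → ℝ}, ContDiffOn ℝ ∞ F U → ∀ w ∈ W,
      DifferentiableAt ℝ (fun w : (Option (Fin n) → ℝ) × ℝ => F (spacePart w.1)) w :=
    fun hF w hw => DifferentiableAt.comp w (hF.differentiableAt_of_isOpen hU (hWU w hw))
      spaceProjE.differentiableAt
  have dB : ∀ {F : (Option (Fin n) → ℝ) → ℝ}, ContDiffOn ℝ ∞ F Ω → ∀ w ∈ W,
      DifferentiableAt ℝ (fun w : (Option (Fin n) → ℝ) × ℝ => F w.1) w :=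
    fun hF w hw => DifferentiableAt.comp w (hF.differentiableAt_of_isOpen hΩ (hWΩ w hw))
      differentiableAt_fst
  have B0 : ∀ {F : (Option (Fin n) → ℝ) → ℝ}, ContDiffOn ℝ ∞ F Ω → ∀ w ∈ W, ∀ v,
      dirDeriv v (fun w : (Option (Fin n) → ℝ) × ℝ => F w.1) w = dirDeriv v.1 F w.1 :=
    fun hF w hw v => dirDeriv_comp (ContinuousLinearMap.fst ℝ (Option (Fin n) → ℝ) ℝ)
      (hF.differentiableAt_of_isOpen hΩ (hWΩ w hw))
  have z0 : ∀ {F : (Fin n → ℝ) → ℝ} {y}, dirDeriv 0 F y = 0 := fun {F y} => by simp [dirDeriv]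
  have hτ : ∀ w ∈ W, ∀ v, dirDeriv v (ξ none) w = 2 * (φ * w.1 none + ψ) * T v := by
    intro w hw v
    rw [dirDeriv_congr (g := fun w => (φ * T w + 2 * ψ) * T w + c) hW
      (fun x hx => (h0 x hx).trans
        (by change _ = (φ * x.1 none + _) * x.1 none + c; ring)) hw,
      dirDeriv_add ((((dT w).const_mul φ).add_const _).fun_mul (dT w)) (differentiableAt_const c),
      dirDeriv_mul (((dT w).const_mul φ).add_const _) (dT w),
      dirDeriv_add ((dT w).const_mul φ) (differentiableAt_const _), dirDeriv_const_mul _ (dT w), T0,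
      dirDeriv_const, dirDeriv_const]
    change (φ * T v + 0) * w.1 none + (φ * w.1 none + 2 * ψ) * T v + 0 = _
    ring
  have hξ' : ∀ w ∈ W, ∀ k v, dirDeriv v (ξ (some k)) w =
      dirDeriv (spacePart v.1) (Y k) (spacePart w.1)
      + w.1 none * dirDeriv (spacePart v.1) (Z k) (spacePart w.1)
      + T v * Z k (spacePart w.1) := by
    intro w hw k v
    rw [dirDeriv_congr (g := fun w => Y k (spacePart w.1) + T w * Z k (spacePart w.1)) hW
      (fun x hx => h1 x hx k) hw,
      dirDeriv_add (dF (hY k) w hw) ((dT w).fun_mul (dF (hZ k) w hw)),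
      dirDeriv_mul (dT w) (dF (hZ k) w hw), dirDeriv_spaceFun hU (hY k) (hWU w hw),
      dirDeriv_spaceFun hU (hZ k) (hWU w hw), T0]
    change _ + (_ + w.1 none * _) = _
    ring
  have hη1 : ∀ w ∈ W, ∀ v, dirDeriv v η w =
      (-(1 / 2) * dirDeriv (spacePart v.1) S (spacePart w.1) - 1 / 2 * n * φ * T v) * w.2
      + (-(1 / 2) * S (spacePart w.1) - 1 / 2 * n * φ * w.1 none + a₀) * v.2
      + dirDeriv v.1 b w.1 := by
    intro w hw v
    have d1 := ((dF hS w hw).const_mul (-(1 / 2))).fun_sub ((dT w).const_mul (1 / 2 * n * φ))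
    rw [dirDeriv_congr (g := fun w =>
      (-(1 / 2) * S (spacePart w.1) - 1 / 2 * n * φ * T w + a₀) * P w + b w.1) hW h2 hw,
      dirDeriv_add ((d1.add_const a₀).fun_mul (dP w)) (dB hb w hw),
      dirDeriv_mul (d1.add_const a₀) (dP w), dirDeriv_add d1 (differentiableAt_const _),
      dirDeriv_sub ((dF hS w hw).const_mul _) ((dT w).const_mul _),
      dirDeriv_const_mul _ (dF hS w hw), dirDeriv_const_mul _ (dT w),
      dirDeriv_spaceFun hU hS (hWU w hw), T0, P0, dirDeriv_const, B0 hb w hw, add_zero]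
    rfl
  have hηs : ∀ w ∈ W, ∀ i, dirDeriv (spaceDir i) η w =
      (-(1 / 2) * dirDeriv (Pi.single i 1) S (spacePart w.1)) * w.2
      + dirDeriv (Pi.single (some i) 1) b w.1 := by
    intro w hw i
    rw [hη1 w hw, Ts, spacePart_spaceDir]
    simp [spaceDir, baseDir]
  have hηss : ∀ w ∈ W, ∀ i j, dirDeriv (spaceDir j) (dirDeriv (spaceDir i) η) w =
      (-(1 / 2) * dirDeriv (Pi.single j 1) (dirDeriv (Pi.single i 1) S) (spacePart w.1)) * w.2
      + dirDeriv (Pi.single (some j) 1) (dirDeriv (Pi.single (some i) 1) b) w.1 := by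
    intro w hw i j
    have s1 := hS.dirDeriv hU (Pi.single i 1)
    have s2 := hb.dirDeriv hΩ (Pi.single (some i) 1)
    rw [dirDeriv_congr (g := fun w =>
      (-(1 / 2) * dirDeriv (Pi.single i 1) S (spacePart w.1)) * P w
      + dirDeriv (Pi.single (some i) 1) b w.1) hW (fun x hx => hηs x hx i) hw,
      dirDeriv_add (((dF s1 w hw).const_mul _).fun_mul (dP w)) (dB s2 w hw),
      dirDeriv_mul ((dF s1 w hw).const_mul _) (dP w), dirDeriv_const_mul _ (dF s1 w hw),
      dirDeriv_spaceFun hU s1 (hWU w hw), P0, B0 s2 w hw, spacePart_spaceDir]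
    simp [spaceDir, baseDir, P]
  have hηt : ∀ w ∈ W, dirDeriv timeDir η w =
      -(1 / 2) * n * φ * w.2 + dirDeriv (Pi.single none 1) b w.1 := by
    intro w hw
    rw [hη1 w hw, Tt, spacePart_timeDir, z0]
    simp [timeDir, baseDir]
  have hηu : ∀ w ∈ W, dirDeriv fibreDir η w =
      -(1 / 2) * S (spacePart w.1) - 1 / 2 * n * φ * T w + a₀ := by
    intro w hw
    rw [hη1 w hw, Tu, spacePart_fibreDir, z0]
    simp [fibreDir, dirDeriv, T]
  have hηu1 : ∀ w ∈ W, ∀ v, dirDeriv v (dirDeriv fibreDir η) w =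
      -(1 / 2) * dirDeriv (spacePart v.1) S (spacePart w.1) - 1 / 2 * n * φ * T v := by
    intro w hw v
    have d1 := ((dF hS w hw).const_mul (-(1 / 2))).fun_sub ((dT w).const_mul (1 / 2 * n * φ))
    rw [dirDeriv_congr hW hηu hw, dirDeriv_add d1 (differentiableAt_const _),
      dirDeriv_sub ((dF hS w hw).const_mul _) ((dT w).const_mul _),
      dirDeriv_const_mul _ (dF hS w hw), dirDeriv_const_mul _ (dT w),
      dirDeriv_spaceFun hU hS (hWU w hw), T0, dirDeriv_const, add_zero]
  refine ⟨⟨fun w hw i => ?_, fun w hw => ?_, fun w hw k => ?_, fun w hw i j => ?_⟩, fun w hw => ?_,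
    fun w hw i => ?_, fun w hw => ?_⟩
  · rw [hτ w hw, Ts, mul_zero]
  · rw [hτ w hw, Tu, mul_zero]
  · rw [hξ' w hw, Tu, spacePart_fibreDir, z0, z0]; ring
  · rw [hτ w hw, Tt]
    have e := hLY _ (hWU w hw) i j
    have e' := hLZ _ (hWU w hw) i j
    have e3 : lieDerivMetric (pullMetric G) spaceDir (fun k => ξ (some k)) w i j =
        lieDerivMetric G (fun k => Pi.single k 1) Y (spacePart w.1) i j + w.1 none *
        lieDerivMetric G (fun k => Pi.single k 1) Z (spacePart w.1) i j := by
      simp only [lieDerivMetric, Finset.mul_sum, ← Finset.sum_add_distrib]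
      refine Finset.sum_congr rfl fun k _ => ?_
      have hGk : dirDeriv (spaceDir k) (fun w => pullMetric G w i j) w =
          dirDeriv (Pi.single k 1) (fun y => G y i j) (spacePart w.1) :=
        (dirDeriv_spaceFun hU (hG i j) (hWU w hw) _).trans (by rw [spacePart_spaceDir])
      rw [hGk, hξ' w hw, hξ' w hw, Ts, Ts, spacePart_spaceDir, spacePart_spaceDir, h1 w hw]
      simp only [pullMetric]
      ring
    rw [e3, e, e']
    simp only [pullMetric]
    ring
  · rw [hηu1 w hw, Tu, spacePart_fibreDir, z0]; ring
  · simp only [hηu1 w hw, Ts, spacePart_spaceDir, hξ' w hw, spacePart_timeDir, z0, Tt, mul_zero,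
      sub_zero, add_zero, zero_add, one_mul]
    have e : (fun k => dirDeriv (Pi.single k 1) S (spacePart w.1)) =
        (G (spacePart w.1)).mulVec (fun k => Z k (spacePart w.1)) := by
      funext k; exact (hgrad _ (hWU w hw) k).symm
    -- Raising the index of dS returns Z, so 2 g^{ij} η_{uj} = -Z^i cancels ξ^i_t = Z^i.
    have e2 : ∑ j, (pullMetric G w)⁻¹ i j * dirDeriv (Pi.single j 1) S (spacePart w.1) =
        Z i (spacePart w.1) := by
      change (G (spacePart w.1))⁻¹.mulVec
        (fun k => dirDeriv (Pi.single k 1) S (spacePart w.1)) i = _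
      rw [e, Matrix.mulVec_mulVec, Matrix.nonsing_inv_mul _ (hdet _ (hWU w hw)),
        Matrix.one_mulVec]
    rw [← e2]
    simp only [mul_left_comm _ (-(1 / 2) : ℝ), ← Finset.mul_sum]
    ring
  -- The Laplacian of S is nφ, so the contribution -(1/2) u nφ cancels against the same term in η_t;
  -- b contributes nothing because it solves the equation.
  · have e1 := laplacian_of_homothetic_gradient hU hG hsymm hdet hZ hS hgrad (hWU w hw)
      (hLZ _ (hWU w hw))
    have e2 := hheat _ (hWΩ w hw)
    simp only [heatFun] at e2
    change ∑ i, ∑ j, (G (spacePart w.1))⁻¹ i j *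
        dirDeriv (Pi.single (some j) 1) (dirDeriv (Pi.single (some i) 1) b) w.1
      - ∑ i, tracedChristoffel G (fun k => Pi.single k 1) (spacePart w.1) i
        * dirDeriv (Pi.single (some i) 1) b w.1 - dirDeriv (Pi.single none 1) b w.1 = 0 at e2
    have eΓ : tracedChristoffel (pullMetric G) spaceDir w = _ :=
      tracedChristoffel_pullback hU hG (hWU w hw)
    rw [Fintype.card_fin] at e1
    simp only [heatOperator, hηss w hw, hηs w hw, hηt w hw, eΓ, mul_add, Finset.sum_add_distrib]
    have e3 : ∀ a x y : ℝ, a * (-(1 / 2) * x * y) = -(1 / 2) * y * (a * x) := fun a x y => by ring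
    simp only [e3, ← Finset.mul_sum]
    simp only [pullMetric]
    linear_combination e2 - 1 / 2 * w.2 * e1

end DeterminingConsequences

/-! ### Coordinate expressions on the manifold -/

noncomputable section ChartExpressions

variable {n : ℕ} {M : Type*} [TopologicalSpace M] [ChartedSpace (Fin n → ℝ) M]
  {e : OpenPartialHomeomorph M (Fin n → ℝ)}

theorem vecComp_add (x : M) (v w : TSpace n x) :
    vecComp e x (v + w) = vecComp e x v + vecComp e x w :=
  map_add (mfderiv 𝓘(ℝ, Fin n → ℝ) 𝓘(ℝ, Fin n → ℝ) e x) v w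

theorem vecComp_smul (x : M) (c : ℝ) (v : TSpace n x) :
    vecComp e x (c • v) = c • vecComp e x v :=
  map_smul (mfderiv 𝓘(ℝ, Fin n → ℝ) 𝓘(ℝ, Fin n → ℝ) e x) c v

theorem vecComp_zero (x : M) : vecComp e x (0 : TSpace n x) = 0 :=
  map_zero (mfderiv 𝓘(ℝ, Fin n → ℝ) 𝓘(ℝ, Fin n → ℝ) e x)

section

variable [IsManifold 𝓘(ℝ, Fin n → ℝ) ∞ M]

theorem mdifferentiable_of_chart (he : e ∈ atlas (Fin n → ℝ) M) :
    e.MDifferentiable 𝓘(ℝ, Fin n → ℝ) 𝓘(ℝ, Fin n → ℝ) :=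
  haveI : IsManifold 𝓘(ℝ, Fin n → ℝ) 1 M := IsManifold.of_le (n := ∞) (by simp)
  mdifferentiable_of_mem_atlas he

theorem vecComp_injective (he : e ∈ atlas (Fin n → ℝ) M) {x : M} (hx : x ∈ e.source) :
    Function.Injective (vecComp e x) :=
  (mdifferentiable_of_chart he).mfderiv_injective hx

theorem vecComp_coordVec (he : e ∈ atlas (Fin n → ℝ) M) {y : Fin n → ℝ} (hy : y ∈ e.target)
    (i : Fin n) : vecComp e (e.symm y) (coordVec e y i) = Pi.single i 1 :=
  DFunLike.congr_fun ((mdifferentiable_of_chart he).comp_symm_deriv hy)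
    (Pi.single i (1 : ℝ) : Fin n → ℝ)

theorem sum_vecComp_smul_coordVec (he : e ∈ atlas (Fin n → ℝ) M) {y : Fin n → ℝ}
    (hy : y ∈ e.target) (v : TSpace n (e.symm y)) :
    ∑ i, vecComp e (e.symm y) v i • coordVec e y i = v := by
  apply vecComp_injective he (e.map_target hy)
  have h1 : vecComp e (e.symm y) (∑ i, vecComp e (e.symm y) v i • coordVec e y i) =
      ∑ i, vecComp e (e.symm y) v i • vecComp e (e.symm y) (coordVec e y i) := by
    have := map_sum (mfderiv 𝓘(ℝ, Fin n → ℝ) 𝓘(ℝ, Fin n → ℝ) e (e.symm y))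
      (fun i => vecComp e (e.symm y) v i • coordVec e y i) Finset.univ
    refine this.trans (Finset.sum_congr rfl fun i _ => vecComp_smul _ _ _)
  rw [h1]
  simp only [vecComp_coordVec he hy]
  funext k
  simp [Pi.single_apply]

/-- A kernel vector of the coordinate matrix would be the component vector of a tangent vector
orthogonal to everything. -/
theorem isUnit_det_lower (g : MetricTensor n M) (he : e ∈ atlas (Fin n → ℝ) M) {y : Fin n → ℝ}
    (hy : y ∈ e.target) : IsUnit (g.lower e y).det := by
  rw [isUnit_iff_ne_zero]
  intro h0
  obtain ⟨c, hc, h1⟩ := Matrix.exists_mulVec_eq_zero_iff.2 h0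
  have h2 : ∑ i, c i • coordVec e y i = 0 := by
    refine g.nondegenerate _ _ fun w => ?_
    have h3 : ∀ j, g.form _ (coordVec e y j) (∑ i, c i • coordVec e y i) = 0 := fun j => by
      rw [map_sum]
      refine Eq.trans (Finset.sum_congr rfl fun i _ => ?_) (congrFun h1 j)
      rw [map_smul, smul_eq_mul, mul_comm]
      rfl
    generalize (∑ i, c i • coordVec e y i) = V at h3 ⊢
    rw [g.symm, ← sum_vecComp_smul_coordVec he hy w, map_sum, LinearMap.sum_apply]
    refine Finset.sum_eq_zero fun j _ => ?_
    rw [map_smul, LinearMap.smul_apply, h3, smul_zero]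
  refine hc (funext fun k => ?_)
  have h4 : ∑ i, c i • vecComp e (e.symm y) (coordVec e y i) = 0 := by
    have := congrArg (vecComp e (e.symm y)) h2
    rw [vecComp_zero] at this
    refine Eq.trans ?_ this
    refine Eq.trans (Finset.sum_congr rfl fun i _ => (vecComp_smul _ _ _).symm) ?_
    exact (map_sum (mfderiv 𝓘(ℝ, Fin n → ℝ) 𝓘(ℝ, Fin n → ℝ) e (e.symm y))
      (fun i => c i • coordVec e y i) Finset.univ).symm
  simp only [vecComp_coordVec he hy] at h4
  simpa [Pi.single_apply] using congrFun h4 k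

/-- In a chart, the gradient of `S` satisfies `g_{ik} Y^k = S_{,i}`. -/
theorem MetricTensor.IsGradient.chart {g : MetricTensor n M} {Y : ∀ x : M, TSpace n x} {S : M → ℝ}
    (h : g.IsGradient Y S) (he : e ∈ atlas (Fin n → ℝ) M) :
    ContDiffOn ℝ ∞ (fun y => S (e.symm y)) e.target ∧ ∀ y ∈ e.target, ∀ i,
      ∑ k, g.lower e y i k * vecComp e (e.symm y) (Y (e.symm y)) k =
        dirDeriv (Pi.single i 1) (fun y => S (e.symm y)) y := by
  refine ⟨?_, fun y hy i => ?_⟩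
  · rw [← contMDiffOn_iff_contDiffOn]
    exact h.1.comp_contMDiffOn (contMDiffOn_symm_of_mem_maximalAtlas
      (IsManifold.subset_maximalAtlas he))
  · have h1 := h.2 (e.symm y) (coordVec e y i)
    have h2 : mfderiv 𝓘(ℝ, Fin n → ℝ) 𝓘(ℝ, ℝ) S (e.symm y) (coordVec e y i) =
        dirDeriv (Pi.single i 1) (fun y => S (e.symm y)) y := by
      have := mfderiv_comp y (I' := 𝓘(ℝ, Fin n → ℝ)) ((h.1 (e.symm y)).mdifferentiableAt (by simp))
        ((mdifferentiable_of_chart he).mdifferentiableAt_symm hy)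
      rw [mfderiv_eq_fderiv] at this
      exact (DFunLike.congr_fun this (Pi.single i (1 : ℝ) : Fin n → ℝ)).symm
    rw [← h2, ← h1, g.symm]
    conv_rhs => rw [← sum_vecComp_smul_coordVec he hy (Y (e.symm y))]
    simp only [map_sum, map_smul, smul_eq_mul]
    exact Finset.sum_congr rfl fun k _ => mul_comm _ _

/-- Smoothness is local, and the defining identity is linear in `v`, so coordinate vectors suffice.
-/
theorem MetricTensor.isGradient_of_charts {g : MetricTensor n M} {Y : ∀ x : M, TSpace n x}
    {S : M → ℝ} (h : ∀ e ∈ atlas (Fin n → ℝ) M,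
      ContDiffOn ℝ ∞ (fun y => S (e.symm y)) e.target ∧ ∀ y ∈ e.target, ∀ i,
      ∑ k, g.lower e y i k * vecComp e (e.symm y) (Y (e.symm y)) k =
        dirDeriv (Pi.single i 1) (fun y => S (e.symm y)) y) : g.IsGradient Y S := by
  have hS : ContMDiff 𝓘(ℝ, Fin n → ℝ) 𝓘(ℝ, ℝ) ∞ S := by
    intro x
    set e := chartAt (Fin n → ℝ) x with hedef
    have he : e ∈ atlas (Fin n → ℝ) M := chart_mem_atlas _ x
    have h1 : ContMDiffOn 𝓘(ℝ, Fin n → ℝ) 𝓘(ℝ, ℝ) ∞ (fun y => S (e.symm y)) e.target :=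
      (h e he).1.contMDiffOn
    have h2 : ContMDiffOn 𝓘(ℝ, Fin n → ℝ) 𝓘(ℝ, ℝ) ∞ S e.source :=
      (h1.comp (contMDiffOn_of_mem_maximalAtlas (IsManifold.subset_maximalAtlas he))
        e.mapsTo).congr fun x hx => by simp [e.left_inv hx]
    exact h2.contMDiffAt (e.open_source.mem_nhds (mem_chart_source _ x))
  refine ⟨hS, fun x v => ?_⟩
  obtain ⟨e, he, hx⟩ : ∃ e ∈ atlas (Fin n → ℝ) M, x ∈ e.source :=
    ⟨_, chart_mem_atlas _ x, mem_chart_source _ x⟩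
  obtain ⟨y, hy, rfl⟩ : ∃ y ∈ e.target, e.symm y = x := ⟨e x, e.map_source hx, e.left_inv hx⟩
  rw [← sum_vecComp_smul_coordVec he hy v]
  simp only [map_sum, map_smul, smul_eq_mul]
  refine Finset.sum_congr rfl fun i _ => ?_
  congr 1
  have h2 : mfderiv 𝓘(ℝ, Fin n → ℝ) 𝓘(ℝ, ℝ) S (e.symm y) (coordVec e y i) =
      dirDeriv (Pi.single i 1) (fun y => S (e.symm y)) y := by
    have := mfderiv_comp y (I' := 𝓘(ℝ, Fin n → ℝ)) ((hS (e.symm y)).mdifferentiableAt (by simp))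
      ((mdifferentiable_of_chart he).mdifferentiableAt_symm hy)
    rw [mfderiv_eq_fderiv] at this
    exact (DFunLike.congr_fun this (Pi.single i (1 : ℝ) : Fin n → ℝ)).symm
  rw [h2, ← (h e he).2 y hy i, g.symm]
  conv_lhs => rw [← sum_vecComp_smul_coordVec he hy (Y (e.symm y))]
  simp only [map_sum, map_smul, smul_eq_mul]
  exact Finset.sum_congr rfl fun k _ => mul_comm _ _

/-- Two constants would give (ψ - ψ') g = 0 at a point, where g ≠ 0 because n ≥ 1. -/
theorem MetricTensor.IsHomothetic.const_unique [Nonempty M] (hn : 0 < n) {g : MetricTensor n M}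
    {Y : ∀ x : M, TSpace n x} {ψ ψ' : ℝ} (h : g.IsHomothetic Y ψ) (h' : g.IsHomothetic Y ψ') :
    ψ = ψ' := by
  obtain ⟨x⟩ := ‹Nonempty M›
  have he := chart_mem_atlas (Fin n → ℝ) x
  set e := chartAt (Fin n → ℝ) x
  have hy : e x ∈ e.target := e.map_source (mem_chart_source _ x)
  by_contra hne
  have h0 : g.lower e (e x) = 0 := by
    ext i j
    have := ((h e he).2 _ hy i j).symm.trans ((h' e he).2 _ hy i j)
    have h2 : (ψ - ψ') * g.lower e (e x) i j = 0 := by linarith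
    exact (mul_eq_zero.1 h2).resolve_left (sub_ne_zero.2 hne)
  have hd := isUnit_det_lower g he hy
  have : Nonempty (Fin n) := ⟨⟨0, hn⟩⟩
  rw [h0, Matrix.det_zero] at hd
  exact not_isUnit_zero hd

end

/-- A function on a connected manifold whose partial derivatives vanish is constant. -/
theorem eq_of_partialDeriv_eq_zero [ConnectedSpace M] {f : M → ℝ}
    (h : ∀ e ∈ atlas (Fin n → ℝ) M, ContDiffOn ℝ ∞ (fun y => f (e.symm y)) e.target ∧
      ∀ y ∈ e.target, ∀ i : Fin n, dirDeriv (Pi.single i 1) (fun y => f (e.symm y)) y = 0)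
    (x x' : M) : f x = f x' := by
  have hl : IsLocallyConstant f := by
    rw [IsLocallyConstant.iff_eventually_eq]
    intro x
    have he := chart_mem_atlas (Fin n → ℝ) x
    have hx := mem_chart_source (Fin n → ℝ) x
    set e := chartAt (Fin n → ℝ) x
    obtain ⟨ε, hε, hb⟩ := Metric.isOpen_iff.1 e.open_target (e x) (e.map_source hx)
    have hz : ∀ y ∈ Metric.ball (e x) ε, fderiv ℝ (fun y => f (e.symm y)) y = 0 := by
      intro y hy
      ext v
      have hv : v = ∑ i, v i • (Pi.single i (1 : ℝ) : Fin n → ℝ) := by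
        funext k; simp [Pi.single_apply]
      rw [hv, map_sum]
      refine Finset.sum_eq_zero fun i _ => ?_
      rw [map_smul]
      exact (congrArg _ ((h e he).2 y (hb hy) i)).trans (smul_zero _)
    have hd : DifferentiableOn ℝ (fun y => f (e.symm y)) (Metric.ball (e x) ε) :=
      ((h e he).1.differentiableOn (by simp)).mono hb
    have hc : e ⁻¹' Metric.ball (e x) ε ∈ nhds x :=
      ContinuousAt.preimage_mem_nhds (e.continuousAt hx) (Metric.ball_mem_nhds _ hε)
    filter_upwards [hc, e.open_source.mem_nhds hx] with x' hx' hs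
    have := Metric.isOpen_ball.is_const_of_fderiv_eq_zero (convex_ball (e x) ε).isPreconnected
      hd hz hx' (Metric.mem_ball_self hε)
    simpa [e.left_inv hs, e.left_inv hx] using this
  exact hl.apply_eq_of_preconnectedSpace x x'

theorem MetricTensor.IsHomothetic.linear_combination {g : MetricTensor n M}
    {A B : ∀ x : M, TSpace n x} {α β : ℝ} (hA : g.IsHomothetic A α) (hB : g.IsHomothetic B β)
    (c d : ℝ) : g.IsHomothetic (fun x => c • A x + d • B x) (c * α + d * β) := by
  intro e he
  have sA := (hA e he).1
  have sB := (hB e he).1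
  have e1 : ∀ y, vecComp e (e.symm y) (c • A (e.symm y) + d • B (e.symm y)) =
      c • vecComp e (e.symm y) (A (e.symm y)) + d • vecComp e (e.symm y) (B (e.symm y)) :=
    fun y => by rw [vecComp_add, vecComp_smul, vecComp_smul]
  simp only [e1]
  refine ⟨(sA.const_smul c).add (sB.const_smul d), fun y hy i j => ?_⟩
  have e2 : ∀ k m, partialDeriv m (fun y => (c • vecComp e (e.symm y) (A (e.symm y))
      + d • vecComp e (e.symm y) (B (e.symm y))) k) y =
      c * partialDeriv m (fun y => vecComp e (e.symm y) (A (e.symm y)) k) y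
      + d * partialDeriv m (fun y => vecComp e (e.symm y) (B (e.symm y)) k) y := fun k m => by
    have dA := ((contDiffOn_pi.1 sA) k).differentiableAt_of_isOpen e.open_target hy
    have dB := ((contDiffOn_pi.1 sB) k).differentiableAt_of_isOpen e.open_target hy
    exact (dirDeriv_add (dA.const_mul c) (dB.const_mul d)).trans (congrArg₂ _
      (dirDeriv_const_mul c dA) (dirDeriv_const_mul d dB))
  have hA' := (hA e he).2 y hy i j
  have hB' := (hB e he).2 y hy i j
  simp only [e2]
  rw [mul_add, add_mul, show 2 * (c * α) * g.lower e y i j = c * (2 * α * g.lower e y i j) by ring,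
    show 2 * (d * β) * g.lower e y i j = d * (2 * β * g.lower e y i j) by ring, ← hA', ← hB',
    Finset.mul_sum, Finset.mul_sum, ← Finset.sum_add_distrib]
  refine Finset.sum_congr rfl fun k _ => ?_
  simp only [Pi.add_apply, Pi.smul_apply, smul_eq_mul]
  ring

theorem MetricTensor.isHomothetic_zero (g : MetricTensor n M) :
    g.IsHomothetic (fun x => (0 : TSpace n x)) 0 := by
  intro e he
  simp only [vecComp_zero]
  refine ⟨contDiffOn_const, fun y hy i j => ?_⟩
  simp [partialDeriv]

theorem MetricTensor.IsHomothetic.smul {g : MetricTensor n M} {A : ∀ x : M, TSpace n x} {α : ℝ}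
    (hA : g.IsHomothetic A α) (c : ℝ) : g.IsHomothetic (fun x => c • A x) (c * α) := by
  simpa using hA.linear_combination hA c 0

theorem MetricTensor.IsGradient.smul {g : MetricTensor n M} {Y : ∀ x : M, TSpace n x} {S : M → ℝ}
    (h : g.IsGradient Y S) (c : ℝ) : g.IsGradient (fun x => c • Y x) (fun x => c * S x) := by
  refine ⟨contMDiff_const.mul h.1, fun x v => ?_⟩
  have h1 := h.2 x v
  rw [map_smul, LinearMap.smul_apply, h1]
  have := ((h.1 x).mdifferentiableAt (by simp)).hasMFDerivAt.const_smul c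
  exact (DFunLike.congr_fun this.mfderiv v).symm

theorem MetricTensor.isGradient_zero (g : MetricTensor n M) :
    g.IsGradient (fun x => (0 : TSpace n x)) (fun _ => 0) :=
  ⟨contMDiff_const, fun x v => by
    rw [mfderiv_const, map_zero]; rfl⟩

theorem MetricTensor.IsGradient.eq_add_const [IsManifold 𝓘(ℝ, Fin n → ℝ) ∞ M] [ConnectedSpace M]
    {g : MetricTensor n M} {Y : ∀ x : M, TSpace n x} {S S' : M → ℝ}
    (h : g.IsGradient Y S) (h' : g.IsGradient Y S') : ∃ c, ∀ x, S x = S' x + c := by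
  obtain ⟨x0⟩ := (inferInstance : Nonempty M)
  refine ⟨S x0 - S' x0, fun x => ?_⟩
  have := eq_of_partialDeriv_eq_zero (n := n) (f := fun x => S x - S' x) (fun e he => ?_) x x0
  · linarith
  · obtain ⟨s1, d1⟩ := h.chart he
    obtain ⟨s2, d2⟩ := h'.chart he
    refine ⟨s1.sub s2, fun y hy i => ?_⟩
    rw [dirDeriv_sub (s1.differentiableAt_of_isOpen e.open_target hy)
      (s2.differentiableAt_of_isOpen e.open_target hy), ← d1 y hy, ← d2 y hy, sub_self]

end ChartExpressions

/-! ### The symmetry algebra of the heat equation -/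

section Line

variable {J : Set ℝ}

theorem const_of_hasDerivAt_zero (hJ : IsOpen J) (hJc : J.OrdConnected) {f : ℝ → ℝ}
    (h : ∀ t ∈ J, HasDerivAt f 0 t) : ∃ c, ∀ t ∈ J, f t = c :=
  hJ.exists_is_const_of_deriv_eq_zero hJc.isPreconnected
    (fun t ht => (h t ht).differentiableAt.differentiableWithinAt) (fun t ht => (h t ht).deriv)

theorem affine_of_hasDerivAt (hJ : IsOpen J) (hJc : J.OrdConnected) {f : ℝ → ℝ} {a : ℝ}
    (h : ∀ t ∈ J, HasDerivAt f a t) : ∃ c, ∀ t ∈ J, f t = a * t + c := by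
  obtain ⟨c, hc⟩ := const_of_hasDerivAt_zero hJ hJc (f := fun t => f t - a * t) fun t ht => by
    have := (h t ht).fun_sub ((hasDerivAt_id' t).const_mul a)
    rwa [mul_one, sub_self] at this
  exact ⟨c, fun t ht => by linarith [hc t ht]⟩

theorem affine_of_hasDerivAt_hasDerivAt (hJ : IsOpen J) (hJc : J.OrdConnected) {f f' : ℝ → ℝ}
    (h : ∀ t ∈ J, HasDerivAt f (f' t) t) (h' : ∀ t ∈ J, HasDerivAt f' 0 t) :
    ∃ a c, ∀ t ∈ J, f t = a * t + c ∧ f' t = a := by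
  obtain ⟨a, ha⟩ := const_of_hasDerivAt_zero hJ hJc h'
  obtain ⟨c, hc⟩ := affine_of_hasDerivAt hJ hJc (a := a) fun t ht => ha t ht ▸ h t ht
  exact ⟨a, c, fun t ht => ⟨hc t ht, ha t ht⟩⟩

theorem quadratic_of_hasDerivAt (hJ : IsOpen J) (hJc : J.OrdConnected) {f f' f'' : ℝ → ℝ}
    (h : ∀ t ∈ J, HasDerivAt f (f' t) t) (h' : ∀ t ∈ J, HasDerivAt f' (f'' t) t)
    (h'' : ∀ t ∈ J, HasDerivAt f'' 0 t) :
    ∃ a b c, ∀ t ∈ J, f t = a * t ^ 2 + 2 * b * t + c := by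
  obtain ⟨a, b, hab⟩ := affine_of_hasDerivAt_hasDerivAt hJ hJc h' h''
  obtain ⟨c, hc⟩ := const_of_hasDerivAt_zero hJ hJc
      (f := fun t => f t - (a / 2 * t ^ 2 + b * t)) fun t ht => by
    have := (h t ht).fun_sub ((((hasDerivAt_id' t).fun_pow 2).const_mul (a / 2)).fun_add
      ((hasDerivAt_id' t).const_mul b))
    rw [(hab t ht).1] at this
    exact this.congr_deriv (by norm_num; ring)
  -- With f' = a t + b, halving both coefficients puts f in the normal form whose linear part is
  -- 2ψt.
  exact ⟨a / 2, b / 2, c, fun t ht => by linarith [hc t ht]⟩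

/-- Two distinct times determine a field that is affine in t. -/
theorem exists_ne_mem_of_isOpen (hJ : IsOpen J) {t₀ : ℝ} (h : t₀ ∈ J) : ∃ t₁ ∈ J, t₁ ≠ t₀ := by
  obtain ⟨ε, hε, hb⟩ := Metric.isOpen_iff.1 hJ t₀ h
  refine ⟨t₀ + ε / 2, hb ?_, by simp [hε.ne']⟩
  rw [Metric.mem_ball, Real.dist_eq, add_sub_cancel_left, abs_of_pos (half_pos hε)]
  linarith

end Line

/-! ### Components of a symmetry on the manifold -/

noncomputable section SymmetryAlgebra

variable {n : ℕ} {M : Type*} [TopologicalSpace M] [ChartedSpace (Fin n → ℝ) M]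
  {J : Set ℝ} {e : OpenPartialHomeomorph M (Fin n → ℝ)}

omit [ChartedSpace (Fin n → ℝ) M] in
theorem isOpen_chartDomain (hJ : IsOpen J) (e : OpenPartialHomeomorph M (Fin n → ℝ)) :
    IsOpen (chartDomain J e) :=
  (hJ.preimage (continuous_apply none)).inter (e.open_target.preimage spaceProj.continuous)

/-- The coordinate domain of `J × M × ℝ` given by the chart `e` of `M`. -/
abbrev fullDomain (J : Set ℝ) (e : OpenPartialHomeomorph M (Fin n → ℝ)) :
    Set ((Option (Fin n) → ℝ) × ℝ) := chartDomain J e ×ˢ Set.univ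

omit [ChartedSpace (Fin n → ℝ) M] in
theorem isOpen_fullDomain (hJ : IsOpen J) (e : OpenPartialHomeomorph M (Fin n → ℝ)) :
    IsOpen (fullDomain J e) := (isOpen_chartDomain hJ e).prod isOpen_univ

omit [ChartedSpace (Fin n → ℝ) M] in
theorem txPoint_mem_fullDomain {t : ℝ} (ht : t ∈ J) {y : Fin n → ℝ} (hy : y ∈ e.target) (u : ℝ) :
    (txPoint t y, u) ∈ fullDomain J e := ⟨⟨ht, hy⟩, Set.mem_univ u⟩

theorem contDiff_spaceSlice (t u : ℝ) :
    ContDiff ℝ ∞ (fun y : Fin n → ℝ => ((txPoint t y, u) : (Option (Fin n) → ℝ) × ℝ)) := by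
  rw [funext fun y => (spaceIncl_apply t u y).symm]
  exact contDiff_const.add spaceIncl.contDiff

omit [ChartedSpace (Fin n → ℝ) M] in
theorem contDiffOn_spaceSlice {f : (Option (Fin n) → ℝ) × ℝ → ℝ}
    (hf : ContDiffOn ℝ ∞ f (fullDomain J e)) {t : ℝ} (ht : t ∈ J) (u : ℝ) :
    ContDiffOn ℝ ∞ (fun y => f (txPoint t y, u)) e.target :=
  hf.comp (contDiff_spaceSlice t u).contDiffOn fun _ hy => txPoint_mem_fullDomain ht hy u

namespace PointField.IsHeatSymmetry

variable [IsManifold 𝓘(ℝ, Fin n → ℝ) ∞ M] {g : MetricTensor n M} {X : PointField n M}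

theorem determining [Nonempty (Fin n)] (hJ : IsOpen J) (h : X.IsHeatSymmetry g J)
    (he : e ∈ atlas (Fin n → ℝ) M) :
    DeterminingSystem (g.lower e) (fullDomain J e) (X.baseComp e) (X.fibreComp e) := by
  obtain ⟨hs, hm⟩ := h
  obtain ⟨mult, hmult⟩ := hm e he
  exact DeterminingSystem.of_symmetryCondition e.open_target (isOpen_fullDomain hJ e)
    (fun w hw => hw.1.2) (g.smooth e he) (fun y i j => g.symm _ _ _)
    (fun y hy => isUnit_det_lower g he hy) (hs e he).1 (hs e he).2
    fun w hw => ⟨fun p => mult (w.1, w.2, p), fun p q hq => hmult w.1 hw.1 w.2 p q hq⟩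

theorem τ_fibre [Nonempty (Fin n)] (hJ : IsOpen J) (h : X.IsHeatSymmetry g J) {t : ℝ}
    (ht : t ∈ J) (x : M) (u : ℝ) : X.τ t x u = X.τ t x 0 := by
  obtain ⟨e, he, hx⟩ : ∃ e ∈ atlas (Fin n → ℝ) M, x ∈ e.source :=
    ⟨_, chart_mem_atlas _ x, mem_chart_source _ x⟩
  obtain ⟨y, hy, rfl⟩ : ∃ y ∈ e.target, e.symm y = x := ⟨e x, e.map_source hx, e.left_inv hx⟩
  have hw := txPoint_mem_fullDomain (e := e) ht hy
  have hd : ∀ s, HasDerivAt (fun s => X.baseComp e none (txPoint t y, s)) 0 s := fun s => by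
    rw [← (h.determining hJ he).time_fibre _ (hw s)]
    exact hasDerivAt_fibreSlice
      (((h.1 e he).1 none).differentiableAt_of_isOpen (isOpen_fullDomain hJ e) (hw s))
  exact is_const_of_deriv_eq_zero (fun s => (hd s).differentiableAt) (fun s => (hd s).deriv) u 0

theorem ξ_fibre [Nonempty (Fin n)] (hJ : IsOpen J) (h : X.IsHeatSymmetry g J) {t : ℝ}
    (ht : t ∈ J) (x : M) (u : ℝ) : X.ξ t x u = X.ξ t x 0 := by
  obtain ⟨e, he, hx⟩ : ∃ e ∈ atlas (Fin n → ℝ) M, x ∈ e.source :=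
    ⟨_, chart_mem_atlas _ x, mem_chart_source _ x⟩
  obtain ⟨y, hy, rfl⟩ : ∃ y ∈ e.target, e.symm y = x := ⟨e x, e.map_source hx, e.left_inv hx⟩
  have hw := txPoint_mem_fullDomain (e := e) ht hy
  apply vecComp_injective he hx
  funext k
  have hd : ∀ s, HasDerivAt (fun s => X.baseComp e (some k) (txPoint t y, s)) 0 s := fun s => by
    rw [← (h.determining hJ he).space_fibre _ (hw s) k]
    exact hasDerivAt_fibreSlice
      (((h.1 e he).1 (some k)).differentiableAt_of_isOpen (isOpen_fullDomain hJ e) (hw s))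
  exact is_const_of_deriv_eq_zero (fun s => (hd s).differentiableAt) (fun s => (hd s).deriv) u 0

theorem τ_space [Nonempty (Fin n)] [ConnectedSpace M] (hJ : IsOpen J) (h : X.IsHeatSymmetry g J)
    {t : ℝ} (ht : t ∈ J) (x x' : M) : X.τ t x 0 = X.τ t x' 0 := by
  refine eq_of_partialDeriv_eq_zero (n := n) (f := fun x => X.τ t x 0) (fun e he => ?_) x x'
  have hs := (h.1 e he).1 none
  refine ⟨contDiffOn_spaceSlice hs ht 0, fun y hy i => ?_⟩
  have hw := txPoint_mem_fullDomain (e := e) ht hy 0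
  exact (dirDeriv_spaceSlice (hs.differentiableAt_of_isOpen (isOpen_fullDomain hJ e) hw) i).trans
    ((h.determining hJ he).time_space _ hw i)

theorem exists_τ [Nonempty (Fin n)] [ConnectedSpace M] (hJ : IsOpen J) (hJc : J.OrdConnected)
    (h : X.IsHeatSymmetry g J) :
    ∃ φ ψ c : ℝ, ∀ t ∈ J, ∀ x u, X.τ t x u = φ * t ^ 2 + 2 * ψ * t + c := by
  obtain ⟨x⟩ := (inferInstance : Nonempty M)
  obtain ⟨e, he, hx⟩ : ∃ e ∈ atlas (Fin n → ℝ) M, x ∈ e.source :=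
    ⟨_, chart_mem_atlas _ x, mem_chart_source _ x⟩
  obtain ⟨y, hy, rfl⟩ : ∃ y ∈ e.target, e.symm y = x := ⟨e x, e.map_source hx, e.left_inv hx⟩
  have hw := fun t (ht : t ∈ J) => txPoint_mem_fullDomain (e := e) ht hy 0
  have hW := isOpen_fullDomain hJ e
  have hs := (h.1 e he).1 none
  have hD := h.determining hJ he
  obtain ⟨a, b, c, habc⟩ := quadratic_of_hasDerivAt hJ hJc
    (fun t ht => hasDerivAt_timeSlice (hs.differentiableAt_of_isOpen hW (hw t ht)))
    (fun t ht => hasDerivAt_timeSlice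
      ((hs.dirDeriv hW timeDir).differentiableAt_of_isOpen hW (hw t ht)))
    (fun t ht => by
      have := hasDerivAt_timeSlice
        (((hs.dirDeriv hW timeDir).dirDeriv hW timeDir).differentiableAt_of_isOpen hW (hw t ht))
      rwa [hD.time_third_deriv e.open_target hW (fun w hw => hw.1.2) (g.smooth e he)
        (fun y i j => g.symm _ _ _) (fun y hy => isUnit_det_lower g he hy) (h.1 e he).1
        (h.1 e he).2 (hw t ht)] at this)
  refine ⟨a, b, c, fun t ht x u => ?_⟩
  rw [h.τ_fibre hJ ht, h.τ_space hJ ht x (e.symm y), ← habc t ht]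
  rfl

omit [IsManifold 𝓘(ℝ, Fin n → ℝ) ∞ M] in
theorem time_deriv (hJ : IsOpen J) {φ ψ c : ℝ} (h : X.IsHeatSymmetry g J)
    (hτ : ∀ t ∈ J, ∀ x u, X.τ t x u = φ * t ^ 2 + 2 * ψ * t + c)
    (he : e ∈ atlas (Fin n → ℝ) M) {t : ℝ} (ht : t ∈ J) {y : Fin n → ℝ} (hy : y ∈ e.target)
    (u : ℝ) :
    dirDeriv timeDir (X.baseComp e none) (txPoint t y, u) = 2 * (φ * t + ψ) ∧
    dirDeriv timeDir (dirDeriv timeDir (X.baseComp e none)) (txPoint t y, u) = 2 * φ := by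
  have hW := isOpen_fullDomain hJ e
  have hs := (h.1 e he).1 none
  have h1 : ∀ t ∈ J, dirDeriv timeDir (X.baseComp e none) (txPoint t y, u) =
      2 * (φ * t + ψ) := by
    intro t ht
    have hw := txPoint_mem_fullDomain (e := e) ht hy u
    have d1 := hasDerivAt_timeSlice (hs.differentiableAt_of_isOpen hW hw)
    have d2 : HasDerivAt (fun t : ℝ => φ * t ^ 2 + 2 * ψ * t + c) (2 * (φ * t + ψ)) t := by
      have := ((((hasDerivAt_id' t).fun_pow 2).const_mul φ).fun_add
        ((hasDerivAt_id' t).const_mul (2 * ψ))).add_const c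
      exact this.congr_deriv (by norm_num; ring)
    exact d1.unique (d2.congr_of_eventuallyEq
      (Filter.eventuallyEq_of_mem (hJ.mem_nhds ht) fun s hs => hτ s hs (e.symm y) u))
  refine ⟨h1 t ht, ?_⟩
  have hw := txPoint_mem_fullDomain (e := e) ht hy u
  have d1 := hasDerivAt_timeSlice ((hs.dirDeriv hW timeDir).differentiableAt_of_isOpen hW hw)
  have d2 : HasDerivAt (fun t : ℝ => 2 * (φ * t + ψ)) (2 * φ) t := by
    simpa using (((hasDerivAt_id t).const_mul φ).add_const ψ).const_mul 2
  exact d1.unique (d2.congr_of_eventuallyEq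
    (Filter.eventuallyEq_of_mem (hJ.mem_nhds ht) fun s hs => h1 s hs))

/-- At fixed time the space part of a symmetry is homothetic. -/
theorem isHomothetic_slice [Nonempty (Fin n)] (hJ : IsOpen J) {φ ψ c : ℝ}
    (h : X.IsHeatSymmetry g J)
    (hτ : ∀ t ∈ J, ∀ x u, X.τ t x u = φ * t ^ 2 + 2 * ψ * t + c) {t : ℝ} (ht : t ∈ J) :
    g.IsHomothetic (fun x => X.ξ t x 0) (φ * t + ψ) := by
  intro e he
  have hW := isOpen_fullDomain hJ e
  have hs := fun k => (h.1 e he).1 (some k)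
  refine ⟨contDiffOn_pi.2 fun k => contDiffOn_spaceSlice (hs k) ht 0, fun y hy i j => ?_⟩
  have hw := txPoint_mem_fullDomain (e := e) ht hy 0
  have h1 := (h.determining hJ he).lie _ hw i j
  rw [(h.time_deriv hJ hτ he ht hy 0).1] at h1
  refine Eq.trans (Finset.sum_congr rfl fun k _ => ?_) h1
  have e1 : dirDeriv (spaceDir k) (fun w => pullMetric (g.lower e) w i j) (txPoint t y, 0) =
      dirDeriv (Pi.single k 1) (fun y => g.lower e y i j) y :=
    (dirDeriv_spaceFun e.open_target (g.smooth e he i j) (w := (txPoint t y, (0 : ℝ))) hy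
      _).trans (by rw [spacePart_spaceDir]; rfl)
  have e2 := fun m => dirDeriv_spaceSlice ((hs k).differentiableAt_of_isOpen hW hw) m
  rw [e1, ← e2, ← e2]
  rfl

/-- A consequence of ξ_tt = 0. The slope is recorded also as the time derivative, so that the
gradient equation for ξ_t transfers to Z. -/
theorem ξ_affine [Nonempty (Fin n)] (hJ : IsOpen J) (hJc : J.OrdConnected)
    (h : X.IsHeatSymmetry g J) (he : e ∈ atlas (Fin n → ℝ) M) {y : Fin n → ℝ} (hy : y ∈ e.target)
    (k : Fin n) :
    ∃ a c, ∀ t ∈ J, vecComp e (e.symm y) (X.ξ t (e.symm y) 0) k = a * t + c ∧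
      dirDeriv timeDir (X.baseComp e (some k)) (txPoint t y, 0) = a := by
  have hW := isOpen_fullDomain hJ e
  have hs := (h.1 e he).1 (some k)
  have hw := fun t (ht : t ∈ J) => txPoint_mem_fullDomain (e := e) ht hy 0
  exact affine_of_hasDerivAt_hasDerivAt hJ hJc
    (fun t ht => hasDerivAt_timeSlice (hs.differentiableAt_of_isOpen hW (hw t ht)))
    (fun t ht => by
      have := hasDerivAt_timeSlice
        ((hs.dirDeriv hW timeDir).differentiableAt_of_isOpen hW (hw t ht))
      rwa [(h.determining hJ he).space_timeDeriv_timeDeriv e.open_target hW (fun w hw => hw.1.2)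
        (g.smooth e he) (fun y i j => g.symm _ _ _) (fun y hy => isUnit_det_lower g he hy)
        (h.1 e he).1 (h.1 e he).2 (hw t ht)] at this)

/-- Since η_uu = 0, the coefficient η_u is the increment of η from u = 0 to u = 1, an expression
that needs no chart. -/
theorem η_affine [Nonempty (Fin n)] (hJ : IsOpen J) (h : X.IsHeatSymmetry g J)
    (he : e ∈ atlas (Fin n → ℝ) M) {t : ℝ} (ht : t ∈ J) {y : Fin n → ℝ} (hy : y ∈ e.target)
    (u : ℝ) :
    X.η t (e.symm y) u = (X.η t (e.symm y) 1 - X.η t (e.symm y) 0) * u + X.η t (e.symm y) 0 ∧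
    dirDeriv fibreDir (X.fibreComp e) (txPoint t y, u) =
      X.η t (e.symm y) 1 - X.η t (e.symm y) 0 := by
  have hW := isOpen_fullDomain hJ e
  have hs := (h.1 e he).2
  have hw := txPoint_mem_fullDomain (e := e) ht hy
  obtain ⟨a, c, hac⟩ := affine_of_hasDerivAt_hasDerivAt isOpen_univ Set.ordConnected_univ
    (fun u _ => hasDerivAt_fibreSlice (hs.differentiableAt_of_isOpen hW (hw u)))
    (fun u _ => by
      have := hasDerivAt_fibreSlice
        ((hs.dirDeriv hW fibreDir).differentiableAt_of_isOpen hW (hw u))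
      rwa [(h.determining hJ he).fibre_affine _ (hw u)] at this)
  have hη : ∀ u, X.η t (e.symm y) u = a * u + c := fun u => (hac u (Set.mem_univ u)).1
  refine ⟨by rw [hη, hη, hη]; ring, ?_⟩
  rw [hη, hη, (hac u (Set.mem_univ u)).2]; ring

/-- The slope is -(n/4) τ_tt with τ_tt = 2φ. -/
theorem η_time [Nonempty (Fin n)] (hJ : IsOpen J) (hJc : J.OrdConnected)
    (h : X.IsHeatSymmetry g J) {φ ψ c : ℝ}
    (hτ : ∀ t ∈ J, ∀ x u, X.τ t x u = φ * t ^ 2 + 2 * ψ * t + c) (x : M) :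
    ∃ d, ∀ t ∈ J, X.η t x 1 - X.η t x 0 = -(1 / 2) * n * φ * t + d := by
  obtain ⟨e, he, hx⟩ : ∃ e ∈ atlas (Fin n → ℝ) M, x ∈ e.source :=
    ⟨_, chart_mem_atlas _ x, mem_chart_source _ x⟩
  obtain ⟨y, hy, rfl⟩ : ∃ y ∈ e.target, e.symm y = x := ⟨e x, e.map_source hx, e.left_inv hx⟩
  have hW := isOpen_fullDomain hJ e
  have hs := (h.1 e he).2
  have hw := fun t (ht : t ∈ J) => txPoint_mem_fullDomain (e := e) ht hy 0
  obtain ⟨d, hd⟩ := affine_of_hasDerivAt hJ hJc (a := -(1 / 2) * n * φ)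
    (f := fun t => dirDeriv fibreDir (X.fibreComp e) (txPoint t y, 0)) (fun t ht => by
      have := hasDerivAt_timeSlice
        ((hs.dirDeriv hW fibreDir).differentiableAt_of_isOpen hW (hw t ht))
      rw [(h.determining hJ he).linear_timeDeriv e.open_target hW (fun w hw => hw.1.2)
        (g.smooth e he) (fun y i j => g.symm _ _ _) (fun y hy => isUnit_det_lower g he hy)
        (h.1 e he).1 (h.1 e he).2 (hw t ht), (h.time_deriv hJ hτ he ht hy 0).2] at this
      exact this.congr_deriv (by ring))
  exact ⟨d, fun t ht => by rw [← hd t ht, (h.η_affine hJ he ht hy 0).2]⟩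

/-- The determining equation for η at the fixed value u = 0. -/
theorem isHeatSolution [Nonempty (Fin n)] (hJ : IsOpen J) (h : X.IsHeatSymmetry g J) :
    g.IsHeatSolution J (fun t x => X.η t x 0) := by
  intro e he
  have hW := isOpen_fullDomain hJ e
  have hΩ := isOpen_chartDomain hJ e
  have hs := (h.1 e he).2
  have hb : ContDiffOn ℝ ∞ (fun z => X.fibreComp e (z, 0)) (chartDomain J e) :=
    hs.comp (contDiff_id.prodMk contDiff_const).contDiffOn fun z hz => ⟨hz, Set.mem_univ _⟩
  refine ⟨hb, fun z hz => ?_⟩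
  have hw : ∀ z ∈ chartDomain J e, (z, (0 : ℝ)) ∈ fullDomain J e := fun z hz =>
    ⟨hz, Set.mem_univ _⟩
  have e1 : ∀ a, ∀ z ∈ chartDomain J e, partialDeriv a (fun z => X.fibreComp e (z, 0)) z =
      dirDeriv (baseDir a) (X.fibreComp e) (z, 0) := fun a z hz =>
    dirDeriv_baseSlice (hs.differentiableAt_of_isOpen hW (hw z hz)) a
  have e2 : ∀ a a', partialDeriv a' (partialDeriv a (fun z => X.fibreComp e (z, 0))) z =
      dirDeriv (baseDir a') (dirDeriv (baseDir a) (X.fibreComp e)) (z, 0) := fun a a' =>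
    (dirDeriv_congr hΩ (e1 a) hz).trans (dirDeriv_baseSlice
      ((hs.dirDeriv hW _).differentiableAt_of_isOpen hW (hw z hz)) a')
  have h1 := (h.determining hJ he).heat _ (hw z hz)
  have eΓ : tracedChristoffel (pullMetric (g.lower e)) spaceDir (z, 0) = _ :=
    tracedChristoffel_pullback e.open_target (g.smooth e he) (w := (z, 0)) hz.2
  rw [heatOperator, eΓ] at h1
  change heatFun (g.lower e) (z, X.fibreComp e (z, 0), fun a =>
    partialDeriv a (fun z => X.fibreComp e (z, 0)) z, fun a a' =>
    partialDeriv a' (partialDeriv a (fun z => X.fibreComp e (z, 0))) z) = 0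
  simp only [heatFun, e1 _ z hz, e2]
  exact h1

end PointField.IsHeatSymmetry

end SymmetryAlgebra

/-! ### Classification of the symmetries -/

noncomputable section SymmetryClassification

variable {n : ℕ} {M : Type*} [TopologicalSpace M] [ChartedSpace (Fin n → ℝ) M]
  [IsManifold 𝓘(ℝ, Fin n → ℝ) ∞ M] {J : Set ℝ} {g : MetricTensor n M} {X : PointField n M}

theorem PointField.IsHeatSymmetry.exists_form [Nonempty (Fin n)] [ConnectedSpace M]
    (hJ : IsOpen J) (hJc : J.OrdConnected) {t₀ t₁ : ℝ} (ht₀ : t₀ ∈ J) (ht₁ : t₁ ∈ J)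
    (hne : t₁ ≠ t₀) (h : X.IsHeatSymmetry g J) :
    ∃ (Y Z : ∀ x : M, TSpace n x) (ψ φ : ℝ) (S : M → ℝ) (c a₀ : ℝ) (b : ℝ → M → ℝ),
      g.IsHomothetic Y ψ ∧ g.IsHomothetic Z φ ∧ g.IsGradient Z S ∧ g.IsHeatSolution J b ∧
      ∀ t ∈ J, ∀ x u,
        X.τ t x u = φ * t ^ 2 + 2 * ψ * t + c ∧
        X.ξ t x u = Y x + t • Z x ∧
        X.η t x u = (-(1 / 2) * S x - 1 / 2 * n * φ * t + a₀) * u + b t x := by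
  obtain ⟨φ, ψ, c, hτ⟩ := h.exists_τ hJ hJc
  set δ := (t₁ - t₀)⁻¹ with hδ
  have hδ0 : δ * (t₁ - t₀) = 1 := inv_mul_cancel₀ (sub_ne_zero.2 hne)
  -- Linear interpolation of ξ between the times t₀ and t₁: `Z` is the slope and `Y` the value
  -- extrapolated to t = 0, which need not lie in J. As combinations of two homothetic slices both
  -- are homothetic.
  let Z : ∀ x : M, TSpace n x := fun x => (-δ) • X.ξ t₀ x 0 + δ • X.ξ t₁ x 0
  let Y : ∀ x : M, TSpace n x := fun x => (1 + δ * t₀) • X.ξ t₀ x 0 + (-(δ * t₀)) • X.ξ t₁ x 0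
  have hZ : g.IsHomothetic Z φ := by
    have := (h.isHomothetic_slice hJ hτ ht₀).linear_combination
      (h.isHomothetic_slice hJ hτ ht₁) (-δ) δ
    rwa [show -δ * (φ * t₀ + ψ) + δ * (φ * t₁ + ψ) = φ by linear_combination φ * hδ0] at this
  have hY : g.IsHomothetic Y ψ := by
    have := (h.isHomothetic_slice hJ hτ ht₀).linear_combination
      (h.isHomothetic_slice hJ hτ ht₁) (1 + δ * t₀) (-(δ * t₀))
    rwa [show (1 + δ * t₀) * (φ * t₀ + ψ) + -(δ * t₀) * (φ * t₁ + ψ) = ψ by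
      linear_combination (-t₀ * φ) * hδ0] at this
  have hZc : ∀ e ∈ atlas (Fin n → ℝ) M, ∀ y ∈ e.target, ∀ k, ∀ t ∈ J,
      dirDeriv timeDir (X.baseComp e (some k)) (txPoint t y, 0) =
        vecComp e (e.symm y) (Z (e.symm y)) k := by
    intro e he y hy k t ht
    obtain ⟨a, d, had⟩ := h.ξ_affine hJ hJc he hy k
    simp only [Z, vecComp_add, vecComp_smul, Pi.add_apply, Pi.smul_apply, smul_eq_mul]
    rw [(had t ht).2, (had t₀ ht₀).1, (had t₁ ht₁).1]
    linear_combination (-a) * hδ0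
  have hξ : ∀ t ∈ J, ∀ x u, X.ξ t x u = Y x + t • Z x := by
    intro t ht x u
    rw [h.ξ_fibre hJ ht]
    obtain ⟨e, he, hx⟩ : ∃ e ∈ atlas (Fin n → ℝ) M, x ∈ e.source :=
      ⟨_, chart_mem_atlas _ x, mem_chart_source _ x⟩
    obtain ⟨y, hy, rfl⟩ : ∃ y ∈ e.target, e.symm y = x := ⟨e x, e.map_source hx, e.left_inv hx⟩
    apply vecComp_injective he hx
    funext k
    obtain ⟨a, d, had⟩ := h.ξ_affine hJ hJc he hy k
    simp only [Y, Z, vecComp_add, vecComp_smul, Pi.add_apply, Pi.smul_apply, smul_eq_mul]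
    rw [(had t ht).1, (had t₀ ht₀).1, (had t₁ ht₁).1]
    linear_combination (a * (t₀ - t)) * hδ0
  -- The potential -2η_u is frozen at t₀; at other times it differs by a function of t only.
  have hS : g.IsGradient Z (fun x => -2 * (X.η t₀ x 1 - X.η t₀ x 0)) := by
    refine MetricTensor.isGradient_of_charts fun e he => ?_
    have hW := isOpen_fullDomain hJ e
    have hs := (h.1 e he).2
    have e1 : ∀ y ∈ e.target, -2 * (X.η t₀ (e.symm y) 1 - X.η t₀ (e.symm y) 0) =
        -2 * dirDeriv fibreDir (X.fibreComp e) (txPoint t₀ y, 0) := fun y hy => by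
      rw [(h.η_affine hJ he ht₀ hy 0).2]
    have s1 := contDiffOn_spaceSlice (hs.dirDeriv hW fibreDir) ht₀ 0
    refine ⟨(contDiffOn_const.mul s1).congr e1, fun y hy i => ?_⟩
    have hw := txPoint_mem_fullDomain (e := e) ht₀ hy 0
    have h1 := (h.determining hJ he).gradient (fun w hw => hw.1.2)
      (fun y hy => isUnit_det_lower g he hy) hw i
    rw [dirDeriv_congr e.open_target e1 hy,
      dirDeriv_const_mul _ (s1.differentiableAt_of_isOpen e.open_target hy),
      dirDeriv_spaceSlice ((hs.dirDeriv hW _).differentiableAt_of_isOpen hW hw), ← h1]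
    refine Finset.sum_congr rfl fun k _ => ?_
    rw [hZc e he y hy k t₀ ht₀]
    rfl
  -- The constant `a₀` compensates the value of -(1/2) nφt at t₀, where S was defined.
  refine ⟨Y, Z, ψ, φ, _, c, 1 / 2 * n * φ * t₀, fun t x => X.η t x 0, hY, hZ, hS,
    h.isHeatSolution hJ, fun t ht x u => ⟨hτ t ht x u, hξ t ht x u, ?_⟩⟩
  obtain ⟨d, hd⟩ := h.η_time hJ hJc hτ x
  have h1 : X.η t x u = (X.η t x 1 - X.η t x 0) * u + X.η t x 0 := by
    obtain ⟨e, he, hx⟩ : ∃ e ∈ atlas (Fin n → ℝ) M, x ∈ e.source :=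
      ⟨_, chart_mem_atlas _ x, mem_chart_source _ x⟩
    obtain ⟨y, hy, rfl⟩ : ∃ y ∈ e.target, e.symm y = x := ⟨e x, e.map_source hx, e.left_inv hx⟩
    exact (h.η_affine hJ he ht hy u).1
  rw [h1, hd t ht, hd t₀ ht₀]
  ring

/-- A homothetic field and a homothetic gradient field define a symmetry. -/
theorem MetricTensor.isHeatSymmetry_of_form (hJ : IsOpen J) {Y Z : ∀ x : M, TSpace n x}
    {ψ φ : ℝ} {S : M → ℝ} {c a₀ : ℝ} {b : ℝ → M → ℝ}
    (hY : g.IsHomothetic Y ψ) (hZ : g.IsHomothetic Z φ) (hS : g.IsGradient Z S)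
    (hb : g.IsHeatSolution J b)
    (hX : ∀ t ∈ J, ∀ x u,
        X.τ t x u = φ * t ^ 2 + 2 * ψ * t + c ∧
        X.ξ t x u = Y x + t • Z x ∧
        X.η t x u = (-(1 / 2) * S x - 1 / 2 * n * φ * t + a₀) * u + b t x) :
    X.IsHeatSymmetry g J := by
  have h0 : ∀ e : OpenPartialHomeomorph M (Fin n → ℝ), ∀ w ∈ fullDomain J e,
      X.baseComp e none w = φ * w.1 none ^ 2 + 2 * ψ * w.1 none + c := fun e w hw =>
    (hX _ hw.1.1 _ _).1
  have h1 : ∀ e : OpenPartialHomeomorph M (Fin n → ℝ), ∀ w ∈ fullDomain J e, ∀ k,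
      X.baseComp e (some k) w =
      vecComp e (e.symm (spacePart w.1)) (Y (e.symm (spacePart w.1))) k
      + w.1 none * vecComp e (e.symm (spacePart w.1)) (Z (e.symm (spacePart w.1))) k := by
    intro e w hw k
    have := congrArg (fun v => vecComp e (e.symm (spacePart w.1)) v k)
      (hX _ hw.1.1 (e.symm (spacePart w.1)) w.2).2.1
    simp only [vecComp_add, vecComp_smul, Pi.add_apply, Pi.smul_apply, smul_eq_mul] at this
    exact this
  have h2 : ∀ e : OpenPartialHomeomorph M (Fin n → ℝ), ∀ w ∈ fullDomain J e,
      X.fibreComp e w = (-(1 / 2) * S (e.symm (spacePart w.1)) - 1 / 2 * n * φ * w.1 none + a₀)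
        * w.2 + b (w.1 none) (e.symm (spacePart w.1)) := fun e w hw =>
    (hX _ hw.1.1 _ _).2.2
  have sT : ∀ e : OpenPartialHomeomorph M (Fin n → ℝ),
      ContDiffOn ℝ ∞ (fun w : (Option (Fin n) → ℝ) × ℝ => w.1 none) (fullDomain J e) := fun e =>
    ((contDiff_apply ℝ ℝ (none : Option (Fin n))).comp contDiff_fst).contDiffOn
  have hs : X.IsSmooth J := by
    intro e he
    have pull : ∀ {F : (Fin n → ℝ) → ℝ}, ContDiffOn ℝ ∞ F e.target → ContDiffOn ℝ ∞
        (fun w : (Option (Fin n) → ℝ) × ℝ => F (spacePart w.1)) (fullDomain J e) := fun hF =>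
      hF.comp spaceProjE.contDiff.contDiffOn fun w hw => hw.1.2
    have sY := fun k => contDiffOn_pi.1 (hY e he).1 k
    have sZ := fun k => contDiffOn_pi.1 (hZ e he).1 k
    refine ⟨fun k => ?_, ?_⟩
    · cases k with
      | none =>
        exact (((contDiffOn_const.mul ((sT e).pow 2)).add (contDiffOn_const.mul (sT e))).add
          contDiffOn_const).congr (h0 e)
      | some k =>
        exact ((pull (sY k)).add ((sT e).mul (pull (sZ k)))).congr fun w hw => h1 e w hw k
    · exact (((((contDiffOn_const.mul (pull (hS.chart he).1)).sub
        (contDiffOn_const.mul (sT e))).add contDiffOn_const).mul contDiff_snd.contDiffOn).add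
        ((hb e he).1.comp contDiff_fst.contDiffOn fun w hw => hw.1)).congr (h2 e)
  refine ⟨hs, fun e he => ?_⟩
  have hD : DeterminingSystem (g.lower e) (fullDomain J e) (X.baseComp e) (X.fibreComp e) :=
    DeterminingSystem.of_homothetic e.open_target (isOpen_fullDomain hJ e) (fun w hw => hw.1.2)
      (g.smooth e he) (fun y i j => g.symm _ _ _) (fun y hy => isUnit_det_lower g he hy)
      (isOpen_chartDomain hJ e) (fun w hw => hw.1)
      (fun k => contDiffOn_pi.1 (hY e he).1 k) (fun k => contDiffOn_pi.1 (hZ e he).1 k)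
      (hS.chart he).1 (hb e he).1 (hY e he).2 (hZ e he).2 (hS.chart he).2 (hb e he).2
      (h0 e) (h1 e) (h2 e)
  refine ⟨fun a => dirDeriv fibreDir (X.fibreComp e) (a.1, a.2.1)
    - dirDeriv timeDir (X.baseComp e none) (a.1, a.2.1), fun z hz u p q hq => ?_⟩
  exact hD.prolongApply_eq e.open_target (isOpen_fullDomain hJ e) (fun w hw => hw.1.2)
    (g.smooth e he) (fun y i j => g.symm _ _ _) (fun y hy => isUnit_det_lower g he hy)
    (hs e he).1 (hs e he).2 (z := z) (u := u) ⟨hz, Set.mem_univ u⟩ p q hq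

-- J is not assumed nonempty; over empty J every condition at t ∈ J is vacuous, but a solution b
-- must still be supplied.
omit [IsManifold 𝓘(ℝ, Fin n → ℝ) ∞ M] in
theorem MetricTensor.isHeatSolution_of_isEmpty (g : MetricTensor n M) (hJ : J = ∅) :
    g.IsHeatSolution J (fun _ _ => 0) := fun e _ =>
  ⟨contDiffOn_const, fun z hz => by rw [hJ] at hz; exact hz.1.elim⟩

/-- The Lie point symmetries of the heat equation. -/
theorem isHeatSymmetry_iff [ConnectedSpace M] (hn : 0 < n) (hJ : IsOpen J)
    (hJc : J.OrdConnected) :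
    X.IsHeatSymmetry g J ↔
    ∃ (Y Z : ∀ x : M, TSpace n x) (ψ φ : ℝ) (S : M → ℝ) (c a₀ : ℝ) (b : ℝ → M → ℝ),
      g.IsHomothetic Y ψ ∧ g.IsHomothetic Z φ ∧ g.IsGradient Z S ∧ g.IsHeatSolution J b ∧
      ∀ t ∈ J, ∀ x u,
        X.τ t x u = φ * t ^ 2 + 2 * ψ * t + c ∧
        X.ξ t x u = Y x + t • Z x ∧
        X.η t x u = (-(1 / 2) * S x - 1 / 2 * n * φ * t + a₀) * u + b t x := by
  constructor
  · intro h
    have : Nonempty (Fin n) := ⟨⟨0, hn⟩⟩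
    rcases J.eq_empty_or_nonempty with h0 | ⟨t₀, ht₀⟩
    · exact ⟨_, _, 0, 0, _, 0, 0, _, g.isHomothetic_zero, g.isHomothetic_zero, g.isGradient_zero,
        g.isHeatSolution_of_isEmpty h0, fun t ht => by rw [h0] at ht; exact ht.elim⟩
    · obtain ⟨t₁, ht₁, hne⟩ := exists_ne_mem_of_isOpen hJ ht₀
      exact h.exists_form hJ hJc ht₀ ht₁ hne
  · rintro ⟨Y, Z, ψ, φ, S, c, a₀, b, hY, hZ, hS, hb, hX⟩
    exact MetricTensor.isHeatSymmetry_of_form hJ hY hZ hS hb hX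

/-- If the space part of a symmetry is proportional to the homothetic field `Y`, then so are its
coefficients. -/
theorem PointField.IsHeatSymmetry.exists_proportional_form [ConnectedSpace M] (hn : 0 < n)
    (hJ : IsOpen J) (hJc : J.OrdConnected) (hJ0 : J.Nonempty) (h : X.IsHeatSymmetry g J)
    {Y : ∀ x : M, TSpace n x} {ψ : ℝ} (hY : g.IsHomothetic Y ψ) {T : ℝ → ℝ}
    (hT : ∀ t ∈ J, ∀ x u, X.ξ t x u = T t • Y x) :
    ∃ (κ ν : ℝ) (S : M → ℝ) (c a₀ : ℝ) (b : ℝ → M → ℝ),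
      g.IsGradient (fun x => κ • Y x) S ∧ g.IsHeatSolution J b ∧
      ∀ t ∈ J, ∀ x u,
        X.τ t x u = κ * ψ * t ^ 2 + 2 * (ν * ψ) * t + c ∧
        X.ξ t x u = (κ * t + ν) • Y x ∧
        X.η t x u = (-(1 / 2) * S x - 1 / 2 * n * (κ * ψ) * t + a₀) * u + b t x := by
  obtain ⟨A, B, α, β, S, c, a₀, b, hA, hB, hS, hb, hX⟩ := (isHeatSymmetry_iff hn hJ hJc).1 h
  obtain ⟨t₀, ht₀⟩ := hJ0
  obtain ⟨t₁, ht₁, hne⟩ := exists_ne_mem_of_isOpen hJ ht₀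
  set δ := (t₁ - t₀)⁻¹ with hδ
  have hδ0 : δ * (t₁ - t₀) = 1 := inv_mul_cancel₀ (sub_ne_zero.2 hne)
  -- Slope and intercept of the affine function through the values of T at t₀ and t₁. Nothing is
  -- assumed of T, and where Y vanishes its values are irrelevant.
  set κ := δ * (T t₁ - T t₀) with hκ
  set ν := T t₀ - κ * t₀ with hν
  have e : ∀ t ∈ J, ∀ x, A x + t • B x = T t • Y x := fun t ht x =>
    ((hX t ht x 0).2.1).symm.trans (hT t ht x 0)
  have eB : B = fun x => κ • Y x := by
    funext x
    have h1 : (t₁ - t₀) • B x = (T t₁ - T t₀) • Y x := by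
      rw [sub_smul, sub_smul, ← e t₁ ht₁, ← e t₀ ht₀]; abel
    rw [hκ, mul_smul, ← h1, smul_smul, hδ0, one_smul]
  have eA : A = fun x => ν • Y x := by
    funext x
    rw [hν, sub_smul, ← e t₀ ht₀, eB, smul_smul, mul_comm t₀ κ, add_sub_cancel_right]
  have : Nonempty M := inferInstance
  have hβ : β = κ * ψ := hB.const_unique hn (eB ▸ hY.smul κ)
  have hα : α = ν * ψ := hA.const_unique hn (eA ▸ hY.smul ν)
  refine ⟨κ, ν, S, c, a₀, b, eB ▸ hS, hb, fun t ht x u => ?_⟩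
  obtain ⟨h1, h2, h3⟩ := hX t ht x u
  refine ⟨by rw [h1, hα, hβ], ?_, by rw [h3, hβ]⟩
  rw [h2, eA, eB, smul_smul, ← add_smul]
  congr 1
  ring

theorem isHeatSymmetry_nongradient_iff [ConnectedSpace M] (hn : 0 < n) (hJ : IsOpen J)
    (hJc : J.OrdConnected) {Y : ∀ x : M, TSpace n x} {ψ : ℝ} (hY : g.IsHomothetic Y ψ)
    (hng : ¬ ∃ S, g.IsGradient Y S) :
    (X.IsHeatSymmetry g J ∧ ∃ T : ℝ → ℝ, ∀ t ∈ J, ∀ x u, X.ξ t x u = T t • Y x) ↔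
    ∃ (c₁ c₂ a₀ : ℝ) (b : ℝ → M → ℝ), g.IsHeatSolution J b ∧
      ∀ t ∈ J, ∀ x u,
        X.τ t x u = 2 * ψ * c₁ * t + c₂ ∧
        X.ξ t x u = c₁ • Y x ∧
        X.η t x u = a₀ * u + b t x := by
  constructor
  · rintro ⟨h, T, hT⟩
    rcases J.eq_empty_or_nonempty with h0 | hJ0
    · exact ⟨0, 0, 0, _, g.isHeatSolution_of_isEmpty h0,
        fun t ht => by rw [h0] at ht; exact ht.elim⟩
    obtain ⟨κ, ν, S, c, a₀, b, hS, hb, hX⟩ :=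
      h.exists_proportional_form hn hJ hJc hJ0 hY hT
    -- Otherwise S/κ would be a potential of the nongradient field Y.
    have hκ : κ = 0 := by
      by_contra hκ
      refine hng ⟨fun x => κ⁻¹ * S x, ?_⟩
      have := hS.smul κ⁻¹
      simpa only [smul_smul, inv_mul_cancel₀ hκ, one_smul] using this
    subst hκ
    simp only [zero_smul] at hS
    -- With κ = 0 the potential has zero gradient, so it is a constant d, absorbed in the
    -- coefficient of u.
    obtain ⟨d, hd⟩ := hS.eq_add_const g.isGradient_zero
    refine ⟨ν, c, a₀ - 1 / 2 * d, b, hb, fun t ht x u => ?_⟩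
    obtain ⟨h1, h2, h3⟩ := hX t ht x u
    refine ⟨by rw [h1]; ring, by rw [h2, zero_mul, zero_add], ?_⟩
    rw [h3, hd]; ring
  · rintro ⟨c₁, c₂, a₀, b, hb, hX⟩
    refine ⟨(isHeatSymmetry_iff hn hJ hJc).2 ⟨_, _, _, _, _, c₂, a₀, b, hY.smul c₁,
      g.isHomothetic_zero, g.isGradient_zero, hb, fun t ht x u => ?_⟩, fun _ => c₁,
      fun t ht x u => (hX t ht x u).2.1⟩
    obtain ⟨h1, h2, h3⟩ := hX t ht x u
    refine ⟨by rw [h1]; ring, by rw [h2, smul_zero, add_zero], by rw [h3]; ring⟩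

theorem isHeatSymmetry_gradient_iff [ConnectedSpace M] (hn : 0 < n) (hJ : IsOpen J)
    (hJc : J.OrdConnected) {Y : ∀ x : M, TSpace n x} {ψ : ℝ} {S : M → ℝ}
    (hY : g.IsHomothetic Y ψ) (hS : g.IsGradient Y S) :
    (X.IsHeatSymmetry g J ∧ ∃ T : ℝ → ℝ, ∀ t ∈ J, ∀ x u, X.ξ t x u = T t • Y x) ↔
    ∃ (c₃ c₄ c₅ c₆ : ℝ) (b : ℝ → M → ℝ), g.IsHeatSolution J b ∧
      ∀ t ∈ J, ∀ x u,
        X.τ t x u = c₃ * ψ * t ^ 2 + 2 * c₄ * ψ * t + c₅ ∧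
        X.ξ t x u = (c₃ * t + c₄) • Y x ∧
        X.η t x u = (-(c₃ / 2) * S x - c₃ / 2 * n * ψ * t + c₆) * u + b t x := by
  constructor
  · rintro ⟨h, T, hT⟩
    rcases J.eq_empty_or_nonempty with h0 | hJ0
    · exact ⟨0, 0, 0, 0, _, g.isHeatSolution_of_isEmpty h0,
        fun t ht => by rw [h0] at ht; exact ht.elim⟩
    obtain ⟨κ, ν, S', c, a₀, b, hS', hb, hX⟩ :=
      h.exists_proportional_form hn hJ hJc hJ0 hY hT
    -- Both `S'` and κS are potentials of κY, so they differ by a constant, absorbed in `c₆`.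
    obtain ⟨d, hd⟩ := hS'.eq_add_const (hS.smul κ)
    refine ⟨κ, ν, c, a₀ - 1 / 2 * d, b, hb, fun t ht x u => ?_⟩
    obtain ⟨h1, h2, h3⟩ := hX t ht x u
    refine ⟨by rw [h1]; ring, h2, ?_⟩
    rw [h3, hd]; ring
  · rintro ⟨c₃, c₄, c₅, c₆, b, hb, hX⟩
    refine ⟨(isHeatSymmetry_iff hn hJ hJc).2 ⟨_, _, _, _, _, c₅, c₆, b, hY.smul c₄,
      hY.smul c₃, hS.smul c₃, hb, fun t ht x u => ?_⟩, fun t => c₃ * t + c₄,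
      fun t ht x u => (hX t ht x u).2.1⟩
    obtain ⟨h1, h2, h3⟩ := hX t ht x u
    refine ⟨by rw [h1]; ring, ?_, by rw [h3]; ring⟩
    rw [h2, smul_smul, ← add_smul]
    congr 1
    ring

end SymmetryClassification

theorem mainTheorem3 {n : ℕ} (hn : 0 < n) {M : Type*} [TopologicalSpace M]
    [ChartedSpace (Fin n → ℝ) M] [IsManifold 𝓘(ℝ, Fin n → ℝ) ∞ M] [ConnectedSpace M]
    (g : MetricTensor n M) (J : Set ℝ) (hJo : IsOpen J) (hJc : J.OrdConnected) :
    -- nongradient homothetic or Killing vectors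
    (∀ (Y : ∀ x : M, TSpace n x) (ψ : ℝ), g.IsHomothetic Y ψ → (¬ ∃ S, g.IsGradient Y S) →
      ∀ X : PointField n M,
        (X.IsHeatSymmetry g J ∧ ∃ T : ℝ → ℝ, ∀ t ∈ J, ∀ x u, X.ξ t x u = T t • Y x) ↔
        ∃ (c₁ c₂ a₀ : ℝ) (b : ℝ → M → ℝ), g.IsHeatSolution J b ∧
          ∀ t ∈ J, ∀ x u,
            X.τ t x u = 2 * ψ * c₁ * t + c₂ ∧
            X.ξ t x u = c₁ • Y x ∧
            X.η t x u = a₀ * u + b t x) ∧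
    -- gradient homothetic or Killing vectors
    (∀ (Y : ∀ x : M, TSpace n x) (ψ : ℝ) (S : M → ℝ), g.IsHomothetic Y ψ → g.IsGradient Y S →
      ∀ X : PointField n M,
        (X.IsHeatSymmetry g J ∧ ∃ T : ℝ → ℝ, ∀ t ∈ J, ∀ x u, X.ξ t x u = T t • Y x) ↔
        ∃ (c₃ c₄ c₅ c₆ : ℝ) (b : ℝ → M → ℝ), g.IsHeatSolution J b ∧
          ∀ t ∈ J, ∀ x u,
            X.τ t x u = c₃ * ψ * t ^ 2 + 2 * c₄ * ψ * t + c₅ ∧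
            X.ξ t x u = (c₃ * t + c₄) • Y x ∧
            X.η t x u = (-(c₃ / 2) * S x - c₃ / 2 * n * ψ * t + c₆) * u + b t x) ∧
    -- every Lie point symmetry is composed of these
    (∀ X : PointField n M, X.IsHeatSymmetry g J ↔
      ∃ (Y Z : ∀ x : M, TSpace n x) (ψ φ : ℝ) (S : M → ℝ) (c a₀ : ℝ) (b : ℝ → M → ℝ),
        g.IsHomothetic Y ψ ∧ g.IsHomothetic Z φ ∧ g.IsGradient Z S ∧ g.IsHeatSolution J b ∧
        ∀ t ∈ J, ∀ x u,
          X.τ t x u = φ * t ^ 2 + 2 * ψ * t + c ∧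
          X.ξ t x u = Y x + t • Z x ∧
          X.η t x u = (-(1 / 2) * S x - 1 / 2 * n * φ * t + a₀) * u + b t x) :=
  ⟨fun _ _ hY hng _ => isHeatSymmetry_nongradient_iff hn hJo hJc hY hng,
    fun _ _ _ hY hS _ => isHeatSymmetry_gradient_iff hn hJo hJc hY hS,
    fun _ => isHeatSymmetry_iff hn hJo hJc⟩
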